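/- Consider one point charge of unit mass and charge in $\mathbb R^3$, with position $\xi(t)$ and velocity $\eta(t)$, interacting repulsively with a plasma with distribution $f(x,v,t)$. For $g:\mathbb R^3\times\mathbb R^3\to\mathbb R$ write $\rho_g(x)=\int g(x,v)\,dv$ and $E_g(x)=\int \frac{x-y}{|x-y|^3}\rho_g(y)\,dy$, and abbreviate $\rho(\cdot,t)=\rho_{f(\cdot,\cdot,t)}$, $E(\cdot,t)=E_{f(\cdot,\cdot,t)}$. Let $\xi_0,\eta_0\in\mathbb R^3$ and let $f_0\in L^\infty(\mathbb R^3\times\mathbb R^3)$ be a compactly supported probability density such that, for some $\delta_0>0$, $|x-\xi_0|\ge\delta_0$ for all $(x,v)\in\operatorname{supp} f_0$. A solution on $[0,T]$ with datum $(\xi_0,\eta_0,f_0)$ consists of $\xi\in C^2([0,T])$ and $f\in L^\infty([0,T],L^1\cap L^\infty)$ with $\rho\in L^\infty([0,T],L^\infty)$ (the norms being bounded uniformly in $t\in[0,T]$), such that $\dot\xi=\eta$, $\dot\eta(t)=E(\xi(t),t)$ on $[0,T]$, $(\xi,\eta)(0)=(\xi_0,\eta_0)$, together with an invertible flow $(X,V)(\cdot,\cdot,\tau,t):(\mathbb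 R^3\setminus\{\xi(\tau)\})\times\mathbb R^3\to(\mathbb R^3\setminus\{\xi(t)\})\times\mathbb R^3$, $\tau,t\in[0,T]$, such that $f(X(x,v,0,t),V(x,v,0,t),t)=f_0(x,v)$ for all $x\ne\xi_0$, $v\in\mathbb R^3$, $t\in[0,T]$, and such that there is $\delta>0$ for which, for all $\tau,t\in[0,T]$ and $(x,v)\in\operatorname{supp} f(\tau)$, with $(X,V)(t)=(X,V)(x,v,\tau,t)$, $$|X(t)-\xi(t)|\ge\delta,\qquad \dot X(t)=V(t),\qquad \dot V(t)=E(X(t),t)+\frac{X(t)-\xi(t)}{|X(t)-\xi(t)|^3},\qquad (X,V)(\tau)=(x,v).$$ Let $$H=\frac12\int|v|^2f_0\,dx\,dv+\frac12|\eta_0|^2+\int\frac{\rho_{f_0}(x)}{|x-\xi_0|}\,dx+\frac12\iint\frac{\rho_{f_0}(x)\rho_{f_0}(y)}{|x-y|}\,dx\,dy$$ be the total energy, let $K_1\ge\max(8H,1)$, and let $$h(x,v,t)=\frac{|v-\eta(t)|^2}{2}+\frac1{|x-\xi(t)|}+K_1,$$ $$Q_0=\sup\{\sqrt{h(x,v,0)}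 : (x,v)\in\operatorname{supp}f_0\},$$ $$Q_T=\sup\{\sqrt{h(X(x,v,0,t),V(x,v,0,t),t)} : t\in[0,T],\ (x,v)\in\operatorname{supp}f_0\}.$$ Then there is a constant $C_1>0$, depending only on $\|f_0\|_{L^\infty}$ and $H$, such that for every $T>0$ and every solution on $[0,T]$ with datum $(\xi_0,\eta_0,f_0)$ the suprema $Q_0$ and $Q_T$ are finite and $$Q_T\le (Q_0+C_1)\exp\bigl(C_1(1+T)\bigr).$$ -/

import Mathlib

open MeasureTheory Set
open scoped NNReal ENNReal

noncomputable section

namespace PlasmaCharge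

/-- Physical space `ℝ³` with the Euclidean norm. -/
abbrev Space : Type := EuclideanSpace ℝ (Fin 3)

/-- Phase space: a point is `z = (x, v)`. -/
abbrev Phase : Type := Space × Space

/-- The Coulomb field `x / |x|³` of a unit charge at the origin. -/
def coulomb (x : Space) : Space := (‖x‖ ^ 3)⁻¹ • x

/-- The spatial density `ρ(x) = ∫ g(x, v) dv`. -/
def density (g : Phase → ℝ) (x : Space) : ℝ := ∫ v, g (x, v)

/-- The electric field `E(x) = ∫ (x - y) / |x - y|³ ρ(y) dy` of the plasma. -/
def electricField (g : Phase → ℝ) (x : Space) : Space :=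
  ∫ y, density g y • coulomb (x - y)

/-- The total energy of a plasma with distribution `g` and one unit charge at `ξ` with
velocity `η`. -/
def totalEnergy (g : Phase → ℝ) (ξ η : Space) : ℝ :=
  (1 / 2) * (∫ z : Phase, ‖z.2‖ ^ 2 * g z) + (1 / 2) * ‖η‖ ^ 2
    + (∫ x, density g x / ‖x - ξ‖)
    + (1 / 2) * (∫ x, ∫ y, density g x * density g y / ‖x - y‖)

/-- The phase points whose position is not that of the charge. -/
def awayFrom (ξ : Space) : Set Phase := {z | z.1 ≠ ξ}

/-- Initial data: `f₀` is a bounded, compactly supported probability density whose support is at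
positive distance from the initial position `ξ₀` of the charge. -/
structure IsInitialDatum (f₀ : Phase → ℝ) (ξ₀ : Space) : Prop where
  memLp_top : MemLp f₀ ∞ volume
  nonneg : ∀ z, 0 ≤ f₀ z
  integral_eq_one : ∫ z, f₀ z = 1
  hasCompactSupport : HasCompactSupport f₀
  away : ∃ δ₀ : ℝ, 0 < δ₀ ∧ ∀ z ∈ tsupport f₀, δ₀ ≤ ‖z.1 - ξ₀‖

/-- `(ξ, f)` is a solution on `[0, T]`, with charge velocity `η` and flow `φ`, of the
Vlasov–Poisson system with one point charge and initial datum `(ξ₀, η₀, f₀)`. Here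
`φ τ t (x, v) = (X(x, v, τ, t), V(x, v, τ, t))` is the state at time `t` of the plasma particle
that is at `(x, v)` at time `τ`, and `f t (x, v)` is `f(x, v, t)`. -/
structure IsSolution (T : ℝ) (f₀ : Phase → ℝ) (ξ₀ η₀ : Space)
    (ξ η : ℝ → Space) (f : ℝ → Phase → ℝ) (φ : ℝ → ℝ → Phase → Phase) : Prop where
  /-- `ξ ∈ C²([0,T])`. -/
  contDiffOn : ContDiffOn ℝ 2 ξ (Icc 0 T)
  /-- `f ∈ L^∞([0,T], L¹ ∩ L^∞)` and `ρ ∈ L^∞([0,T], L^∞)`. -/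
  aestronglyMeasurable : AEStronglyMeasurable (fun p : ℝ × Phase => f p.1 p.2)
    ((volume.restrict (Icc 0 T)).prod volume)
  aestronglyMeasurable_apply : ∀ t ∈ Icc 0 T, AEStronglyMeasurable (f t) volume
  bounded : ∃ M : ℝ≥0, ∀ t ∈ Icc 0 T, eLpNorm (f t) 1 volume ≤ M ∧
    eLpNorm (f t) ∞ volume ≤ M ∧ eLpNorm (density (f t)) ∞ volume ≤ M
  /-- The motion of the charge. -/
  hasDeriv_ξ : ∀ t ∈ Icc 0 T, HasDerivWithinAt ξ (η t) (Icc 0 T) t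
  hasDeriv_η : ∀ t ∈ Icc 0 T, HasDerivWithinAt η (electricField (f t) (ξ t)) (Icc 0 T) t
  ξ_zero : ξ 0 = ξ₀
  η_zero : η 0 = η₀
  /-- `φ` is an invertible flow: `φ τ t` maps `(ℝ³ ∖ {ξ(τ)}) × ℝ³` to `(ℝ³ ∖ {ξ(t)}) × ℝ³` with
  inverse `φ t τ`. -/
  flow_mapsTo : ∀ τ ∈ Icc 0 T, ∀ t ∈ Icc 0 T, MapsTo (φ τ t) (awayFrom (ξ τ)) (awayFrom (ξ t))
  flow_self : ∀ τ ∈ Icc 0 T, ∀ z ∈ awayFrom (ξ τ), φ τ τ z = z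
  flow_comp : ∀ τ ∈ Icc 0 T, ∀ s ∈ Icc 0 T, ∀ t ∈ Icc 0 T, ∀ z ∈ awayFrom (ξ τ),
    φ s t (φ τ s z) = φ τ t z
  /-- `f` is transported by the flow. -/
  transport : ∀ t ∈ Icc 0 T, ∀ z ∈ awayFrom (ξ 0), f t (φ 0 t z) = f₀ z
  /-- Plasma particles stay at positive distance from the charge on `[0,T]`. -/
  lower : ∃ δ : ℝ, 0 < δ ∧ ∀ τ ∈ Icc 0 T, ∀ t ∈ Icc 0 T, ∀ z ∈ tsupport (f τ),
    δ ≤ ‖(φ τ t z).1 - ξ t‖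
  /-- The motion of the plasma particles. -/
  flow_init : ∀ τ ∈ Icc 0 T, ∀ z ∈ tsupport (f τ), φ τ τ z = z
  hasDeriv_X : ∀ τ ∈ Icc 0 T, ∀ z ∈ tsupport (f τ), ∀ t ∈ Icc 0 T,
    HasDerivWithinAt (fun s => (φ τ s z).1) (φ τ t z).2 (Icc 0 T) t
  hasDeriv_V : ∀ τ ∈ Icc 0 T, ∀ z ∈ tsupport (f τ), ∀ t ∈ Icc 0 T,
    HasDerivWithinAt (fun s => (φ τ s z).2)
      (electricField (f t) (φ τ t z).1 + coulomb ((φ τ t z).1 - ξ t)) (Icc 0 T) t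

/-- The energy `h = |v - η|² / 2 + 1 / |x - ξ| + K₁` of a plasma particle `z = (x, v)` when the
charge is at `ξ` with velocity `η`. -/
def particleEnergy (K₁ : ℝ) (ξ η : Space) (z : Phase) : ℝ :=
  ‖z.2 - η‖ ^ 2 / 2 + 1 / ‖z.1 - ξ‖ + K₁

/-- The values `√h(X(t), V(t), t)` for `t ∈ [0,T]` along the trajectories that start in
`supp f₀`. -/
def trajectoryValues (K₁ T : ℝ) (f₀ : Phase → ℝ) (ξ η : ℝ → Space)
    (φ : ℝ → ℝ → Phase → Phase) : Set ℝ :=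
  {q | ∃ t ∈ Icc 0 T, ∃ z ∈ tsupport f₀, q = √(particleEnergy K₁ (ξ t) (η t) (φ 0 t z))}

/-- The values `√h(x, v, 0)` for `(x, v) ∈ supp f₀`. -/
def initialValues (K₁ : ℝ) (f₀ : Phase → ℝ) (ξ₀ η₀ : Space) : Set ℝ :=
  {q | ∃ z ∈ tsupport f₀, q = √(particleEnergy K₁ ξ₀ η₀ z)}

end PlasmaCharge

end

noncomputable section

namespace PlasmaCharge

/-! ### The Coulomb kernel -/

/-! The quantity to follow is `√h`. In the frame of the charge the singular repulsion derives from
the potential `1/|x-ξ|`, so it cancels in `dh/dt = ⟨v-η, E(x)-E(ξ)⟩`, and `√h` grows by at most the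
time integral of `|E(x)|+|E(ξ)|` (`sqrt_particleEnergy_le`). If `√h ≤ Q` and this integral over
`[a,b]` is at most `C(Q(b-a)+1)`, then on a time interval of fixed length the energies at most
double, up to a constant, and iteration gives the exponential.

The field at the charge is controlled by a virial argument. The mean over the plasma of the radial
component of `V`, seen from the charge, is bounded by the energy; its derivative contains the mean
of `1/|X-ξ|²`, and the other terms are bounded below. Hence the mean of `1/|X-ξ|²`, which dominates
`|E(ξ)|`, has a bounded time integral (`integral_integral_charge_inv_sq_le`).

For the field along a trajectory put `q = Q^(1/12)`, so that speeds relative to the charge are at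
most `2q^12`. A set of velocities in a ball of radius `P`, with bounded phase density and kinetic
energy, produces a field of order `P^(4/3)` (`lintegral_slow_le`). With `P = q^9` this is of order
`Q`, which settles the particles that are slow, either absolutely or relative to the given one.
Particles closer than `q^(-24)` also contribute order `Q`. The rest are fast. During a time `q^(-8)`
a particle cannot become fast unless its energy was already of order `q^18` at the start, so by
Markov's inequality the fast particles have mass of order `q^(-18)`. A second virial argument, for
pairs of particles and a smoothed distance, bounds the time integral of `1/|x-y|²` over the times of
large relative velocity by order `q^18` (`integral_pairKernel_le`, `lintegral_pairKernel_le`). The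
product is a constant per time `q^(-8)`, hence at most order `Q` per unit of time
(`integral_field_le`).

All this needs two a priori facts: the phase density stays below `‖f₀‖_∞`, and kinetic and potential
energies stay below multiples of `H`. A solution comes only with an invertible flow along which `f`
is constant; the field is merely log-Lipschitz, so the Jacobian of the flow cannot be
differentiated. Instead the flow is a pointwise limit, on short times, of symplectic Euler schemes,
which preserve volume exactly; Fatou's lemma shows that neither the flow nor its inverse increases
the image measure, so both preserve it (`preservesVolume`). The energy bound comes from smoothing
the interaction and removing the smoothing at the end (`outerEnergy_le`).

The numbers `δ`, `D`, `B` attached to a solution only justify integrability and differentiation; the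
final constants involve `M = ‖f₀‖_∞` and `H` alone. -/

theorem norm_coulomb (x : Space) : ‖coulomb x‖ = (‖x‖ ^ 2)⁻¹ := by
  unfold coulomb
  rw [norm_smul, norm_inv, norm_pow, norm_norm]
  rcases eq_or_ne ‖x‖ 0 with h | h
  · simp [h]
  · field_simp

theorem coulomb_neg (x : Space) : coulomb (-x) = -coulomb x := by
  simp [coulomb]

@[fun_prop]
theorem measurable_coulomb : Measurable coulomb := by
  unfold coulomb
  fun_prop

/-- The Coulomb field of a unit charge smeared inside the ball of radius `ε`. -/
def cutCoulomb (ε : ℝ) (x : Space) : Space := (max ‖x‖ ε ^ 3)⁻¹ • x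

theorem continuous_cutCoulomb {ε : ℝ} (hε : 0 < ε) : Continuous (cutCoulomb ε) := by
  unfold cutCoulomb
  refine Continuous.smul (Continuous.inv₀ ((continuous_norm.max continuous_const).pow 3)
    fun x => ?_) continuous_id
  have : 0 < max ‖x‖ ε := lt_max_of_lt_right hε
  exact (pow_pos this 3).ne'

theorem cutCoulomb_eq_coulomb {ε : ℝ} {x : Space} (h : ε ≤ ‖x‖) : cutCoulomb ε x = coulomb x := by
  unfold cutCoulomb coulomb
  rw [max_eq_left h]

theorem norm_cutCoulomb_le {ε : ℝ} (hε : 0 < ε) (x : Space) : ‖cutCoulomb ε x‖ ≤ (ε ^ 2)⁻¹ := by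
  unfold cutCoulomb
  have h0 : 0 < max ‖x‖ ε := lt_max_of_lt_right hε
  rw [norm_smul, norm_inv, norm_pow, Real.norm_of_nonneg h0.le]
  calc (max ‖x‖ ε ^ 3)⁻¹ * ‖x‖ ≤ (max ‖x‖ ε ^ 3)⁻¹ * max ‖x‖ ε := by
        gcongr; exact le_max_left _ _
    _ = (max ‖x‖ ε ^ 2)⁻¹ := by field_simp
    _ ≤ (ε ^ 2)⁻¹ := by gcongr; exact le_max_right _ _

/-- The two fields agree outside the ball; inside, the cut one points the same way and is shorter,
so the difference is at most the kernel itself. -/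
theorem norm_coulomb_sub_cutCoulomb_le {ε : ℝ} (hε : 0 < ε) (x : Space) :
    ‖coulomb x - cutCoulomb ε x‖ ≤ (Iio ε).indicator (fun r => (r ^ 2)⁻¹) ‖x‖ := by
  by_cases h : ‖x‖ < ε
  · rw [indicator_of_mem (by exact h), ← norm_coulomb]
    unfold coulomb cutCoulomb
    rw [max_eq_right h.le, ← sub_smul, norm_smul, norm_smul]
    rcases eq_or_ne x 0 with rfl | hx
    · simp
    · have hx' : 0 < ‖x‖ := norm_pos_iff.2 hx
      gcongr
      have h1 : (ε ^ 3)⁻¹ ≤ (‖x‖ ^ 3)⁻¹ := by gcongr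
      have h2 : 0 < (ε ^ 3)⁻¹ := by positivity
      rw [Real.norm_of_nonneg (by linarith), Real.norm_of_nonneg (by positivity)]
      linarith
  · rw [cutCoulomb_eq_coulomb (not_lt.1 h)]
    simp [indicator, h]

/-- The gradient is of order `max(|x|, ε)^(-3)`. Comparing the two endpoints algebraically, rather
than by the mean value theorem, avoids the segment between them, which may pass near the origin. -/
theorem norm_cutCoulomb_sub_le {ε : ℝ} (hε : 0 < ε) (a b : Space) :
    ‖cutCoulomb ε a - cutCoulomb ε b‖
      ≤ 4 * ‖a - b‖ * ((max ‖a‖ ε ^ 3)⁻¹ + (max ‖b‖ ε ^ 3)⁻¹) := by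
  unfold cutCoulomb
  set A := max ‖a‖ ε with hA
  set B := max ‖b‖ ε with hB
  have hA0 : 0 < A := lt_max_of_lt_right hε
  have hB0 : 0 < B := lt_max_of_lt_right hε
  have hbB : ‖b‖ ≤ B := le_max_left _ _
  have hAB : |A - B| ≤ ‖a - b‖ := by
    refine (abs_max_sub_max_le_abs _ _ _).trans (abs_norm_sub_norm_le a b)
  have hdec : (A ^ 3)⁻¹ • a - (B ^ 3)⁻¹ • b = (A ^ 3)⁻¹ • (a - b) + ((A ^ 3)⁻¹ - (B ^ 3)⁻¹) • b := by
    rw [smul_sub, sub_smul]; abel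
  have hdiff : (A ^ 3)⁻¹ - (B ^ 3)⁻¹ = (B - A) * ((A ^ 2 + A * B + B ^ 2) / (A ^ 3 * B ^ 3)) := by
    field_simp; ring
  have h3 : (A ^ 2 + A * B + B ^ 2) / (A ^ 3 * B ^ 3) * B ≤ 3 * ((A ^ 3)⁻¹ + (B ^ 3)⁻¹) := by
    have : 3 * ((A ^ 3)⁻¹ + (B ^ 3)⁻¹) - (A ^ 2 + A * B + B ^ 2) / (A ^ 3 * B ^ 3) * B
        = (3 * (A ^ 3 + B ^ 3) - (A ^ 2 + A * B + B ^ 2) * B) / (A ^ 3 * B ^ 3) := by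
      field_simp
      ring
    have h2 : 0 ≤ (3 * (A ^ 3 + B ^ 3) - (A ^ 2 + A * B + B ^ 2) * B) / (A ^ 3 * B ^ 3) := by
      apply div_nonneg _ (by positivity)
      -- The numerator equals `(A + B)(A - B)² + 2A³ + B³`.
      nlinarith [mul_nonneg (add_pos hA0 hB0).le (sq_nonneg (A - B)), pow_pos hA0 3, pow_pos hB0 3]
    linarith
  rw [hdec]
  calc ‖(A ^ 3)⁻¹ • (a - b) + ((A ^ 3)⁻¹ - (B ^ 3)⁻¹) • b‖
      ≤ (A ^ 3)⁻¹ * ‖a - b‖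
        + |A - B| * ((A ^ 2 + A * B + B ^ 2) / (A ^ 3 * B ^ 3)) * ‖b‖ := by
        refine (norm_add_le _ _).trans (le_of_eq ?_)
        rw [norm_smul, norm_smul, hdiff, Real.norm_of_nonneg (by positivity), norm_mul,
          Real.norm_of_nonneg (r := (A ^ 2 + A * B + B ^ 2) / (A ^ 3 * B ^ 3)) (by positivity),
          Real.norm_eq_abs, abs_sub_comm]
    _ ≤ (A ^ 3)⁻¹ * ‖a - b‖
        + ‖a - b‖ * ((A ^ 2 + A * B + B ^ 2) / (A ^ 3 * B ^ 3)) * B := by gcongr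
    _ ≤ (A ^ 3)⁻¹ * ‖a - b‖ + ‖a - b‖ * (3 * ((A ^ 3)⁻¹ + (B ^ 3)⁻¹)) := by
        rw [mul_assoc]; gcongr
    _ ≤ _ := by
        have : 0 ≤ ‖a - b‖ * (B ^ 3)⁻¹ := by positivity
        nlinarith

theorem norm_cutCoulomb_sub_le_lipschitz {ε : ℝ} (hε : 0 < ε) (a b : Space) :
    ‖cutCoulomb ε a - cutCoulomb ε b‖ ≤ 8 * (ε ^ 3)⁻¹ * ‖a - b‖ := by
  refine (norm_cutCoulomb_sub_le hε a b).trans ?_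
  have h1 : (max ‖a‖ ε ^ 3)⁻¹ ≤ (ε ^ 3)⁻¹ := by gcongr; exact le_max_right _ _
  have h2 : (max ‖b‖ ε ^ 3)⁻¹ ≤ (ε ^ 3)⁻¹ := by gcongr; exact le_max_right _ _
  nlinarith [norm_nonneg (a - b)]

/-! ### Integrals of radial functions -/

theorem lintegral_radial_le {g : ℝ → ℝ} (hg : ∀ r, 0 ≤ g r) {c : ℝ}
    (hI : IntegrableOn (fun r => r ^ 2 * g r) (Ioi 0))
    (hc : 4 * Real.pi * ∫ r in Ioi (0 : ℝ), r ^ 2 * g r ≤ c) (x : Space) :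
    ∫⁻ y, ENNReal.ofReal (g ‖x - y‖) ≤ ENNReal.ofReal c := by
  rw [lintegral_sub_left_eq_self (fun y : Space => ENNReal.ofReal (g ‖y‖)) x]
  have hintg : Integrable (fun y : Space => g ‖y‖) := by
    rw [integrable_fun_norm_addHaar volume]
    simpa using hI
  rw [← ofReal_integral_eq_lintegral_ofReal hintg (ae_of_all _ fun y => hg _)]
  apply ENNReal.ofReal_le_ofReal
  rw [integral_fun_norm_addHaar volume]
  have : (volume : Measure Space).real (Metric.ball 0 1) = 4 * Real.pi / 3 := by
    simp [Measure.real, EuclideanSpace.volume_ball_fin_three]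
    rw [ENNReal.toReal_ofReal (by positivity)]; ring
  rw [this]
  simp only [finrank_euclideanSpace, Fintype.card_fin, nsmul_eq_mul, smul_eq_mul]
  refine le_trans (le_of_eq ?_) hc
  norm_num
  ring

theorem lintegral_inv_sq_lt_le {l : ℝ} (hl : 0 ≤ l) (x : Space) :
    ∫⁻ y, ENNReal.ofReal ((Iio l).indicator (fun r => (r ^ 2)⁻¹) ‖x - y‖)
      ≤ ENNReal.ofReal (4 * Real.pi * l) := by
  have e : EqOn (fun r : ℝ => r ^ 2 * (Iio l).indicator (fun r => (r ^ 2)⁻¹) r)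
      ((Iio l).indicator fun _ => 1) (Ioi 0) := by
    intro r hr
    by_cases h : r < l
    · simp [indicator, h, (show r ≠ 0 from ne_of_gt hr)]
    · simp [indicator, h]
  refine lintegral_radial_le (g := (Iio l).indicator (fun r => (r ^ 2)⁻¹))
    (fun r => indicator_nonneg (fun _ _ => by positivity) _) ?_ ?_ x
  · rw [integrableOn_congr_fun e measurableSet_Ioi]
    rw [IntegrableOn, integrable_indicator_iff measurableSet_Iio]
    simp [IntegrableOn, Measure.restrict_restrict, Iio_inter_Ioi]
  · rw [setIntegral_congr_fun measurableSet_Ioi e, integral_indicator measurableSet_Iio]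
    simp [Measure.restrict_restrict, Iio_inter_Ioi, Measure.real, hl]

/-- The power five is two from the Coulomb kernel plus three from the volume of a velocity ball
whose radius is inversely proportional to the distance. -/
theorem lintegral_inv_pow_five_ge_le {l : ℝ} (hl : 0 < l) (x : Space) :
    ∫⁻ y, ENNReal.ofReal ((Ici l).indicator (fun r => (r ^ 5)⁻¹) ‖x - y‖)
      ≤ ENNReal.ofReal (2 * Real.pi * (l ^ 2)⁻¹) := by
  have e : EqOn (fun r : ℝ => r ^ 2 * (Ici l).indicator (fun r => (r ^ 5)⁻¹) r)
      ((Ici l).indicator fun r => r ^ (-3 : ℝ)) (Ioi 0) := by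
    intro r hr
    have hr' : (0 : ℝ) < r := hr
    by_cases h : l ≤ r
    · simp only [indicator, mem_Ici, h, if_true]
      rw [Real.rpow_neg hr'.le]
      norm_cast
      field_simp
    · simp [indicator, h]
  have hs : Ici l ∩ Ioi 0 = Ici l := inter_eq_left.2 fun r hr => lt_of_lt_of_le hl hr
  refine lintegral_radial_le (g := (Ici l).indicator (fun r => (r ^ 5)⁻¹))
    (fun r => indicator_nonneg (fun r hr => ?_) _) ?_ ?_ x
  · have : 0 < r := lt_of_lt_of_le hl hr
    positivity
  · rw [integrableOn_congr_fun e measurableSet_Ioi]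
    rw [IntegrableOn, integrable_indicator_iff measurableSet_Ici, IntegrableOn,
      Measure.restrict_restrict measurableSet_Ici, hs]
    exact (integrableOn_Ici_iff_integrableOn_Ioi (by simp)).2
      (integrableOn_Ioi_rpow_of_lt (by norm_num) hl)
  · rw [setIntegral_congr_fun measurableSet_Ioi e, integral_indicator measurableSet_Ici,
      Measure.restrict_restrict measurableSet_Ici, hs, integral_Ici_eq_integral_Ioi,
      integral_Ioi_rpow_of_lt (by norm_num) hl]
    apply le_of_eq
    have : (-3 + 1 : ℝ) = -2 := by norm_num
    rw [this, Real.rpow_neg hl.le]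
    norm_cast
    field_simp
    norm_num

/-- The gradient of the kernel just fails to be integrable at the origin. In polar coordinates the
core contributes at most `1` and the shell `[ε, 1)` contributes `∫ dr/r`; this logarithm is the one
in the modulus of continuity of the field. -/
theorem lintegral_inv_pow_three_le {ε : ℝ} (hε : 0 < ε) (hε1 : ε ≤ 1) (x : Space) :
    ∫⁻ y, ENNReal.ofReal ((Iio 1).indicator (fun r => (max r ε ^ 3)⁻¹) ‖x - y‖)
      ≤ ENNReal.ofReal (4 * Real.pi * (1 + Real.log ε⁻¹)) := by
  have hle : ∀ r ∈ Ioi (0 : ℝ), r ^ 2 * (Iio 1).indicator (fun r => (max r ε ^ 3)⁻¹) r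
      ≤ (Iio ε).indicator (fun _ => ε⁻¹) r + (Ico ε 1).indicator (fun r => r⁻¹) r := by
    intro r hr
    have hr' : (0 : ℝ) < r := hr
    by_cases h1 : r < ε
    · have h2 : r < 1 := h1.trans_le hε1
      simp only [indicator, mem_Iio, h1, h2, if_true, max_eq_right h1.le, mem_Ico, not_le.2 h1,
        false_and, if_false, add_zero]
      rw [← div_eq_mul_inv, div_le_iff₀ (by positivity)]
      have : ε⁻¹ * ε ^ 3 = ε ^ 2 := by field_simp
      rw [this]; gcongr
    · by_cases h2 : r < 1
      · simp only [indicator, mem_Iio, h1, h2, if_true, max_eq_left (not_lt.1 h1), mem_Ico,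
          not_lt.1 h1, true_and, if_false, zero_add]
        apply le_of_eq; field_simp
      · simp [indicator, h1, h2]
  have hi1 : IntegrableOn ((Iio ε).indicator (fun _ : ℝ => ε⁻¹)) (Ioi 0) := by
    rw [IntegrableOn, integrable_indicator_iff measurableSet_Iio]
    simp [IntegrableOn, Measure.restrict_restrict, Iio_inter_Ioi]
  have hs : Ico ε 1 ∩ Ioi 0 = Ico ε 1 := inter_eq_left.2 fun r hr => lt_of_lt_of_le hε hr.1
  have hii : IntervalIntegrable (fun r : ℝ => r⁻¹) volume ε 1 := by
    refine intervalIntegral.intervalIntegrable_inv (fun r hr => ?_) continuousOn_id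
    rw [uIcc_of_le hε1] at hr
    exact (lt_of_lt_of_le hε hr.1).ne'
  have hi2 : IntegrableOn ((Ico ε 1).indicator (fun r : ℝ => r⁻¹)) (Ioi 0) := by
    rw [IntegrableOn, integrable_indicator_iff measurableSet_Ico, IntegrableOn,
      Measure.restrict_restrict measurableSet_Ico, hs]
    exact (intervalIntegrable_iff_integrableOn_Ico_of_le hε1).1 hii
  have hi3 : IntegrableOn (fun r => r ^ 2 * (Iio 1).indicator (fun r => (max r ε ^ 3)⁻¹) r)
      (Ioi 0) := by
    refine Integrable.mono' (hi1.add hi2) ?_ ?_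
    · refine Measurable.aestronglyMeasurable ?_
      refine Measurable.mul (by fun_prop) (Measurable.indicator (by fun_prop) measurableSet_Iio)
    · refine (ae_restrict_iff' measurableSet_Ioi).2 (ae_of_all _ fun r hr => ?_)
      rw [Real.norm_of_nonneg]
      · exact hle r hr
      · exact mul_nonneg (by positivity) (indicator_nonneg (fun r _ => by positivity) _)
  refine lintegral_radial_le (g := (Iio 1).indicator (fun r => (max r ε ^ 3)⁻¹))
    (fun r => indicator_nonneg (fun r hr => by positivity) _) hi3 ?_ x
  gcongr
  calc _ ≤ ∫ r in Ioi (0 : ℝ), ((Iio ε).indicator (fun _ => ε⁻¹) r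
          + (Ico ε 1).indicator (fun r => r⁻¹) r) :=
        setIntegral_mono_on hi3 (hi1.add hi2) measurableSet_Ioi hle
    _ = 1 + Real.log ε⁻¹ := by
        rw [integral_add hi1 hi2, integral_indicator measurableSet_Iio,
          integral_indicator measurableSet_Ico, Measure.restrict_restrict measurableSet_Ico, hs,
          integral_Ico_eq_integral_Ioc, ← intervalIntegral.integral_of_le hε1,
          integral_inv_of_pos hε one_pos]
        simp [Measure.restrict_restrict, Iio_inter_Ioi, Measure.real, hε.le, hε.ne']

end PlasmaCharge
end

noncomputable section

namespace PlasmaCharge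

/-! ### The field of a charge distribution with bounded density -/

section BoundedDensity

variable {σ : Measure Space} {D m : ℝ}

theorem lintegral_le_of_le_smul {α : Type*} [MeasurableSpace α] {ν μ : Measure α} {g : α → ℝ≥0∞}
    {c : ℝ} (hD : 0 ≤ D) (hν : ν ≤ ENNReal.ofReal D • μ) (hg : ∫⁻ y, g y ∂μ ≤ ENNReal.ofReal c) :
    ∫⁻ y, g y ∂ν ≤ ENNReal.ofReal (D * c) := by
  calc ∫⁻ y, g y ∂ν ≤ ∫⁻ y, g y ∂(ENNReal.ofReal D • μ) := lintegral_mono' hν le_rfl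
    _ = ENNReal.ofReal D * ∫⁻ y, g y ∂μ := by rw [lintegral_smul_measure]; rfl
    _ ≤ ENNReal.ofReal D * ENNReal.ofReal c := by gcongr
    _ = _ := (ENNReal.ofReal_mul hD).symm

theorem lintegral_inv_sq_lt_le_of_le (hD : 0 ≤ D) (hσ : σ ≤ ENNReal.ofReal D • volume)
    {l : ℝ} (hl : 0 ≤ l) (x : Space) :
    ∫⁻ y, ENNReal.ofReal ((Iio l).indicator (fun r => (r ^ 2)⁻¹) ‖x - y‖) ∂σ
      ≤ ENNReal.ofReal (D * (4 * Real.pi * l)) :=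
  lintegral_le_of_le_smul hD hσ (lintegral_inv_sq_lt_le hl x)

/-- Within distance one the bounded density controls the kernel, beyond it the total mass does. -/
theorem lintegral_inv_sq_le_of_le (hD : 0 ≤ D) (hm : 0 ≤ m)
    (hσ : σ ≤ ENNReal.ofReal D • volume) (hmass : σ univ ≤ ENNReal.ofReal m) (x : Space) :
    ∫⁻ y, ENNReal.ofReal ((‖x - y‖ ^ 2)⁻¹) ∂σ ≤ ENNReal.ofReal (4 * Real.pi * D + m) := by
  calc ∫⁻ y, ENNReal.ofReal ((‖x - y‖ ^ 2)⁻¹) ∂σ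
      ≤ ∫⁻ y, (ENNReal.ofReal ((Iio 1).indicator (fun r => (r ^ 2)⁻¹) ‖x - y‖) + 1) ∂σ := by
        refine lintegral_mono fun y => ?_
        by_cases h : ‖x - y‖ < 1
        · simp [indicator, h]
        · simp only [indicator, mem_Iio, h, if_false, ENNReal.ofReal_zero, zero_add]
          rw [ENNReal.ofReal_le_one]
          exact inv_le_one_of_one_le₀ (one_le_pow₀ (not_lt.1 h))
    _ = ∫⁻ y, ENNReal.ofReal ((Iio 1).indicator (fun r => (r ^ 2)⁻¹) ‖x - y‖) ∂σ + σ univ := by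
        rw [lintegral_add_right _ measurable_const]; simp
    _ ≤ ENNReal.ofReal (D * (4 * Real.pi * 1)) + ENNReal.ofReal m := by
        gcongr
        exact lintegral_inv_sq_lt_le_of_le hD hσ zero_le_one x
    _ = _ := by
        rw [← ENNReal.ofReal_add (by positivity) hm]; congr 1; ring

theorem lintegral_enorm_coulomb_le (hD : 0 ≤ D) (hm : 0 ≤ m)
    (hσ : σ ≤ ENNReal.ofReal D • volume) (hmass : σ univ ≤ ENNReal.ofReal m) (x : Space) :
    ∫⁻ y, ‖coulomb (x - y)‖ₑ ∂σ ≤ ENNReal.ofReal (4 * Real.pi * D + m) := by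
  refine le_trans (le_of_eq ?_) (lintegral_inv_sq_le_of_le hD hm hσ hmass x)
  refine lintegral_congr fun y => ?_
  rw [← ofReal_norm, norm_coulomb]

theorem integrable_coulomb (hD : 0 ≤ D) (hm : 0 ≤ m)
    (hσ : σ ≤ ENNReal.ofReal D • volume) (hmass : σ univ ≤ ENNReal.ofReal m) (x : Space) :
    Integrable (fun y => coulomb (x - y)) σ :=
  ⟨(measurable_coulomb.comp (by fun_prop)).aestronglyMeasurable,
    (lintegral_enorm_coulomb_le hD hm hσ hmass x).trans_lt ENNReal.ofReal_lt_top⟩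

theorem norm_integral_coulomb_le (hD : 0 ≤ D) (hm : 0 ≤ m)
    (hσ : σ ≤ ENNReal.ofReal D • volume) (hmass : σ univ ≤ ENNReal.ofReal m) (x : Space) :
    ‖∫ y, coulomb (x - y) ∂σ‖ ≤ 4 * Real.pi * D + m := by
  have h := (enorm_integral_le_lintegral_enorm _).trans
    (lintegral_enorm_coulomb_le hD hm hσ hmass x)
  rw [← ofReal_norm] at h
  exact (ENNReal.ofReal_le_ofReal_iff (by positivity)).1 h

theorem norm_integral_le_of_lintegral {α F : Type*} [MeasurableSpace α] [NormedAddCommGroup F]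
    [NormedSpace ℝ F] {ν : Measure α} {g : α → F} {k : α → ℝ} {c : ℝ}
    (hgk : ∀ y, ‖g y‖ ≤ k y) (hc : 0 ≤ c) (hk : ∫⁻ y, ENNReal.ofReal (k y) ∂ν ≤ ENNReal.ofReal c) :
    ‖∫ y, g y ∂ν‖ ≤ c := by
  have h : ‖∫ y, g y ∂ν‖ₑ ≤ ENNReal.ofReal c := by
    refine (enorm_integral_le_lintegral_enorm _).trans (le_trans (lintegral_mono fun y => ?_) hk)
    rw [← ofReal_norm]
    exact ENNReal.ofReal_le_ofReal (hgk y)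
  rw [← ofReal_norm] at h
  exact (ENNReal.ofReal_le_ofReal_iff hc).1 h

theorem integrable_cutCoulomb [IsFiniteMeasure σ] {ε : ℝ} (hε : 0 < ε) (x : Space) :
    Integrable (fun y => cutCoulomb ε (x - y)) σ := by
  refine Integrable.of_bound (C := (ε ^ 2)⁻¹) ?_ (ae_of_all _ fun y => norm_cutCoulomb_le hε _)
  exact ((continuous_cutCoulomb hε).comp (by fun_prop)).aestronglyMeasurable

theorem lintegral_max_inv_pow_three_le (hD : 0 ≤ D) (hm : 0 ≤ m)
    (hσ : σ ≤ ENNReal.ofReal D • volume) (hmass : σ univ ≤ ENNReal.ofReal m) {ε : ℝ} (hε : 0 < ε)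
    (hε1 : ε ≤ 1) (x : Space) :
    ∫⁻ y, ENNReal.ofReal ((max ‖x - y‖ ε ^ 3)⁻¹) ∂σ
      ≤ ENNReal.ofReal ((4 * Real.pi * D + m) * (1 + Real.log ε⁻¹)) := by
  have hlog : 0 ≤ Real.log ε⁻¹ := Real.log_nonneg (one_le_inv_iff₀.2 ⟨hε, hε1⟩)
  calc ∫⁻ y, ENNReal.ofReal ((max ‖x - y‖ ε ^ 3)⁻¹) ∂σ
      ≤ ∫⁻ y, (ENNReal.ofReal ((Iio 1).indicator (fun r => (max r ε ^ 3)⁻¹) ‖x - y‖) + 1) ∂σ := by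
        refine lintegral_mono fun y => ?_
        by_cases h : ‖x - y‖ < 1
        · simp [indicator, h]
        · simp only [indicator, mem_Iio, h, if_false, ENNReal.ofReal_zero, zero_add]
          rw [ENNReal.ofReal_le_one]
          exact inv_le_one_of_one_le₀ (one_le_pow₀ ((not_lt.1 h).trans (le_max_left _ _)))
    _ = ∫⁻ y, ENNReal.ofReal ((Iio 1).indicator (fun r => (max r ε ^ 3)⁻¹) ‖x - y‖) ∂σ
        + σ univ := by
        rw [lintegral_add_right _ measurable_const]; simp
    _ ≤ ENNReal.ofReal (D * (4 * Real.pi * (1 + Real.log ε⁻¹))) + ENNReal.ofReal m := by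
        gcongr
        exact lintegral_le_of_le_smul hD hσ (lintegral_inv_pow_three_le hε hε1 x)
    _ ≤ _ := by
        rw [← ENNReal.ofReal_add (by positivity) hm]
        apply ENNReal.ofReal_le_ofReal
        nlinarith

/-- The field of a bounded charge density is log-Lipschitz. -/
theorem norm_integral_coulomb_sub_le (hD : 0 ≤ D) (hm : 0 ≤ m)
    (hσ : σ ≤ ENNReal.ofReal D • volume) (hmass : σ univ ≤ ENNReal.ofReal m) {ε : ℝ} (hε : 0 < ε)
    (hε1 : ε ≤ 1) (x x' : Space) :
    ‖(∫ y, coulomb (x - y) ∂σ) - ∫ y, coulomb (x' - y) ∂σ‖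
      ≤ 2 * (4 * Real.pi * D + m) * ε
        + 8 * (4 * Real.pi * D + m) * (1 + Real.log ε⁻¹) * ‖x - x'‖ := by
  have hlog : 0 ≤ Real.log ε⁻¹ := Real.log_nonneg (one_le_inv_iff₀.2 ⟨hε, hε1⟩)
  have : IsFiniteMeasure σ := ⟨hmass.trans_lt ENNReal.ofReal_lt_top⟩
  -- Cutting the kernel at radius `ε` changes either field by a multiple of `ε`; the cut kernels are
  -- then compared through their gradient. `ε` stays a free parameter, to be chosen later against
  -- the step size of the scheme.
  have hnear : ∀ z : Space, ‖∫ y, (coulomb (z - y) - cutCoulomb ε (z - y)) ∂σ‖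
      ≤ (4 * Real.pi * D + m) * ε := by
    intro z
    refine (norm_integral_le_of_lintegral (fun y => norm_coulomb_sub_cutCoulomb_le hε _)
      (by positivity) (lintegral_inv_sq_lt_le_of_le hD hσ hε.le z)).trans ?_
    nlinarith
  have hcut : ‖∫ y, (cutCoulomb ε (x - y) - cutCoulomb ε (x' - y)) ∂σ‖
      ≤ 8 * (4 * Real.pi * D + m) * (1 + Real.log ε⁻¹) * ‖x - x'‖ := by
    refine norm_integral_le_of_lintegral
      (k := fun y => 4 * ‖x - x'‖ * ((max ‖x - y‖ ε ^ 3)⁻¹ + (max ‖x' - y‖ ε ^ 3)⁻¹))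
      (fun y => ?_) (by positivity) ?_
    · refine (norm_cutCoulomb_sub_le hε (x - y) (x' - y)).trans (le_of_eq ?_)
      rw [sub_sub_sub_cancel_right]
    · have hp : ∀ z y : Space, 0 ≤ (max ‖z - y‖ ε ^ 3)⁻¹ := fun z y => by positivity
      simp_rw [ENNReal.ofReal_mul (show 0 ≤ 4 * ‖x - x'‖ by positivity)]
      simp_rw [ENNReal.ofReal_add (hp x _) (hp x' _)]
      rw [lintegral_const_mul _ (by fun_prop), lintegral_add_left (by fun_prop)]
      calc _ ≤ ENNReal.ofReal (4 * ‖x - x'‖)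
            * (ENNReal.ofReal ((4 * Real.pi * D + m) * (1 + Real.log ε⁻¹))
              + ENNReal.ofReal ((4 * Real.pi * D + m) * (1 + Real.log ε⁻¹))) := by
            gcongr
            · exact lintegral_max_inv_pow_three_le hD hm hσ hmass hε hε1 x
            · exact lintegral_max_inv_pow_three_le hD hm hσ hmass hε hε1 x'
        _ = _ := by
            rw [← ENNReal.ofReal_add (by positivity) (by positivity),
              ← ENNReal.ofReal_mul (by positivity)]
            congr 1; ring
  have e : (∫ y, coulomb (x - y) ∂σ) - ∫ y, coulomb (x' - y) ∂σ
      = (∫ y, (coulomb (x - y) - cutCoulomb ε (x - y)) ∂σ)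
        - (∫ y, (coulomb (x' - y) - cutCoulomb ε (x' - y)) ∂σ)
        + ∫ y, (cutCoulomb ε (x - y) - cutCoulomb ε (x' - y)) ∂σ := by
    rw [integral_sub (integrable_coulomb hD hm hσ hmass x) (integrable_cutCoulomb hε x),
      integral_sub (integrable_coulomb hD hm hσ hmass x') (integrable_cutCoulomb hε x'),
      integral_sub (integrable_cutCoulomb hε x) (integrable_cutCoulomb hε x')]
    abel
  rw [e]
  refine (norm_add_le _ _).trans (add_le_add ((norm_sub_le _ _).trans ?_) hcut)
  linarith [hnear x, hnear x']

end BoundedDensity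

end PlasmaCharge
end

noncomputable section

namespace PlasmaCharge

/-! ### Calculus on closed intervals -/

theorem HasDerivWithinAt.hasDerivAt_of_mem_Ioo {F : Type*} [NormedAddCommGroup F] [NormedSpace ℝ F]
    {f : ℝ → F} {f' : F} {a b t : ℝ} (h : HasDerivWithinAt f f' (Icc a b) t) (ht : t ∈ Ioo a b) :
    HasDerivAt f f' t :=
  h.hasDerivAt (Icc_mem_nhds ht.1 ht.2)

/-- The fundamental theorem of calculus for functions with bounded derivative. -/
theorem integral_eq_sub_of_bounded_deriv_of_le {F : Type*} [NormedAddCommGroup F] [NormedSpace ℝ F]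
    [FiniteDimensional ℝ F]
    {f f' : ℝ → F} {a b A : ℝ} (hab : a ≤ b)
    (hd : ∀ t ∈ Icc a b, HasDerivWithinAt f (f' t) (Icc a b) t) (hA : ∀ t ∈ Icc a b, ‖f' t‖ ≤ A) :
    IntervalIntegrable f' volume a b ∧ ∫ t in a..b, f' t = f b - f a := by
  have hcompl : CompleteSpace F := FiniteDimensional.complete ℝ F
  have hintg : IntervalIntegrable f' volume a b := by
    rw [intervalIntegrable_iff_integrableOn_Ioo_of_le hab]
    refine Integrable.of_bound (C := A) ?_ ?_
    -- Nothing is assumed on the regularity of `f'`; it is measurable because it coincides with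
    -- `deriv f` in the interior.
    · have h1 : AEStronglyMeasurable (deriv f) (volume.restrict (Ioo a b)) := by
        borelize F
        exact (measurable_deriv f).aestronglyMeasurable
      refine h1.congr ?_
      refine (ae_restrict_iff' measurableSet_Ioo).2 (ae_of_all _ fun t ht => ?_)
      exact (HasDerivWithinAt.hasDerivAt_of_mem_Ioo (hd t (Ioo_subset_Icc_self ht)) ht).deriv
    · exact (ae_restrict_iff' measurableSet_Ioo).2
        (ae_of_all _ fun t ht => hA t (Ioo_subset_Icc_self ht))
  refine ⟨hintg, ?_⟩
  exact intervalIntegral.integral_eq_sub_of_hasDerivAt_of_le hab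
    (fun t ht => (hd t ht).continuousWithinAt)
    (fun t ht => HasDerivWithinAt.hasDerivAt_of_mem_Ioo (hd t (Ioo_subset_Icc_self ht)) ht) hintg

theorem integral_eq_sub_of_bounded_deriv {F : Type*} [NormedAddCommGroup F] [NormedSpace ℝ F]
    [FiniteDimensional ℝ F]
    {f f' : ℝ → F} {a b A : ℝ}
    (hd : ∀ t ∈ uIcc a b, HasDerivWithinAt f (f' t) (uIcc a b) t)
    (hA : ∀ t ∈ uIcc a b, ‖f' t‖ ≤ A) :
    IntervalIntegrable f' volume a b ∧ ∫ t in a..b, f' t = f b - f a := by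
  rcases le_total a b with h | h
  · rw [uIcc_of_le h] at hd hA
    exact integral_eq_sub_of_bounded_deriv_of_le h hd hA
  · rw [uIcc_of_ge h] at hd hA
    obtain ⟨h1, h2⟩ := integral_eq_sub_of_bounded_deriv_of_le h hd hA
    refine ⟨h1.symm, ?_⟩
    rw [intervalIntegral.integral_symm, h2, neg_sub]

theorem norm_sub_le_of_deriv_bound {F : Type*} [NormedAddCommGroup F] [NormedSpace ℝ F]
    {f f' : ℝ → F} {a b A r r' : ℝ}
    (hd : ∀ t ∈ uIcc a b, HasDerivWithinAt f (f' t) (uIcc a b) t)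
    (hA : ∀ t ∈ uIcc a b, ‖f' t‖ ≤ A) (hr : r ∈ uIcc a b) (hr' : r' ∈ uIcc a b) :
    ‖f r' - f r‖ ≤ A * |r' - r| :=
  (convex_uIcc a b).norm_image_sub_le_of_norm_hasDerivWithin_le hd hA hr hr'

/-! ### The symplectic Euler scheme -/

/-- The velocity kick `(x, v) ↦ (x, v + G(x))`. -/
def kick (G : Space → Space) (z : Phase) : Phase := (z.1, z.2 + G z.1)

/-- The free drift `(x, v) ↦ (x + h v, v)`. -/
def drift (h : ℝ) (z : Phase) : Phase := (z.1 + h • z.2, z.2)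

theorem measurePreserving_kick {G : Space → Space} (hG : Measurable G) :
    MeasurePreserving (kick G) volume volume := by
  rw [Measure.volume_eq_prod]
  refine MeasurePreserving.skew_product (g := fun x v => v + G x) (MeasurePreserving.id _)
    (by fun_prop) (ae_of_all _ fun x => ?_)
  exact (measurePreserving_add_right volume (G x)).map_eq

theorem measurePreserving_drift (h : ℝ) : MeasurePreserving (drift h) volume volume := by
  have e : drift h = Prod.swap ∘ kick (fun x => h • x) ∘ Prod.swap := by
    ext z <;> simp [drift, kick]
  have hs : MeasurePreserving (Prod.swap : Phase → Phase) volume volume := by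
    rw [Measure.volume_eq_prod]
    exact Measure.measurePreserving_swap
  rw [e]
  exact hs.comp ((measurePreserving_kick (by fun_prop)).comp hs)

/-- The symplectic Euler scheme with step `h` and initial time `s` for `dx/dt = v`,
`dv/dt = F(t, x)`. -/
def euler (F : ℝ → Space → Space) (s h : ℝ) : ℕ → Phase → Phase
  | 0 => id
  | n + 1 => drift h ∘ kick (fun x => ∫ r in (s + n * h)..(s + (n + 1) * h), F r x) ∘ euler F s h n

/-- `F` is bounded by `A` and has a log-Lipschitz modulus with constant `L` on the time interval
between `s` and `t`. -/
structure IsLogLipschitz (F : ℝ → Space → Space) (s t A L : ℝ) : Prop where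
  nonneg : 0 ≤ L
  integrable : ∀ x, IntervalIntegrable (fun r => F r x) volume s t
  bound : ∀ r ∈ uIcc s t, ∀ x, ‖F r x‖ ≤ A
  modulus : ∀ r ∈ uIcc s t, ∀ ε : ℝ, 0 < ε → ε ≤ 1 → ∀ x y,
    ‖F r x - F r y‖ ≤ L * ε + L * (1 + Real.log ε⁻¹) * ‖x - y‖

theorem IsLogLipschitz.continuous {F : ℝ → Space → Space} {s t A L : ℝ}
    (hF : IsLogLipschitz F s t A L) {r : ℝ} (hr : r ∈ uIcc s t) : Continuous (F r) := by
  rw [Metric.continuous_iff]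
  intro y η hη
  have hL := hF.nonneg
  set ε := min 1 (η / (2 * (L + 1))) with hε
  have hε0 : 0 < ε := by positivity
  have hε1 : ε ≤ 1 := min_le_left _ _
  have hlog : 0 ≤ Real.log ε⁻¹ := Real.log_nonneg (one_le_inv_iff₀.2 ⟨hε0, hε1⟩)
  have hLε : L * ε ≤ η / 2 := by
    calc L * ε ≤ (L + 1) * (η / (2 * (L + 1))) := by
          gcongr; · linarith
          · exact min_le_right _ _
      _ = η / 2 := by field_simp
  set c := L * (1 + Real.log ε⁻¹) with hc
  have hc0 : 0 ≤ c := by positivity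
  refine ⟨η / (2 * (c + 1)), by positivity, fun x hx => ?_⟩
  rw [dist_eq_norm] at hx ⊢
  have h1 := hF.modulus r hr ε hε0 hε1 x y
  have h2 : c * ‖x - y‖ < η / 2 := by
    calc c * ‖x - y‖ ≤ (c + 1) * ‖x - y‖ := by nlinarith [norm_nonneg (x - y)]
      _ < (c + 1) * (η / (2 * (c + 1))) := by gcongr
      _ = η / 2 := by field_simp
  linarith

theorem add_mul_mem_uIcc {s t : ℝ} {n N : ℕ} (hN : 0 < N) (hn : n ≤ N) :
    s + n * ((t - s) / N) ∈ uIcc s t := by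
  have hN' : (0 : ℝ) < N := by exact_mod_cast hN
  have e : s + n * ((t - s) / N) = AffineMap.lineMap s t ((n : ℝ) / N) := by
    simp [AffineMap.lineMap_apply]; ring
  rw [e, ← segment_eq_uIcc, segment_eq_image_lineMap]
  refine ⟨_, ⟨by positivity, ?_⟩, rfl⟩
  rw [div_le_one hN']
  exact_mod_cast hn

/-- Kick and drift are shears, so volume is preserved exactly for every step size and without any
derivative of the force. The force enters through time integrals because it is only integrable in
time; `n ≤ N` keeps them inside the interval where it is controlled. -/
theorem IsLogLipschitz.measurePreserving_euler {F : ℝ → Space → Space} {s t A L : ℝ}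
    (hF : IsLogLipschitz F s t A L) {n N : ℕ} (hN : 0 < N) (hn : n ≤ N) :
    MeasurePreserving (euler F s ((t - s) / N) n) volume volume := by
  induction n with
  | zero => exact MeasurePreserving.id _
  | succ n ih =>
    refine (measurePreserving_drift _).comp ((measurePreserving_kick ?_).comp (ih (by omega)))
    have h0 := add_mul_mem_uIcc (s := s) (t := t) hN (show n ≤ N by omega)
    have h1 := add_mul_mem_uIcc (s := s) (t := t) hN hn
    push_cast at h1
    have hsub := uIcc_subset_uIcc h0 h1
    refine Continuous.measurable ?_
    refine intervalIntegral.continuous_of_dominated_interval (bound := fun _ => A) ?_ ?_ ?_ ?_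
    · intro x
      exact ((hF.integrable x).mono_set hsub).aestronglyMeasurable_restrict_uIoc
    · intro x
      exact ae_of_all _ fun r hr => hF.bound r (hsub (uIoc_subset_uIcc hr)) x
    · simp
    · exact ae_of_all _ fun r hr => hF.continuous (hsub (uIoc_subset_uIcc hr))

/-! ### Convergence of the symplectic Euler scheme -/

section Step

variable {F : ℝ → Space → Space} {s t A L B : ℝ} {x v : ℝ → Space}

/-- The amplification factor is one plus the step times the log-Lipschitz constant at scale `ε`; the
new error is the step times `ε`, from the modulus, plus a term quadratic in the step, from the
motion of the exact solution during the step. -/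
theorem euler_step_error (hF : IsLogLipschitz F s t A L)
    (hx : ∀ r ∈ uIcc s t, HasDerivWithinAt x (v r) (uIcc s t) r)
    (hv : ∀ r ∈ uIcc s t, HasDerivWithinAt v (F r (x r)) (uIcc s t) r)
    (hB : ∀ r ∈ uIcc s t, ‖v r‖ ≤ B) {ε : ℝ} (hε : 0 < ε) (hε1 : ε ≤ 1) {r₀ r₁ : ℝ}
    (h₀ : r₀ ∈ uIcc s t) (h₁ : r₁ ∈ uIcc s t) (y w : Space) {w' : Space}
    (hw' : w' = w + ∫ r in r₀..r₁, F r y) :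
    ‖y + (r₁ - r₀) • w' - x r₁‖ + ‖w' - v r₁‖
      ≤ (1 + |r₁ - r₀| * (1 + L * (1 + Real.log ε⁻¹))) * (‖y - x r₀‖ + ‖w - v r₀‖)
        + |r₁ - r₀| * (L * ε + (L * (1 + Real.log ε⁻¹) * B + 3 * A) * |r₁ - r₀|) := by
  have hlog : 0 ≤ Real.log ε⁻¹ := Real.log_nonneg (one_le_inv_iff₀.2 ⟨hε, hε1⟩)
  have hL := hF.nonneg
  have hsub := uIcc_subset_uIcc h₀ h₁
  have hA0 : 0 ≤ A := (norm_nonneg _).trans (hF.bound _ h₀ 0)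
  have hB0 : 0 ≤ B := (norm_nonneg _).trans (hB _ h₀)
  set Λ := L * (1 + Real.log ε⁻¹) with hΛ
  have hΛ0 : 0 ≤ Λ := by positivity
  set k := |r₁ - r₀| with hk
  have hk0 : 0 ≤ k := abs_nonneg _
  have hvb : ∀ r ∈ uIcc s t, ‖F r (x r)‖ ≤ A := fun r hr => hF.bound r hr _
  obtain ⟨hi, hftc⟩ := integral_eq_sub_of_bounded_deriv (f := v) (f' := fun r => F r (x r))
    (a := r₀) (b := r₁) (A := A) (fun r hr => (hv r (hsub hr)).mono hsub)
    (fun r hr => hvb r (hsub hr))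
  have hiy : IntervalIntegrable (fun r => F r y) volume r₀ r₁ := (hF.integrable y).mono_set hsub
  have hdiff : w' - v r₁ = (w - v r₀) + ∫ r in r₀..r₁, (F r y - F r (x r)) := by
    rw [intervalIntegral.integral_sub hiy hi, hftc, hw']; abel
  have hI1 : ‖∫ r in r₀..r₁, (F r y - F r (x r))‖ ≤ (L * ε + Λ * (‖y - x r₀‖ + B * k)) * k := by
    refine intervalIntegral.norm_integral_le_of_norm_le_const fun r hr => ?_
    have hr' : r ∈ uIcc r₀ r₁ := uIoc_subset_uIcc hr
    refine (hF.modulus r (hsub hr') ε hε hε1 _ _).trans ?_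
    gcongr
    have h1 : ‖x r - x r₀‖ ≤ B * |r - r₀| := norm_sub_le_of_deriv_bound hx hB h₀ (hsub hr')
    have h2 : |r - r₀| ≤ k := abs_sub_left_of_mem_uIcc hr'
    calc ‖y - x r‖ = ‖(y - x r₀) - (x r - x r₀)‖ := by congr 1; abel
      _ ≤ ‖y - x r₀‖ + ‖x r - x r₀‖ := norm_sub_le _ _
      _ ≤ ‖y - x r₀‖ + B * k := by
          gcongr; exact h1.trans (by gcongr)
  -- This crude bound is for the position, where it is multiplied by the step once more and thus
  -- already quadratic; the velocity needs the finer `hI1`.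
  have hI2 : ‖∫ r in r₀..r₁, (F r y - F r (x r))‖ ≤ (2 * A) * k := by
    refine intervalIntegral.norm_integral_le_of_norm_le_const fun r hr => ?_
    have hr' : r ∈ uIcc s t := hsub (uIoc_subset_uIcc hr)
    refine (norm_sub_le _ _).trans ?_
    linarith [hF.bound r hr' y, hF.bound r hr' (x r)]
  have hw1 : ‖w' - v r₁‖ ≤ ‖w - v r₀‖ + (L * ε + Λ * (‖y - x r₀‖ + B * k)) * k := by
    rw [hdiff]; exact (norm_add_le _ _).trans (by gcongr)
  have hw2 : ‖w' - v r₁‖ ≤ ‖w - v r₀‖ + (2 * A) * k := by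
    rw [hdiff]; exact (norm_add_le _ _).trans (by gcongr)
  -- The drift uses the velocity after the kick, so the exact increment is compared with the final
  -- velocity.
  have hpos : ‖x r₁ - x r₀ - (r₁ - r₀) • v r₁‖ ≤ A * k * k := by
    have hder : ∀ r ∈ uIcc r₀ r₁, HasDerivWithinAt (fun r => x r - r • v r₁) (v r - v r₁)
        (uIcc r₀ r₁) r := by
      intro r hr
      have := ((hx r (hsub hr)).mono hsub).sub
        ((hasDerivWithinAt_id r (uIcc r₀ r₁)).smul_const (v r₁))
      rw [one_smul] at this
      exact this
    have hbd : ∀ r ∈ uIcc r₀ r₁, ‖v r - v r₁‖ ≤ A * k := by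
      intro r hr
      refine (norm_sub_le_of_deriv_bound hv hvb h₁ (hsub hr)).trans ?_
      gcongr
      rw [abs_sub_comm]
      exact abs_sub_right_of_mem_uIcc hr
    have := norm_sub_le_of_deriv_bound hder hbd left_mem_uIcc right_mem_uIcc
    refine le_trans (le_of_eq ?_) this
    congr 1
    rw [sub_smul]; abel
  have hy : ‖y + (r₁ - r₀) • w' - x r₁‖ ≤ ‖y - x r₀‖ + k * ‖w' - v r₁‖ + A * k * k := by
    have e : y + (r₁ - r₀) • w' - x r₁
        = (y - x r₀) + (r₁ - r₀) • (w' - v r₁) - (x r₁ - x r₀ - (r₁ - r₀) • v r₁) := by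
      rw [smul_sub]; abel
    rw [e]
    refine (norm_sub_le _ _).trans (add_le_add ((norm_add_le _ _).trans ?_) hpos)
    rw [norm_smul, Real.norm_eq_abs]
  have hkk : k * ‖w' - v r₁‖ ≤ k * (‖w - v r₀‖ + (2 * A) * k) := by gcongr
  have p1 : 0 ≤ k * ‖y - x r₀‖ := by positivity
  have p2 : 0 ≤ k * Λ * ‖w - v r₀‖ := by positivity
  nlinarith

/-- Discrete Gronwall inequality, in the crude form where each of the `n` local errors is amplified
`n` times. -/
theorem euler_error (hF : IsLogLipschitz F s t A L)
    (hx : ∀ r ∈ uIcc s t, HasDerivWithinAt x (v r) (uIcc s t) r)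
    (hv : ∀ r ∈ uIcc s t, HasDerivWithinAt v (F r (x r)) (uIcc s t) r)
    (hB : ∀ r ∈ uIcc s t, ‖v r‖ ≤ B) {ε : ℝ} (hε : 0 < ε) (hε1 : ε ≤ 1) {n N : ℕ} (hN : 0 < N)
    (hn : n ≤ N) :
    ‖(euler F s ((t - s) / N) n (x s, v s)).1 - x (s + n * ((t - s) / N))‖
      + ‖(euler F s ((t - s) / N) n (x s, v s)).2 - v (s + n * ((t - s) / N))‖
      ≤ n * (|(t - s) / N| * (L * ε + (L * (1 + Real.log ε⁻¹) * B + 3 * A) * |(t - s) / N|))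
        * (1 + |(t - s) / N| * (1 + L * (1 + Real.log ε⁻¹))) ^ n := by
  have hlog : 0 ≤ Real.log ε⁻¹ := Real.log_nonneg (one_le_inv_iff₀.2 ⟨hε, hε1⟩)
  have hL := hF.nonneg
  have hA0 : 0 ≤ A := (norm_nonneg _).trans (hF.bound _ left_mem_uIcc 0)
  have hB0 : 0 ≤ B := (norm_nonneg _).trans (hB _ left_mem_uIcc)
  induction n with
  | zero => simp [euler]
  | succ n ih =>
    have h0 := add_mul_mem_uIcc (s := s) (t := t) hN (show n ≤ N by omega)
    have h1 := add_mul_mem_uIcc (s := s) (t := t) hN hn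
    push_cast at h1 ⊢
    have ih' := ih (by omega)
    set h := (t - s) / N with hh
    set z := euler F s h n (x s, v s) with hz
    have hstep := euler_step_error hF hx hv hB hε hε1 h0 h1 z.1 z.2 rfl
    have hdiff : s + (n + 1) * h - (s + n * h) = h := by ring
    rw [hdiff] at hstep
    have e : euler F s h (n + 1) (x s, v s)
        = (z.1 + h • (z.2 + ∫ r in (s + n * h)..(s + (n + 1) * h), F r z.1),
          z.2 + ∫ r in (s + n * h)..(s + (n + 1) * h), F r z.1) := by
      simp [euler, drift, kick, ← hz]
    rw [e]
    refine hstep.trans ?_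
    set b := |h| * (L * ε + (L * (1 + Real.log ε⁻¹) * B + 3 * A) * |h|) with hb
    set a := |h| * (1 + L * (1 + Real.log ε⁻¹)) with ha
    have ha0 : 0 ≤ a := by positivity
    have hb0 : 0 ≤ b := by positivity
    have hp : 1 ≤ (1 + a) ^ (n + 1) := one_le_pow₀ (by linarith)
    calc (1 + a) * (‖z.1 - x (s + n * h)‖ + ‖z.2 - v (s + n * h)‖) + b
        ≤ (1 + a) * (n * b * (1 + a) ^ n) + b * (1 + a) ^ (n + 1) := by
          gcongr
          nlinarith
      _ = (n + 1) * b * (1 + a) ^ (n + 1) := by ring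

/-- A logarithmic modulus at scale `ε` amplifies errors by about `ε^(-|t-s|L)`, while the local
errors sum to order `ε`. When `|t-s|L ≤ 1/2` the gain wins. With `ε = θ²` the product is of order
`θ`; first the number of steps tends to infinity at fixed `θ`, then `θ` is taken small. -/
theorem tendsto_euler (hF : IsLogLipschitz F s t A L)
    (hx : ∀ r ∈ uIcc s t, HasDerivWithinAt x (v r) (uIcc s t) r)
    (hv : ∀ r ∈ uIcc s t, HasDerivWithinAt v (F r (x r)) (uIcc s t) r)
    (hB : ∀ r ∈ uIcc s t, ‖v r‖ ≤ B) (hshort : |t - s| * L ≤ 1 / 2) :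
    Filter.Tendsto (fun N : ℕ => euler F s ((t - s) / N) N (x s, v s)) Filter.atTop
      (nhds (x t, v t)) := by
  have hL := hF.nonneg
  have hA0 : 0 ≤ A := (norm_nonneg _).trans (hF.bound _ left_mem_uIcc 0)
  have hB0 : 0 ≤ B := (norm_nonneg _).trans (hB _ left_mem_uIcc)
  set τ := |t - s| with hτ
  have hτ0 : 0 ≤ τ := abs_nonneg _
  have key : ∀ θ : ℝ, 0 < θ → θ ≤ 1 → ∃ c : ℝ, ∀ N : ℕ, 0 < N →
      dist (euler F s ((t - s) / N) N (x s, v s)) (x t, v t)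
        ≤ τ * Real.exp (τ * (1 + L)) * L * θ + c / N := by
    intro θ hθ hθ1
    set c₀ := L * (1 + Real.log (θ ^ 2)⁻¹) * B + 3 * A with hc₀
    refine ⟨τ * (c₀ * τ) * (Real.exp (τ * (1 + L)) * θ⁻¹), fun N hN => ?_⟩
    have hN' : (0 : ℝ) < N := by exact_mod_cast hN
    have hθ2 : θ ^ 2 ≤ 1 := pow_le_one₀ hθ.le hθ1
    have hlog : 0 ≤ Real.log (θ ^ 2)⁻¹ :=
      Real.log_nonneg (one_le_inv_iff₀.2 ⟨by positivity, hθ2⟩)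
    have h := euler_error hF hx hv hB (ε := θ ^ 2) (by positivity) hθ2 hN le_rfl
    have e1 : s + N * ((t - s) / N) = t := by field_simp; ring
    have e2 : |(t - s) / N| = τ / N := by rw [abs_div, Nat.abs_cast]
    rw [e1, e2, ← hc₀] at h
    have hexp : (1 + τ / N * (1 + L * (1 + Real.log (θ ^ 2)⁻¹))) ^ N
        ≤ Real.exp (τ * (1 + L)) * θ⁻¹ := by
      calc (1 + τ / N * (1 + L * (1 + Real.log (θ ^ 2)⁻¹))) ^ N
          ≤ Real.exp (τ / N * (1 + L * (1 + Real.log (θ ^ 2)⁻¹))) ^ N := by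
            gcongr
            rw [add_comm]; exact Real.add_one_le_exp _
        _ = Real.exp (τ * (1 + L) + τ * L * Real.log (θ ^ 2)⁻¹) := by
            rw [← Real.exp_nat_mul]; congr 1; field_simp; ring
        _ ≤ Real.exp (τ * (1 + L) + 1 / 2 * Real.log (θ ^ 2)⁻¹) := by gcongr
        _ = Real.exp (τ * (1 + L)) * θ⁻¹ := by
            rw [Real.exp_add]
            congr 1
            rw [Real.log_inv, Real.log_pow]
            have : 1 / 2 * -((2 : ℕ) * Real.log θ) = Real.log θ⁻¹ := by
              rw [Real.log_inv]; push_cast; ring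
            rw [this, Real.exp_log (by positivity)]
    have hd : dist (euler F s ((t - s) / N) N (x s, v s)) (x t, v t)
        ≤ ‖(euler F s ((t - s) / N) N (x s, v s)).1 - x t‖
          + ‖(euler F s ((t - s) / N) N (x s, v s)).2 - v t‖ := by
      rw [Prod.dist_eq, dist_eq_norm, dist_eq_norm]
      exact max_le_add_of_nonneg (norm_nonneg _) (norm_nonneg _)
    refine hd.trans (h.trans ?_)
    have hc₀0 : 0 ≤ c₀ := by positivity
    calc (N : ℝ) * (τ / N * (L * θ ^ 2 + c₀ * (τ / N)))
          * (1 + τ / N * (1 + L * (1 + Real.log (θ ^ 2)⁻¹))) ^ N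
        ≤ (N : ℝ) * (τ / N * (L * θ ^ 2 + c₀ * (τ / N))) * (Real.exp (τ * (1 + L)) * θ⁻¹) := by
          gcongr
      _ = _ := by field_simp
  rw [Metric.tendsto_atTop]
  intro ρ hρ
  set c₁ := τ * Real.exp (τ * (1 + L)) * L with hc₁
  have hc₁0 : 0 ≤ c₁ := by positivity
  obtain ⟨c, hc⟩ := key (min 1 (ρ / (2 * (c₁ + 1)))) (by positivity) (min_le_left _ _)
  have h1 : c₁ * min 1 (ρ / (2 * (c₁ + 1))) ≤ c₁ / (c₁ + 1) * (ρ / 2) := by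
    calc _ ≤ c₁ * (ρ / (2 * (c₁ + 1))) := by gcongr; exact min_le_right _ _
      _ = _ := by field_simp
  have h2 : c₁ / (c₁ + 1) * (ρ / 2) ≤ ρ / 2 := by
    have : c₁ / (c₁ + 1) ≤ 1 := by rw [div_le_one (by positivity)]; linarith
    nlinarith
  have hlim : Filter.Tendsto (fun N : ℕ => c / N) Filter.atTop (nhds 0) :=
    tendsto_const_div_atTop_nhds_zero_nat c
  have hev := (hlim.eventually_lt_const (show (0 : ℝ) < ρ / 2 by positivity)).and
    (Filter.eventually_gt_atTop 0)
  obtain ⟨N₀, hN₀⟩ := Filter.eventually_atTop.1 hev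
  refine ⟨N₀, fun N hN => ?_⟩
  have h3 := hN₀ N hN
  have h4 := hc N h3.2
  linarith [h3.1]

end Step

end PlasmaCharge
end

noncomputable section

namespace PlasmaCharge

/-! ### Limits of measure-preserving maps -/

section Limit

variable {α : Type*} [MeasurableSpace α] [TopologicalSpace α] [BorelSpace α]
  [TopologicalSpace.PseudoMetrizableSpace α] {μ : Measure α}

theorem aemeasurable_of_tendsto_measurePreserving {Φ : ℕ → α → α}
    (hΦ : ∀ n, MeasurePreserving (Φ n) μ μ) {S : Set α} (hS : NullMeasurableSet S μ) {f : α → α}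
    (hlim : ∀ z ∈ S, Filter.Tendsto (fun n => Φ n z) Filter.atTop (nhds (f z))) :
    AEMeasurable f (μ.restrict S) :=
  aemeasurable_of_tendsto_metrizable_ae Filter.atTop (fun n => (hΦ n).measurable.aemeasurable)
    ((ae_restrict_iff'₀ hS).2 (ae_of_all _ hlim))

/-- Indicators of open sets are lower semicontinuous, so Fatou's lemma passes the measure of
preimages to the limit with an inequality; outer regularity extends it from open sets to all sets.
-/
theorem map_restrict_le_of_tendsto_measurePreserving [μ.OuterRegular] {Φ : ℕ → α → α}
    (hΦ : ∀ n, MeasurePreserving (Φ n) μ μ) {S : Set α} (hS : NullMeasurableSet S μ) {f : α → α}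
    (hlim : ∀ z ∈ S, Filter.Tendsto (fun n => Φ n z) Filter.atTop (nhds (f z))) :
    (μ.restrict S).map f ≤ μ := by
  have hf := aemeasurable_of_tendsto_measurePreserving hΦ hS hlim
  have hopen : ∀ U : Set α, IsOpen U → (μ.restrict S).map f U ≤ μ U := by
    intro U hU
    have hpt : ∀ᵐ z ∂(μ.restrict S), U.indicator (1 : α → ℝ≥0∞) (f z)
        ≤ Filter.liminf (fun n => U.indicator (1 : α → ℝ≥0∞) (Φ n z)) Filter.atTop := by
      refine (ae_restrict_iff'₀ hS).2 (ae_of_all _ fun z hz => ?_)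
      by_cases hzU : f z ∈ U
      · have hev := (hlim z hz).eventually (hU.mem_nhds hzU)
        refine Filter.le_liminf_of_le (by isBoundedDefault) ?_
        filter_upwards [hev] with n hn
        rw [indicator_of_mem hzU, indicator_of_mem (show Φ n z ∈ U from hn)]
        simp
      · simp [hzU]
    rw [Measure.map_apply_of_aemeasurable hf hU.measurableSet]
    calc (μ.restrict S) (f ⁻¹' U) ≤ ∫⁻ z, U.indicator (1 : α → ℝ≥0∞) (f z) ∂(μ.restrict S) := by
          have : (fun z => U.indicator (1 : α → ℝ≥0∞) (f z)) = (f ⁻¹' U).indicator 1 := by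
            ext z; rfl
          rw [this]
          refine le_of_eq (lintegral_indicator_one₀ ?_).symm
          exact hf.nullMeasurableSet_preimage hU.measurableSet
      _ ≤ ∫⁻ z, Filter.liminf (fun n => U.indicator (1 : α → ℝ≥0∞) (Φ n z)) Filter.atTop
            ∂(μ.restrict S) := lintegral_mono_ae hpt
      _ ≤ Filter.liminf (fun n => ∫⁻ z, U.indicator (1 : α → ℝ≥0∞) (Φ n z) ∂(μ.restrict S))
            Filter.atTop := by
          refine lintegral_liminf_le fun n => ?_
          exact (measurable_one.indicator hU.measurableSet).comp (hΦ n).measurable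
      _ ≤ μ U := by
          refine Filter.liminf_le_of_le (by isBoundedDefault) fun b hb => ?_
          obtain ⟨n, hn⟩ := hb.exists
          refine hn.trans ?_
          calc _ ≤ ∫⁻ z, U.indicator (1 : α → ℝ≥0∞) (Φ n z) ∂μ :=
                lintegral_mono' Measure.restrict_le_self le_rfl
            _ = ∫⁻ z, U.indicator (1 : α → ℝ≥0∞) z ∂μ :=
                (hΦ n).lintegral_comp (measurable_one.indicator hU.measurableSet)
            _ = μ U := lintegral_indicator_one hU.measurableSet
  refine Measure.le_iff.2 fun A _ => ?_
  rw [A.measure_eq_iInf_isOpen μ]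
  refine le_iInf₂ fun U hAU => le_iInf fun hU => (measure_mono hAU).trans (hopen U hU)

end Limit

/-- Two maps that are inverse to each other between `S` and `S'`, neither of which decreases
volumes, preserve volumes. -/
theorem map_restrict_eq_of_inverse {α : Type*} [MeasurableSpace α] {μ : Measure α} {S S' : Set α}
    (hS : NullMeasurableSet S μ) (hS' : NullMeasurableSet S' μ) {f g : α → α}
    (hf : AEMeasurable f (μ.restrict S)) (hg : AEMeasurable g (μ.restrict S'))
    (hfle : (μ.restrict S).map f ≤ μ) (hgle : (μ.restrict S').map g ≤ μ)
    (hfS : MapsTo f S S') (hgS : MapsTo g S' S) (hfg : ∀ z ∈ S', f (g z) = z) :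
    (μ.restrict S).map f = μ.restrict S' := by
  -- Since the image lies in `P'`, the bound by `μ` sharpens to a bound by its restriction. A
  -- measurable superset stands in for `P'`, which is only null measurable.
  have aux : ∀ {P P' : Set α} {k : α → α}, NullMeasurableSet P μ → NullMeasurableSet P' μ →
      AEMeasurable k (μ.restrict P) → (μ.restrict P).map k ≤ μ → MapsTo k P P' →
      (μ.restrict P).map k ≤ μ.restrict P' := by
    intro P P' k hP hP' hk hle hm
    refine Measure.le_iff.2 fun A hA => ?_
    obtain ⟨P'', hP''sub, hP''meas, hP''eq⟩ := hP'.exists_measurable_superset_ae_eq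
    have h1 : μ.restrict P' A = μ (A ∩ P'') := by
      rw [Measure.restrict_apply hA]
      exact measure_congr ((ae_eq_refl A).inter hP''eq.symm)
    rw [h1, Measure.map_apply_of_aemeasurable hk hA]
    calc (μ.restrict P) (k ⁻¹' A) ≤ (μ.restrict P) (k ⁻¹' (A ∩ P'')) := by
          refine measure_mono_ae ?_
          refine (ae_restrict_iff'₀ hP).2 (ae_of_all _ fun z hz hzA => ?_)
          exact ⟨hzA, hP''sub (hm hz)⟩
      _ = (μ.restrict P).map k (A ∩ P'') :=
          (Measure.map_apply_of_aemeasurable hk (hA.inter hP''meas)).symm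
      _ ≤ μ (A ∩ P'') := hle _
  have h1 := aux hS hS' hf hfle hfS
  have h2 := aux hS' hS hg hgle hgS
  refine le_antisymm h1 ?_
  have hf' : AEMeasurable f ((μ.restrict S').map g) := hf.mono_measure h2
  -- On `S'` the composition is the identity; pushing first by `g` lands below the restriction to
  -- `S`, and pushing that by `f` gives the missing inequality.
  calc μ.restrict S' = (μ.restrict S').map (f ∘ g) := by
        conv_lhs => rw [← Measure.map_id (μ := μ.restrict S')]
        refine Measure.map_congr ((ae_restrict_iff'₀ hS').2 (ae_of_all _ fun z hz => ?_))
        exact (hfg z hz).symm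
    _ = ((μ.restrict S').map g).map f := (AEMeasurable.map_map_of_aemeasurable hf' hg).symm
    _ ≤ (μ.restrict S).map f := by
        refine Measure.le_iff.2 fun A hA => ?_
        rw [Measure.map_apply_of_aemeasurable hf' hA, Measure.map_apply_of_aemeasurable hf hA]
        exact h2 _

/-! ### Densities and fields -/

section Density

variable {g : Phase → ℝ}

theorem aestronglyMeasurable_density (hg : AEStronglyMeasurable g volume) :
    AEStronglyMeasurable (density g) volume := by
  rw [Measure.volume_eq_prod] at hg
  exact hg.integral_prod_right'

theorem map_fst_withDensity (hg : Integrable g) (h0 : ∀ z, 0 ≤ g z) :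
    (volume.withDensity fun z => ENNReal.ofReal (g z)).map Prod.fst
      = volume.withDensity fun x => ENNReal.ofReal (density g x) := by
  have hg' := hg
  rw [Measure.volume_eq_prod] at hg'
  ext A hA
  rw [Measure.map_apply measurable_fst hA, withDensity_apply _ (measurable_fst hA),
    withDensity_apply _ hA]
  have e : (Prod.fst ⁻¹' A : Set Phase) = A ×ˢ univ := by ext z; simp
  rw [e, Measure.volume_eq_prod, ← Measure.prod_restrict, Measure.restrict_univ]
  rw [lintegral_prod]
  · refine setLIntegral_congr_fun_ae hA ?_
    filter_upwards [hg'.prod_right_ae] with x hx _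
    exact (ofReal_integral_eq_lintegral_ofReal hx (ae_of_all _ fun v => h0 _)).symm
  · rw [← Measure.restrict_univ (μ := (volume : Measure Space)), Measure.prod_restrict]
    simp only [Measure.restrict_univ]
    exact hg'.1.aemeasurable.ennreal_ofReal.restrict

theorem electricField_eq_integral (hg : Integrable g) (h0 : ∀ z, 0 ≤ g z) (x : Space) :
    electricField g x
      = ∫ y, coulomb (x - y) ∂((volume.withDensity fun z => ENNReal.ofReal (g z)).map Prod.fst) := by
  rw [map_fst_withDensity hg h0, integral_withDensity_eq_integral_toReal_smul₀
    (aestronglyMeasurable_density hg.1).aemeasurable.ennreal_ofReal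
    (ae_of_all _ fun _ => ENNReal.ofReal_lt_top)]
  refine integral_congr_ae (ae_of_all _ fun y => ?_)
  simp only
  rw [ENNReal.toReal_ofReal (show 0 ≤ density g y from integral_nonneg fun v => h0 _)]

/-- In this form the integrand is jointly measurable in time and phase as soon as `f` is, which
yields measurability of the field in time. -/
theorem electricField_eq_integral_phase (hg : Integrable g) (h0 : ∀ z, 0 ≤ g z) (x : Space) :
    electricField g x = ∫ z : Phase, g z • coulomb (x - z.1) := by
  rw [electricField_eq_integral hg h0,
    integral_map (f := fun y => coulomb (x - y)) measurable_fst.aemeasurable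
    (measurable_coulomb.comp (measurable_const.sub measurable_id)).aestronglyMeasurable,
    integral_withDensity_eq_integral_toReal_smul₀ hg.1.aemeasurable.ennreal_ofReal
    (ae_of_all _ fun _ => ENNReal.ofReal_lt_top)]
  refine integral_congr_ae (ae_of_all _ fun y => ?_)
  simp only
  rw [ENNReal.toReal_ofReal (h0 _)]

theorem withDensity_le_of_eLpNorm_le {α : Type*} [MeasurableSpace α] {μ : Measure α} {k : α → ℝ}
    {D : ℝ} (hk : eLpNorm k ∞ μ ≤ ENNReal.ofReal D) :
    μ.withDensity (fun x => ENNReal.ofReal (k x)) ≤ ENNReal.ofReal D • μ := by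
  rw [← withDensity_const]
  refine withDensity_mono ?_
  rw [eLpNorm_exponent_top] at hk
  filter_upwards [ae_le_eLpNormEssSup (f := k) (μ := μ)] with x hx
  refine le_trans ?_ (hx.trans hk)
  rw [← ofReal_norm]
  exact ENNReal.ofReal_le_ofReal (le_abs_self _)

end Density

end PlasmaCharge
end

noncomputable section

namespace PlasmaCharge

/-! ### The flow of a solution preserves volumes -/

namespace IsSolution

variable {T : ℝ} {f₀ : Phase → ℝ} {ξ₀ η₀ : Space} {ξ η : ℝ → Space} {f : ℝ → Phase → ℝ}
  {φ : ℝ → ℝ → Phase → Phase}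

theorem ne_of_mem_tsupport (h : IsSolution T f₀ ξ₀ η₀ ξ η f φ) {t : ℝ} (ht : t ∈ Icc 0 T)
    {z : Phase} (hz : z ∈ tsupport (f t)) : z ∈ awayFrom (ξ t) := by
  obtain ⟨δ, hδ, hlow⟩ := h.lower
  have h1 := hlow t ht t ht z hz
  rw [h.flow_init t ht z hz] at h1
  intro he
  rw [he] at h1
  simp at h1
  linarith

theorem transport_flow (h : IsSolution T f₀ ξ₀ η₀ ξ η f φ) {s t : ℝ} (hs : s ∈ Icc 0 T)
    (ht : t ∈ Icc 0 T) {z : Phase} (hz : z ∈ awayFrom (ξ s)) : f t (φ s t z) = f s z := by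
  have h0 : (0 : ℝ) ∈ Icc 0 T := ⟨le_rfl, hs.1.trans hs.2⟩
  have hw := h.flow_mapsTo s hs 0 h0 hz
  have e1 := h.transport t ht _ hw
  have e2 := h.transport s hs _ hw
  rw [h.flow_comp s hs 0 h0 t ht z hz] at e1
  rw [h.flow_comp s hs 0 h0 s hs z hz, h.flow_self s hs z hz] at e2
  rw [e1, e2]

theorem mapsTo_support (h : IsSolution T f₀ ξ₀ η₀ ξ η f φ) {s t : ℝ} (hs : s ∈ Icc 0 T)
    (ht : t ∈ Icc 0 T) :
    MapsTo (φ s t) (Function.support (f s)) (Function.support (f t)) := by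
  intro z hz
  rw [Function.mem_support, h.transport_flow hs ht (h.ne_of_mem_tsupport hs (subset_tsupport _ hz))]
  exact hz

theorem nonneg (h : IsSolution T f₀ ξ₀ η₀ ξ η f φ) (hf : IsInitialDatum f₀ ξ₀) {t : ℝ}
    (ht : t ∈ Icc 0 T) (z : Phase) : 0 ≤ f t z := by
  by_cases hz : z ∈ Function.support (f t)
  · have h0 : (0 : ℝ) ∈ Icc 0 T := ⟨le_rfl, ht.1.trans ht.2⟩
    have hz' := h.ne_of_mem_tsupport ht (subset_tsupport _ hz)
    have e := h.transport t ht _ (h.flow_mapsTo t ht 0 h0 hz')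
    rw [h.flow_comp t ht 0 h0 t ht z hz', h.flow_self t ht z hz'] at e
    rw [e]
    exact hf.nonneg _
  · rw [Function.notMem_support.1 hz]

/-- Transport says nothing at positions equal to that of the charge; there both functions vanish
because both supports stay away from it. -/
theorem apply_zero (h : IsSolution T f₀ ξ₀ η₀ ξ η f φ) (hf : IsInitialDatum f₀ ξ₀) (hT : 0 ≤ T) :
    f 0 = f₀ := by
  have h0 : (0 : ℝ) ∈ Icc 0 T := ⟨le_rfl, hT⟩
  ext z
  by_cases hz : z ∈ awayFrom (ξ 0)
  · have e := h.transport 0 h0 z hz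
    rwa [h.flow_self 0 h0 z hz] at e
  · have h1 : f 0 z = 0 := by
      by_contra hne
      exact hz (h.ne_of_mem_tsupport h0 (subset_tsupport _ hne))
    have h2 : f₀ z = 0 := by
      by_contra hne
      obtain ⟨δ₀, hδ₀, hlow⟩ := hf.away
      have h3 := hlow z (subset_tsupport _ hne)
      rw [← h.ξ_zero, not_not.1 hz] at h3
      simp at h3
      linarith
    rw [h1, h2]

theorem integrable (h : IsSolution T f₀ ξ₀ η₀ ξ η f φ) {t : ℝ} (ht : t ∈ Icc 0 T) :
    Integrable (f t) := by
  obtain ⟨M, hM⟩ := h.bounded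
  rw [← memLp_one_iff_integrable]
  exact ⟨h.aestronglyMeasurable_apply t ht, (hM t ht).1.trans_lt ENNReal.coe_lt_top⟩

/-- The plasma density is bounded and has bounded mass, uniformly in time. -/
theorem exists_density_bound (h : IsSolution T f₀ ξ₀ η₀ ξ η f φ) (hf : IsInitialDatum f₀ ξ₀) :
    ∃ D : ℝ, 0 ≤ D ∧ ∀ t ∈ Icc 0 T,
      (volume.withDensity fun z => ENNReal.ofReal (f t z)).map Prod.fst
        ≤ ENNReal.ofReal D • volume ∧
      (volume.withDensity fun z => ENNReal.ofReal (f t z)).map Prod.fst univ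
        ≤ ENNReal.ofReal D := by
  obtain ⟨M, hM⟩ := h.bounded
  refine ⟨M, M.2, fun t ht => ⟨?_, ?_⟩⟩
  · rw [map_fst_withDensity (h.integrable ht) (h.nonneg hf ht)]
    exact withDensity_le_of_eLpNorm_le (by simpa using (hM t ht).2.2)
  · rw [Measure.map_apply measurable_fst MeasurableSet.univ, preimage_univ,
      withDensity_apply _ MeasurableSet.univ, Measure.restrict_univ]
    refine le_trans (lintegral_mono fun z => ?_)
      (((eLpNorm_one_eq_lintegral_enorm (f := f t)).symm.le.trans (hM t ht).1).trans (by simp))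
    rw [← ofReal_norm]
    exact ENNReal.ofReal_le_ofReal (le_abs_self _)

theorem continuousOn_ξ (h : IsSolution T f₀ ξ₀ η₀ ξ η f φ) : ContinuousOn ξ (Icc 0 T) :=
  fun t ht => (h.hasDeriv_ξ t ht).continuousWithinAt

theorem aestronglyMeasurable_electricField (h : IsSolution T f₀ ξ₀ η₀ ξ η f φ)
    (hf : IsInitialDatum f₀ ξ₀) (x : Space) :
    AEStronglyMeasurable (fun t => electricField (f t) x) (volume.restrict (Icc 0 T)) := by
  have h1 : AEStronglyMeasurable (fun p : ℝ × Phase => f p.1 p.2 • coulomb (x - p.2.1))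
      ((volume.restrict (Icc 0 T)).prod volume) :=
    h.aestronglyMeasurable.smul
      (measurable_coulomb.comp (g := coulomb) (f := fun p : ℝ × Phase => x - p.2.1)
        (by fun_prop)).aestronglyMeasurable
  refine h1.integral_prod_right'.congr ?_
  refine (ae_restrict_iff' measurableSet_Icc).2 (ae_of_all _ fun t ht => ?_)
  exact (electricField_eq_integral_phase (h.integrable ht) (h.nonneg hf ht) x).symm

/-- Iterates of the scheme may come close to the charge even though true trajectories do not.
Cutting the repulsion at the distance `δ` that all trajectories respect makes the force globally
bounded and log-Lipschitz without altering it along them. -/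
theorem exists_isLogLipschitz (h : IsSolution T f₀ ξ₀ η₀ ξ η f φ) (hf : IsInitialDatum f₀ ξ₀)
    {δ : ℝ} (hδ : 0 < δ) :
    ∃ A L : ℝ, ∀ s ∈ Icc 0 T, ∀ t ∈ Icc 0 T,
      IsLogLipschitz (fun r x => electricField (f r) x + cutCoulomb δ (x - ξ r)) s t A L := by
  obtain ⟨D, hD, hDt⟩ := h.exists_density_bound hf
  set C := 4 * Real.pi * D + D with hC
  have hC0 : 0 ≤ C := by positivity
  set A := C + (δ ^ 2)⁻¹ with hA
  set L := 8 * C + 8 * (δ ^ 3)⁻¹ with hL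
  have hbound : ∀ r ∈ Icc 0 T, ∀ x, ‖electricField (f r) x + cutCoulomb δ (x - ξ r)‖ ≤ A := by
    intro r hr x
    refine (norm_add_le _ _).trans (add_le_add ?_ (norm_cutCoulomb_le hδ _))
    rw [electricField_eq_integral (h.integrable hr) (h.nonneg hf hr)]
    exact norm_integral_coulomb_le hD hD (hDt r hr).1 (hDt r hr).2 x
  refine ⟨A, L, fun s hs t ht => ⟨by positivity, fun x => ?_, fun r hr x => ?_, ?_⟩⟩
  · have hsub : uIoc s t ⊆ Icc 0 T :=
      uIoc_subset_uIcc.trans (ordConnected_Icc.uIcc_subset hs ht)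
    rw [intervalIntegrable_iff]
    have : IsFiniteMeasure (volume.restrict (uIoc s t)) :=
      inferInstanceAs (IsFiniteMeasure (volume.restrict (Ioc _ _)))
    refine Integrable.of_bound (C := A) ?_ ?_
    · refine AEStronglyMeasurable.mono_measure ?_ (Measure.restrict_mono hsub le_rfl)
      refine (h.aestronglyMeasurable_electricField hf x).add ?_
      refine ContinuousOn.aestronglyMeasurable ?_ measurableSet_Icc
      exact (continuous_cutCoulomb hδ).comp_continuousOn (continuousOn_const.sub h.continuousOn_ξ)
    · exact (ae_restrict_iff' measurableSet_uIoc).2 (ae_of_all _ fun r hr => hbound r (hsub hr) x)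
  · exact hbound r (ordConnected_Icc.uIcc_subset hs ht hr) x
  · intro r hr' ε hε hε1 x y
    have hr : r ∈ Icc 0 T := ordConnected_Icc.uIcc_subset hs ht hr'
    have hlog : 0 ≤ Real.log ε⁻¹ := Real.log_nonneg (one_le_inv_iff₀.2 ⟨hε, hε1⟩)
    have h1 := norm_integral_coulomb_sub_le hD hD (hDt r hr).1 (hDt r hr).2 hε hε1 x y
    rw [← electricField_eq_integral (h.integrable hr) (h.nonneg hf hr),
      ← electricField_eq_integral (h.integrable hr) (h.nonneg hf hr), ← hC] at h1
    have h2 := norm_cutCoulomb_sub_le_lipschitz hδ (x - ξ r) (y - ξ r)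
    rw [sub_sub_sub_cancel_right] at h2
    have e : electricField (f r) x + cutCoulomb δ (x - ξ r)
          - (electricField (f r) y + cutCoulomb δ (y - ξ r))
        = (electricField (f r) x - electricField (f r) y)
          + (cutCoulomb δ (x - ξ r) - cutCoulomb δ (y - ξ r)) := by abel
    rw [e]
    refine (norm_add_le _ _).trans ((add_le_add h1 h2).trans ?_)
    have p1 : 0 ≤ (δ ^ 3)⁻¹ := by positivity
    have p2 : 0 ≤ (δ ^ 3)⁻¹ * ε := by positivity
    have p3 : 0 ≤ (δ ^ 3)⁻¹ * Real.log ε⁻¹ * ‖x - y‖ := by positivity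
    have p4 : 0 ≤ C * ε := by positivity
    rw [hL]
    nlinarith

theorem tendsto_euler (h : IsSolution T f₀ ξ₀ η₀ ξ η f φ) {δ A L : ℝ}
    (hlow : ∀ τ ∈ Icc 0 T, ∀ t ∈ Icc 0 T, ∀ z ∈ tsupport (f τ), δ ≤ ‖(φ τ t z).1 - ξ t‖)
    {s t : ℝ} (hs : s ∈ Icc 0 T) (ht : t ∈ Icc 0 T)
    (hF : IsLogLipschitz (fun r x => electricField (f r) x + cutCoulomb δ (x - ξ r)) s t A L)
    (hshort : |t - s| * L ≤ 1 / 2) {z : Phase} (hz : z ∈ tsupport (f s)) :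
    Filter.Tendsto (fun N : ℕ =>
      euler (fun r x => electricField (f r) x + cutCoulomb δ (x - ξ r)) s ((t - s) / N) N z)
      Filter.atTop (nhds (φ s t z)) := by
  have hsub : uIcc s t ⊆ Icc 0 T := ordConnected_Icc.uIcc_subset hs ht
  have hvc : ContinuousOn (fun r => (φ s r z).2) (Icc 0 T) :=
    fun r hr => (h.hasDeriv_V s hs z hz r hr).continuousWithinAt
  obtain ⟨B, hB⟩ := isCompact_Icc.exists_bound_of_continuousOn hvc
  have := PlasmaCharge.tendsto_euler (x := fun r => (φ s r z).1) (v := fun r => (φ s r z).2)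
    (B := B) hF (fun r hr => (h.hasDeriv_X s hs z hz r (hsub hr)).mono hsub)
    (fun r hr => by
      have := (h.hasDeriv_V s hs z hz r (hsub hr)).mono hsub
      rwa [← cutCoulomb_eq_coulomb (hlow s hs r (hsub hr) z hz)] at this)
    (fun r hr => hB r (hsub hr)) hshort
  simpa only [Prod.mk.eta, h.flow_init s hs z hz] using this

/-- The flow from time `s` to time `t` preserves volumes on the support of the plasma. -/
def PreservesVolume (f : ℝ → Phase → ℝ) (φ : ℝ → ℝ → Phase → Phase) (s t : ℝ) : Prop :=
  AEMeasurable (φ s t) (volume.restrict (Function.support (f s))) ∧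
    (volume.restrict (Function.support (f s))).map (φ s t)
      = volume.restrict (Function.support (f t))

theorem nullMeasurableSet_support (h : IsSolution T f₀ ξ₀ η₀ ξ η f φ) {t : ℝ} (ht : t ∈ Icc 0 T) :
    NullMeasurableSet (Function.support (f t)) volume :=
  (h.aestronglyMeasurable_apply t ht).aemeasurable.nullMeasurableSet_preimage
    (measurableSet_singleton (0 : ℝ)).compl

/-- For short times the flow and its inverse are both limits of measure-preserving maps, so neither
image measure exceeds the volume; being inverse to each other between the supports, both preserve
it. -/
theorem exists_preservesVolume_of_short (h : IsSolution T f₀ ξ₀ η₀ ξ η f φ)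
    (hf : IsInitialDatum f₀ ξ₀) :
    ∃ τ : ℝ, 0 < τ ∧ ∀ s ∈ Icc 0 T, ∀ t ∈ Icc 0 T, |t - s| ≤ τ → PreservesVolume f φ s t := by
  obtain ⟨δ, hδ, hlow⟩ := h.lower
  obtain ⟨A, L, hF⟩ := h.exists_isLogLipschitz hf hδ
  refine ⟨1 / (2 * (|L| + 1)), by positivity, ?_⟩
  have hone : ∀ s ∈ Icc 0 T, ∀ t ∈ Icc 0 T, |t - s| ≤ 1 / (2 * (|L| + 1)) →
      AEMeasurable (φ s t) (volume.restrict (Function.support (f s))) ∧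
      (volume.restrict (Function.support (f s))).map (φ s t) ≤ volume := by
    intro s hs t ht hst
    have hshort : |t - s| * L ≤ 1 / 2 := by
      calc |t - s| * L ≤ |t - s| * (|L| + 1) := by gcongr; linarith [le_abs_self L]
        _ ≤ 1 / (2 * (|L| + 1)) * (|L| + 1) := by gcongr
        _ = 1 / 2 := by field_simp
    -- The index is shifted by one because the scheme with zero steps has no meaning as a
    -- subdivision.
    have hmp : ∀ n : ℕ, MeasurePreserving (euler (fun r x => electricField (f r) x
        + cutCoulomb δ (x - ξ r)) s ((t - s) / (n + 1 : ℕ)) (n + 1)) volume volume :=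
      fun n => (hF s hs t ht).measurePreserving_euler n.succ_pos le_rfl
    have hlim : ∀ z ∈ Function.support (f s), Filter.Tendsto (fun n : ℕ =>
        euler (fun r x => electricField (f r) x + cutCoulomb δ (x - ξ r)) s
          ((t - s) / (n + 1 : ℕ)) (n + 1) z) Filter.atTop (nhds (φ s t z)) :=
      fun z hz => (h.tendsto_euler hlow hs ht (hF s hs t ht) hshort
        (subset_tsupport _ hz)).comp (Filter.tendsto_add_atTop_nat 1)
    exact ⟨aemeasurable_of_tendsto_measurePreserving hmp (h.nullMeasurableSet_support hs) hlim,
      map_restrict_le_of_tendsto_measurePreserving hmp (h.nullMeasurableSet_support hs) hlim⟩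
  intro s hs t ht hst
  have h1 := hone s hs t ht hst
  have h2 := hone t ht s hs (by rwa [abs_sub_comm])
  refine ⟨h1.1, map_restrict_eq_of_inverse (h.nullMeasurableSet_support hs)
    (h.nullMeasurableSet_support ht) h1.1 h2.1 h1.2 h2.2 (h.mapsTo_support hs ht)
    (h.mapsTo_support ht hs) fun z hz => ?_⟩
  have hz' := h.ne_of_mem_tsupport ht (subset_tsupport _ hz)
  rw [h.flow_comp t ht s hs t ht z hz', h.flow_self t ht z hz']

theorem PreservesVolume.trans (h : IsSolution T f₀ ξ₀ η₀ ξ η f φ) {s r t : ℝ} (hs : s ∈ Icc 0 T)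
    (hr : r ∈ Icc 0 T) (ht : t ∈ Icc 0 T) (h1 : PreservesVolume f φ s r)
    (h2 : PreservesVolume f φ r t) : PreservesVolume f φ s t := by
  have h2m : AEMeasurable (φ r t) ((volume.restrict (Function.support (f s))).map (φ s r)) := by
    rw [h1.2]; exact h2.1
  have e : φ r t ∘ φ s r =ᵐ[volume.restrict (Function.support (f s))] φ s t := by
    refine (ae_restrict_iff'₀ (h.nullMeasurableSet_support hs)).2 (ae_of_all _ fun z hz => ?_)
    exact h.flow_comp s hs r hr t ht z (h.ne_of_mem_tsupport hs (subset_tsupport _ hz))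
  refine ⟨(h2m.comp_aemeasurable h1.1).congr e, ?_⟩
  rw [← Measure.map_congr e, ← AEMeasurable.map_map_of_aemeasurable h2m h1.1, h1.2, h2.2]

theorem preservesVolume (h : IsSolution T f₀ ξ₀ η₀ ξ η f φ) (hf : IsInitialDatum f₀ ξ₀) {t : ℝ}
    (ht : t ∈ Icc 0 T) : PreservesVolume f φ 0 t := by
  obtain ⟨τ, hτ, hshort⟩ := h.exists_preservesVolume_of_short hf
  obtain ⟨N, hN⟩ := exists_nat_gt (t / τ)
  have ht0 : 0 ≤ t := ht.1
  have hN0 : (0 : ℝ) < N := lt_of_le_of_lt (by positivity) hN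
  have hmem : ∀ n : ℕ, n ≤ N → (n : ℝ) * (t / N) ∈ Icc 0 T := by
    intro n hn
    have hn' : (n : ℝ) ≤ N := by exact_mod_cast hn
    refine ⟨by positivity, le_trans ?_ ht.2⟩
    calc (n : ℝ) * (t / N) ≤ N * (t / N) := by gcongr
      _ = t := by field_simp
  have hind : ∀ n : ℕ, n ≤ N → PreservesVolume f φ 0 (n * (t / N)) := by
    intro n
    induction n with
    | zero =>
      intro _
      have h0 := hmem 0 (Nat.zero_le _)
      have := hshort _ h0 _ h0 (by simpa using hτ.le)
      simpa using this
    | succ n ih =>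
      intro hn
      have h0 : (0 : ℝ) ∈ Icc 0 T := by simpa using hmem 0 (Nat.zero_le _)
      refine PreservesVolume.trans h h0 (hmem n (by omega)) (hmem _ hn) (ih (by omega))
        (hshort _ (hmem n (by omega)) _ (hmem _ hn) ?_)
      have e : ((n + 1 : ℕ) : ℝ) * (t / N) - n * (t / N) = t / N := by push_cast; ring
      rw [e, abs_of_nonneg (by positivity), div_le_iff₀ hN0]
      rw [div_lt_iff₀ hτ] at hN
      linarith
  have := hind N le_rfl
  rwa [show (N : ℝ) * (t / N) = t by field_simp] at this

end IsSolution

end PlasmaCharge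
end

noncomputable section

namespace PlasmaCharge

/-! ### The Lagrangian description -/

/-- A process with a.e. continuous paths has a jointly measurable version. -/
theorem exists_measurable_version {Ω E : Type*} [MeasurableSpace Ω] [MeasurableSpace E]
    [TopologicalSpace E] [BorelSpace E] [TopologicalSpace.PseudoMetrizableSpace E] [Inhabited E]
    {μ : Measure Ω} {T : ℝ} (hT : 0 ≤ T) {Z : ℝ → Ω → E}
    (hm : ∀ t ∈ Icc 0 T, AEMeasurable (Z t) μ)
    (hc : ∀ᵐ ω ∂μ, ContinuousOn (fun t => Z t ω) (Icc 0 T)) :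
    ∃ Z' : ℝ → Ω → E, Measurable (Function.uncurry Z') ∧
      ∀ᵐ ω ∂μ, ∀ t ∈ Icc 0 T, Z' t ω = Z t ω := by
  classical
  have hne : Nonempty (Icc (0 : ℝ) T) := ⟨⟨0, le_rfl, hT⟩⟩
  let d : ℕ → Icc (0 : ℝ) T := TopologicalSpace.denseSeq _
  have hd : DenseRange d := TopologicalSpace.denseRange_denseSeq _
  have hae : ∀ᵐ ω ∂μ, ContinuousOn (fun t => Z t ω) (Icc 0 T) ∧
      ∀ n, Z (d n) ω = (hm (d n) (d n).2).mk _ ω := by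
    filter_upwards [hc, ae_all_iff.2 fun n => (hm (d n) (d n).2).ae_eq_mk] with ω h1 h2
    exact ⟨h1, h2⟩
  obtain ⟨N, hN, hNm, hN0⟩ := exists_measurable_superset_of_null (ae_iff.1 hae)
  have hG : ∀ ω ∉ N, ContinuousOn (fun t => Z t ω) (Icc 0 T) ∧
      ∀ n, Z (d n) ω = (hm (d n) (d n).2).mk _ ω := by
    intro ω hω
    by_contra hcon
    exact hω (hN hcon)
  -- Off a measurable null set this is `Z` frozen outside `[0,T]`, on it a constant. Every path is
  -- then continuous, so measurability at a countable dense set of times is enough.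
  let Z' : ℝ → Ω → E := fun t ω => if ω ∈ N then default else Z (projIcc 0 T hT t) ω
  refine ⟨Z', ?_, ?_⟩
  · have hd' : ∀ n, Measurable (Z' (d n)) := by
      intro n
      have e : Z' (d n) = fun ω => if ω ∈ N then default else (hm (d n) (d n).2).mk _ ω := by
        ext ω
        by_cases hω : ω ∈ N
        · simp [Z', hω]
        · simp only [Z', hω, if_false, projIcc_val]
          exact (hG ω hω).2 n
      rw [e]
      exact Measurable.ite hNm measurable_const (hm (d n) (d n).2).measurable_mk
    have hcont : ∀ ω, Continuous fun t => Z' t ω := by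
      intro ω
      by_cases hω : ω ∈ N
      · simp only [Z', hω, if_true]; exact continuous_const
      · simp only [Z', hω, if_false]
        exact (hG ω hω).1.comp_continuous (continuous_subtype_val.comp continuous_projIcc)
          fun t => (projIcc 0 T hT t).2
    refine measurable_uncurry_of_continuous_of_measurable hcont fun t => ?_
    have e : Z' t = Z' (projIcc 0 T hT t) := by
      ext ω; simp [Z']
    rw [e]
    obtain ⟨u, hu, hlim⟩ := mem_closure_iff_seq_limit.1 (hd (projIcc 0 T hT t))
    refine measurable_of_tendsto_metrizable (f := fun n => Z' (u n)) (fun n => ?_) ?_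
    · obtain ⟨k, hk⟩ := hu n
      rw [← hk]; exact hd' k
    · rw [tendsto_pi_nhds]
      intro ω
      exact ((hcont ω).comp continuous_subtype_val).continuousAt.tendsto.comp hlim
  · have : ∀ᵐ ω ∂μ, ω ∉ N := measure_eq_zero_iff_ae_notMem.1 hN0
    filter_upwards [this] with ω hω t ht
    simp [Z', hω, projIcc_of_mem hT ht]

/-- The field at time `t` of the plasma whose particles are at `X t z`, `z` being distributed
according to `μ`. -/
def plasmaField (μ : Measure Phase) (X : ℝ → Phase → Space) (t : ℝ) (x : Space) : Space :=
  ∫ z, coulomb (x - X t z) ∂μ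

/-- The trajectory `(x, v)` of a plasma particle in the field `E` and in that of the charge. -/
structure IsTrajectory (T δ : ℝ) (ξ : ℝ → Space) (E : ℝ → Space → Space) (x v : ℝ → Space) :
    Prop where
  lower : ∀ t ∈ Icc 0 T, δ ≤ ‖x t - ξ t‖
  hasDeriv_x : ∀ t ∈ Icc 0 T, HasDerivWithinAt x (v t) (Icc 0 T) t
  hasDeriv_v : ∀ t ∈ Icc 0 T,
    HasDerivWithinAt v (E t (x t) + coulomb (x t - ξ t)) (Icc 0 T) t

/-- The Lagrangian description of a solution: the particles `z`, distributed according to `μ`,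
move along the trajectories `(X · z, V · z)`. -/
structure IsLagrangian (T δ D B M : ℝ) (μ : Measure Phase) (ξ η : ℝ → Space)
    (X V : ℝ → Phase → Space) : Prop where
  prob : IsProbabilityMeasure μ
  δ_pos : 0 < δ
  D_nonneg : 0 ≤ D
  M_nonneg : 0 ≤ M
  measurable_X : Measurable (Function.uncurry X)
  measurable_V : Measurable (Function.uncurry V)
  trajectory : ∀ᵐ z ∂μ, IsTrajectory T δ ξ (plasmaField μ X) (fun t => X t z) (fun t => V t z)
  speed : ∀ᵐ z ∂μ, ∀ t ∈ Icc 0 T, ‖V t z‖ ≤ B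
  density_le : ∀ t ∈ Icc 0 T, μ.map (X t) ≤ ENNReal.ofReal D • volume
  phase_le : ∀ t ∈ Icc 0 T, μ.map (fun z => (X t z, V t z)) ≤ ENNReal.ofReal M • volume
  hasDeriv_ξ : ∀ t ∈ Icc 0 T, HasDerivWithinAt ξ (η t) (Icc 0 T) t
  hasDeriv_η : ∀ t ∈ Icc 0 T, HasDerivWithinAt η (plasmaField μ X t (ξ t)) (Icc 0 T) t

/-- The measure with density `g`. -/
def plasmaMeasure (g : Phase → ℝ) : Measure Phase :=
  volume.withDensity fun z => ENNReal.ofReal (g z)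

theorem IsInitialDatum.integrable {f₀ : Phase → ℝ} {ξ₀ : Space} (hf : IsInitialDatum f₀ ξ₀) :
    Integrable f₀ := by
  by_contra h
  have := hf.integral_eq_one
  rw [integral_undef h] at this
  norm_num at this

theorem IsInitialDatum.isProbabilityMeasure {f₀ : Phase → ℝ} {ξ₀ : Space}
    (hf : IsInitialDatum f₀ ξ₀) : IsProbabilityMeasure (plasmaMeasure f₀) := by
  refine ⟨?_⟩
  rw [plasmaMeasure, withDensity_apply _ MeasurableSet.univ, Measure.restrict_univ,
    ← ofReal_integral_eq_lintegral_ofReal hf.integrable (ae_of_all _ hf.nonneg),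
    hf.integral_eq_one, ENNReal.ofReal_one]

theorem ae_mem_support {g : Phase → ℝ} (hg : AEStronglyMeasurable g volume) :
    ∀ᵐ z ∂(plasmaMeasure g), z ∈ Function.support g := by
  rw [plasmaMeasure, ae_withDensity_iff' hg.aemeasurable.ennreal_ofReal]
  refine ae_of_all _ fun z hz h0 => hz ?_
  rw [h0, ENNReal.ofReal_zero]

namespace IsSolution

variable {T : ℝ} {f₀ : Phase → ℝ} {ξ₀ η₀ : Space} {ξ η : ℝ → Space} {f : ℝ → Phase → ℝ}
  {φ : ℝ → ℝ → Phase → Phase}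

theorem plasmaMeasure_absolutelyContinuous (h : IsSolution T f₀ ξ₀ η₀ ξ η f φ) {t : ℝ}
    (ht : t ∈ Icc 0 T) :
    plasmaMeasure (f t) ≪ volume.restrict (Function.support (f t)) := by
  refine Measure.AbsolutelyContinuous.mk fun A hA h0 => ?_
  rw [Measure.restrict_apply hA] at h0
  have h1 : plasmaMeasure (f t) (A ∩ Function.support (f t)) = 0 :=
    withDensity_absolutelyContinuous _ _ h0
  refine measure_mono_null_ae ?_ h1
  filter_upwards [ae_mem_support (h.aestronglyMeasurable_apply t ht)] with z hz hzA
  exact ⟨hzA, hz⟩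

theorem aemeasurable_flow (h : IsSolution T f₀ ξ₀ η₀ ξ η f φ) (hf : IsInitialDatum f₀ ξ₀)
    {t : ℝ} (ht : t ∈ Icc 0 T) : AEMeasurable (φ 0 t) (plasmaMeasure f₀) := by
  have hT : 0 ≤ T := ht.1.trans ht.2
  have h0 : (0 : ℝ) ∈ Icc 0 T := ⟨le_rfl, hT⟩
  have := (h.preservesVolume hf ht).1.mono_ac (h.plasmaMeasure_absolutelyContinuous h0)
  rwa [h.apply_zero hf hT] at this

/-- A volume-preserving map along which the density is constant transports the measure with that
density. Everything is restricted to the supports, where alone the flow is known to preserve volume.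
-/
theorem map_flow (h : IsSolution T f₀ ξ₀ η₀ ξ η f φ) (hf : IsInitialDatum f₀ ξ₀)
    {t : ℝ} (ht : t ∈ Icc 0 T) :
    (plasmaMeasure f₀).map (φ 0 t) = plasmaMeasure (f t) := by
  have hT : 0 ≤ T := ht.1.trans ht.2
  have h0 : (0 : ℝ) ∈ Icc 0 T := ⟨le_rfl, hT⟩
  obtain ⟨hm, hmap⟩ := h.preservesVolume hf ht
  have hrestr : ∀ r ∈ Icc 0 T, plasmaMeasure (f r)
      = (volume.restrict (Function.support (f r))).withDensity
        fun z => ENNReal.ofReal (f r z) := by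
    intro r hr
    have hn := h.nullMeasurableSet_support hr
    ext A hA
    rw [plasmaMeasure, withDensity_apply _ hA, withDensity_apply _ hA,
      Measure.restrict_restrict hA, ← lintegral_indicator₀ (hA.nullMeasurableSet.inter hn),
      ← lintegral_indicator hA]
    refine lintegral_congr fun z => ?_
    by_cases hz : f r z = 0
    · simp [indicator, hz]
    · by_cases hzA : z ∈ A
      · rw [indicator_of_mem hzA, indicator_of_mem (show z ∈ A ∩ Function.support (f r) from ⟨hzA, hz⟩)]
      · rw [indicator_of_notMem hzA, indicator_of_notMem fun hz' => hzA hz'.1]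
  have ae0 := h.apply_zero hf hT
  have hAE : AEMeasurable (φ 0 t) (plasmaMeasure f₀) := h.aemeasurable_flow hf ht
  rw [← ae0] at hAE ⊢
  ext A hA
  rw [Measure.map_apply_of_aemeasurable hAE hA, ← lintegral_indicator_one hA,
    ← lintegral_indicator_one₀ (hAE.nullMeasurableSet_preimage hA), hrestr 0 h0, hrestr t ht]
  have hft : AEMeasurable (fun z => ENNReal.ofReal (f t z))
      (volume.restrict (Function.support (f t))) :=
    (h.aestronglyMeasurable_apply t ht).aemeasurable.ennreal_ofReal.restrict
  have hf0 : AEMeasurable (fun z => ENNReal.ofReal (f 0 z))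
      (volume.restrict (Function.support (f 0))) :=
    (h.aestronglyMeasurable_apply 0 h0).aemeasurable.ennreal_ofReal.restrict
  rw [lintegral_withDensity_eq_lintegral_mul₀ hft
    (measurable_one.indicator hA).aemeasurable, ← hmap, lintegral_map' _ hm]
  · rw [lintegral_withDensity_eq_lintegral_mul₀' hf0]
    · refine lintegral_congr_ae ?_
      refine (ae_restrict_iff'₀ (h.nullMeasurableSet_support h0)).2 (ae_of_all _ fun z hz => ?_)
      simp only [Pi.mul_apply]
      rw [h.transport_flow h0 ht (h.ne_of_mem_tsupport h0 (subset_tsupport _ hz))]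
      rfl
    · rw [← hrestr 0 h0]
      have : (φ 0 t ⁻¹' A).indicator (1 : Phase → ℝ≥0∞) = A.indicator 1 ∘ φ 0 t := by
        ext z; rfl
      rw [this]
      exact (measurable_one.indicator hA).comp_aemeasurable hAE
  · rw [hmap]
    exact hft.mul (measurable_one.indicator hA).aemeasurable

/-- The bound must be `‖f₀‖_∞` and not the bound contained in the notion of solution, since the
final constant may depend only on the former; this is where volume preservation pays off. -/
theorem plasmaMeasure_le (h : IsSolution T f₀ ξ₀ η₀ ξ η f φ) (hf : IsInitialDatum f₀ ξ₀)
    {t : ℝ} (ht : t ∈ Icc 0 T) :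
    plasmaMeasure (f t) ≤ ENNReal.ofReal (eLpNorm f₀ ∞ volume).toReal • volume := by
  have hT : 0 ≤ T := ht.1.trans ht.2
  have h0 : (0 : ℝ) ∈ Icc 0 T := ⟨le_rfl, hT⟩
  obtain ⟨hm, hmap⟩ := h.preservesVolume hf ht
  set M := (eLpNorm f₀ ∞ volume).toReal with hM
  have hle : plasmaMeasure f₀ ≤ ENNReal.ofReal M • volume :=
    withDensity_le_of_eLpNorm_le (by rw [hM, ENNReal.ofReal_toReal hf.memLp_top.2.ne])
  have hAE := h.aemeasurable_flow hf ht
  rw [← h.map_flow hf ht]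
  refine Measure.le_iff.2 fun A hA => ?_
  rw [Measure.map_apply_of_aemeasurable hAE hA]
  have hae := ae_mem_support hf.integrable.1
  calc plasmaMeasure f₀ (φ 0 t ⁻¹' A)
      ≤ plasmaMeasure f₀ (φ 0 t ⁻¹' A ∩ Function.support f₀) := by
        refine measure_mono_ae ?_
        filter_upwards [hae] with z hz hzA
        exact ⟨hzA, hz⟩
    _ ≤ (ENNReal.ofReal M • volume) (φ 0 t ⁻¹' A ∩ Function.support f₀) := hle _
    _ = ENNReal.ofReal M * volume (φ 0 t ⁻¹' A ∩ Function.support f₀) := by simp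
    _ ≤ ENNReal.ofReal M * volume A := by
        refine mul_le_mul_right ?_ _
        rw [h.apply_zero hf hT] at hm hmap
        have hn : NullMeasurableSet (Function.support f₀) volume := by
          have := h.nullMeasurableSet_support h0
          rwa [h.apply_zero hf hT] at this
        calc volume (φ 0 t ⁻¹' A ∩ Function.support f₀)
            = (volume.restrict (Function.support f₀)) (φ 0 t ⁻¹' A) :=
              (Measure.restrict_apply₀' hn).symm
          _ = (volume.restrict (Function.support f₀)).map (φ 0 t) A :=
              (Measure.map_apply_of_aemeasurable hm hA).symm
          _ ≤ volume A := by rw [hmap]; exact Measure.restrict_apply_le _ _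
    _ = _ := by simp

end IsSolution

end PlasmaCharge
end

/-! ### Passage to the Lagrangian description -/

noncomputable section

namespace PlasmaCharge

theorem integral_density_mul {g : Phase → ℝ} (hg : Integrable g) (h0 : ∀ z, 0 ≤ g z)
    {k : Space → ℝ} (hk : StronglyMeasurable k) :
    ∫ x, density g x * k x = ∫ z, k z.1 ∂(plasmaMeasure g) := by
  rw [← integral_map (φ := Prod.fst) (f := k) measurable_fst.aemeasurable hk.aestronglyMeasurable,
    plasmaMeasure, map_fst_withDensity hg h0,
    integral_withDensity_eq_integral_toReal_smul₀
    (aestronglyMeasurable_density hg.1).aemeasurable.ennreal_ofReal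
    (ae_of_all _ fun _ => ENNReal.ofReal_lt_top)]
  refine integral_congr_ae (ae_of_all _ fun y => ?_)
  simp only [smul_eq_mul]
  rw [ENNReal.toReal_ofReal (show 0 ≤ density g y from integral_nonneg fun v => h0 _)]

theorem totalEnergy_eq {g : Phase → ℝ} (hg : Integrable g) (h0 : ∀ z, 0 ≤ g z) (ξ η : Space)
    [IsProbabilityMeasure (plasmaMeasure g)] :
    totalEnergy g ξ η = (1 / 2) * (∫ z, ‖z.2‖ ^ 2 ∂(plasmaMeasure g)) + (1 / 2) * ‖η‖ ^ 2
      + (∫ z, ‖z.1 - ξ‖⁻¹ ∂(plasmaMeasure g))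
      + (1 / 2) * ∫ z, ∫ z', ‖z.1 - z'.1‖⁻¹ ∂(plasmaMeasure g) ∂(plasmaMeasure g) := by
  have e1 : ∫ z : Phase, ‖z.2‖ ^ 2 * g z = ∫ z, ‖z.2‖ ^ 2 ∂(plasmaMeasure g) := by
    rw [plasmaMeasure, integral_withDensity_eq_integral_toReal_smul₀
      hg.1.aemeasurable.ennreal_ofReal (ae_of_all _ fun _ => ENNReal.ofReal_lt_top)]
    refine integral_congr_ae (ae_of_all _ fun y => ?_)
    simp only [smul_eq_mul]
    rw [ENNReal.toReal_ofReal (h0 _), mul_comm]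
  have e2 : ∫ x, density g x / ‖x - ξ‖ = ∫ z, ‖z.1 - ξ‖⁻¹ ∂(plasmaMeasure g) := by
    simp_rw [div_eq_mul_inv]
    exact integral_density_mul hg h0 (k := fun x => ‖x - ξ‖⁻¹)
      (Measurable.stronglyMeasurable (by fun_prop))
  have e3 : ∫ x, ∫ y, density g x * density g y / ‖x - y‖
      = ∫ z, ∫ z', ‖z.1 - z'.1‖⁻¹ ∂(plasmaMeasure g) ∂(plasmaMeasure g) := by
    have hi : ∀ x : Space, ∫ y, density g x * density g y / ‖x - y‖
        = density g x * ∫ z', ‖x - z'.1‖⁻¹ ∂(plasmaMeasure g) := by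
      intro x
      rw [← integral_density_mul hg h0 (k := fun y => ‖x - y‖⁻¹)
        (Measurable.stronglyMeasurable (by fun_prop)), ← integral_const_mul]
      refine integral_congr_ae (ae_of_all _ fun y => ?_)
      simp only
      rw [div_eq_mul_inv, mul_assoc]
    simp_rw [hi]
    refine integral_density_mul hg h0 (k := fun x => ∫ z', ‖x - z'.1‖⁻¹ ∂(plasmaMeasure g)) ?_
    refine StronglyMeasurable.integral_prod_right
      (f := fun (x : Space) (z' : Phase) => ‖x - z'.1‖⁻¹) ?_
    exact Measurable.stronglyMeasurable (by fun_prop)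
  rw [totalEnergy, e1, e2, e3]

/-- A purely qualitative bound on the speed: it depends on `δ` and on the field bound, hence on the
solution, and serves to dominate integrands. -/
theorem IsTrajectory.norm_le {T δ A B₀ : ℝ} {ξ : ℝ → Space} {E : ℝ → Space → Space}
    {x v : ℝ → Space} (h : IsTrajectory T δ ξ E x v) (hδ : 0 < δ)
    (hE : ∀ t ∈ Icc 0 T, ∀ x, ‖E t x‖ ≤ A) (hv : ‖v 0‖ ≤ B₀) {t : ℝ} (ht : t ∈ Icc 0 T) :
    ‖v t‖ ≤ B₀ + (A + (δ ^ 2)⁻¹) * T := by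
  have hT : 0 ≤ T := ht.1.trans ht.2
  have h0 : (0 : ℝ) ∈ Icc 0 T := ⟨le_rfl, hT⟩
  have hd := h.hasDeriv_v
  have hA0 : 0 ≤ A := (norm_nonneg _).trans (hE 0 h0 0)
  rw [← uIcc_of_le hT] at hd ht h0
  have hb : ∀ r ∈ uIcc 0 T, ‖E r (x r) + coulomb (x r - ξ r)‖ ≤ A + (δ ^ 2)⁻¹ := by
    intro r hr
    rw [uIcc_of_le hT] at hr
    refine (norm_add_le _ _).trans (add_le_add (hE r hr _) ?_)
    rw [norm_coulomb]
    have := h.lower r hr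
    gcongr
  have h1 := norm_sub_le_of_deriv_bound hd hb h0 ht
  rw [uIcc_of_le hT] at ht
  rw [sub_zero, abs_of_nonneg ht.1] at h1
  calc ‖v t‖ = ‖v 0 + (v t - v 0)‖ := by congr 1; abel
    _ ≤ ‖v 0‖ + ‖v t - v 0‖ := norm_add_le _ _
    _ ≤ B₀ + (A + (δ ^ 2)⁻¹) * T := by
        gcongr
        exact h1.trans (by gcongr; exact ht.2)

namespace IsSolution

variable {T : ℝ} {f₀ : Phase → ℝ} {ξ₀ η₀ : Space} {ξ η : ℝ → Space} {f : ℝ → Phase → ℝ}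
  {φ : ℝ → ℝ → Phase → Phase}

/-- The jointly measurable `X`, `V` agree with the flow only almost everywhere, which is enough for
averages. The suprema, however, run over every point of the support, so the trajectory and speed
statements are also kept for the flow itself at every such point. -/
theorem exists_isLagrangian (h : IsSolution T f₀ ξ₀ η₀ ξ η f φ) (hf : IsInitialDatum f₀ ξ₀)
    (hT : 0 ≤ T) :
    ∃ (δ D B : ℝ) (X V : ℝ → Phase → Space),
      IsLagrangian T δ D B (eLpNorm f₀ ∞ volume).toReal (plasmaMeasure f₀) ξ η X V ∧
      (∀ z ∈ tsupport f₀, IsTrajectory T δ ξ (plasmaField (plasmaMeasure f₀) X)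
        (fun t => (φ 0 t z).1) (fun t => (φ 0 t z).2)) ∧
      (∀ z ∈ tsupport f₀, ∀ t ∈ Icc 0 T, ‖(φ 0 t z).2‖ ≤ B) ∧
      (∀ᵐ z ∂(plasmaMeasure f₀), z ∈ tsupport f₀ ∧ ∀ t ∈ Icc 0 T,
        X t z = (φ 0 t z).1 ∧ V t z = (φ 0 t z).2) ∧
      totalEnergy f₀ ξ₀ η₀ = (1 / 2) * (∫ z, ‖V 0 z‖ ^ 2 ∂(plasmaMeasure f₀))
        + (1 / 2) * ‖η 0‖ ^ 2 + (∫ z, ‖X 0 z - ξ 0‖⁻¹ ∂(plasmaMeasure f₀))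
        + (1 / 2) * ∫ z, ∫ z', ‖X 0 z - X 0 z'‖⁻¹ ∂(plasmaMeasure f₀) ∂(plasmaMeasure f₀) := by
  have h0 : (0 : ℝ) ∈ Icc 0 T := ⟨le_rfl, hT⟩
  have ae0 := h.apply_zero hf hT
  obtain ⟨δ, hδ, hlow⟩ := h.lower
  obtain ⟨D, hD, hDt⟩ := h.exists_density_bound hf
  have hprob := hf.isProbabilityMeasure
  set μ := plasmaMeasure f₀ with hμ
  have hsupp : ∀ᵐ z ∂μ, z ∈ tsupport f₀ := by
    filter_upwards [ae_mem_support hf.integrable.1] with z hz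
    exact subset_tsupport _ hz
  have hXd : ∀ z ∈ tsupport f₀, ∀ t ∈ Icc 0 T,
      HasDerivWithinAt (fun s => (φ 0 s z).1) (φ 0 t z).2 (Icc 0 T) t := by
    intro z hz; rw [← ae0] at hz; exact h.hasDeriv_X 0 h0 z hz
  have hVd : ∀ z ∈ tsupport f₀, ∀ t ∈ Icc 0 T, HasDerivWithinAt (fun s => (φ 0 s z).2)
      (electricField (f t) (φ 0 t z).1 + coulomb ((φ 0 t z).1 - ξ t)) (Icc 0 T) t := by
    intro z hz; rw [← ae0] at hz; exact h.hasDeriv_V 0 h0 z hz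
  have hinit : ∀ z ∈ tsupport f₀, φ 0 0 z = z := by
    intro z hz; rw [← ae0] at hz; exact h.flow_init 0 h0 z hz
  have hlow' : ∀ z ∈ tsupport f₀, ∀ t ∈ Icc 0 T, δ ≤ ‖(φ 0 t z).1 - ξ t‖ := by
    intro z hz t ht; rw [← ae0] at hz; exact hlow 0 h0 t ht z hz
  obtain ⟨Z, hZm, hZ⟩ := exists_measurable_version (μ := μ) hT (Z := φ 0)
    (fun t ht => h.aemeasurable_flow hf ht) (by
      filter_upwards [hsupp] with z hz
      exact ContinuousOn.prodMk (fun t ht => (hXd z hz t ht).continuousWithinAt)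
        (fun t ht => (hVd z hz t ht).continuousWithinAt))
  set X : ℝ → Phase → Space := fun t z => (Z t z).1 with hX
  set V : ℝ → Phase → Space := fun t z => (Z t z).2 with hV
  have hXm : Measurable (Function.uncurry X) := measurable_fst.comp hZm
  have hVm : Measurable (Function.uncurry V) := measurable_snd.comp hZm
  have hmapZ : ∀ t ∈ Icc 0 T, μ.map (Z t) = plasmaMeasure (f t) := by
    intro t ht
    rw [← h.map_flow hf ht]
    refine Measure.map_congr ?_
    filter_upwards [hZ] with z hz using hz t ht
  have hZtm : ∀ t, Measurable (Z t) := fun t => hZm.comp measurable_prodMk_left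
  have hmapX : ∀ t ∈ Icc 0 T, μ.map (X t) = (plasmaMeasure (f t)).map Prod.fst := by
    intro t ht
    rw [← hmapZ t ht, Measure.map_map measurable_fst (hZtm t)]
    rfl
  have hfield : ∀ t ∈ Icc 0 T, ∀ x, electricField (f t) x = plasmaField μ X t x := by
    intro t ht x
    rw [electricField_eq_integral (h.integrable ht) (h.nonneg hf ht), plasmaField]
    have := hmapX t ht
    rw [plasmaMeasure] at this
    rw [← this, integral_map (f := fun y => coulomb (x - y))]
    · exact (measurable_fst.comp (hZtm t)).aemeasurable
    · exact (measurable_coulomb.comp (measurable_const.sub measurable_id)).aestronglyMeasurable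
  have htraj : ∀ z ∈ tsupport f₀, IsTrajectory T δ ξ (plasmaField μ X)
      (fun t => (φ 0 t z).1) (fun t => (φ 0 t z).2) := by
    intro z hz
    refine ⟨hlow' z hz, hXd z hz, fun t ht => ?_⟩
    rw [← hfield t ht]
    exact hVd z hz t ht
  obtain ⟨B₀, hB₀⟩ := hf.hasCompactSupport.isCompact.exists_bound_of_continuousOn
    (f := fun z : Phase => z.2) continuous_snd.continuousOn
  have hE : ∀ t ∈ Icc 0 T, ∀ x, ‖plasmaField μ X t x‖ ≤ 4 * Real.pi * D + D := by
    intro t ht x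
    rw [← hfield t ht, electricField_eq_integral (h.integrable ht) (h.nonneg hf ht)]
    exact norm_integral_coulomb_le hD hD (hDt t ht).1 (hDt t ht).2 x
  set B := B₀ + (4 * Real.pi * D + D + (δ ^ 2)⁻¹) * T with hB
  have hspeed : ∀ z ∈ tsupport f₀, ∀ t ∈ Icc 0 T, ‖(φ 0 t z).2‖ ≤ B := by
    intro z hz t ht
    exact (htraj z hz).norm_le hδ hE (by simpa only [hinit z hz] using hB₀ z hz) ht
  have hall : ∀ᵐ z ∂μ, z ∈ tsupport f₀ ∧ ∀ t ∈ Icc 0 T,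
      X t z = (φ 0 t z).1 ∧ V t z = (φ 0 t z).2 := by
    filter_upwards [hsupp, hZ] with z hz hz'
    exact ⟨hz, fun t ht => ⟨by rw [← hz' t ht], by rw [← hz' t ht]⟩⟩
  have hinit' : ∀ᵐ z ∂μ, X 0 z = z.1 ∧ V 0 z = z.2 := by
    filter_upwards [hall] with z hz
    rw [(hz.2 0 h0).1, (hz.2 0 h0).2, hinit z hz.1]
    exact ⟨rfl, rfl⟩
  refine ⟨δ, D, B, X, V, ⟨hprob, hδ, hD, ENNReal.toReal_nonneg, hXm, hVm, ?_, ?_, ?_, ?_,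
    h.hasDeriv_ξ, ?_⟩, htraj, hspeed, hall, ?_⟩
  · filter_upwards [hall] with z hz
    have ht := htraj z hz.1
    refine ⟨fun t hT' => ?_, fun t hT' => ?_, fun t hT' => ?_⟩
    · rw [(hz.2 t hT').1]; exact ht.lower t hT'
    · rw [(hz.2 t hT').2]
      exact (ht.hasDeriv_x t hT').congr (fun s hs => (hz.2 s hs).1) (hz.2 t hT').1
    · rw [(hz.2 t hT').1]
      exact (ht.hasDeriv_v t hT').congr (fun s hs => (hz.2 s hs).2) (hz.2 t hT').2
  · filter_upwards [hall] with z hz t ht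
    rw [(hz.2 t ht).2]; exact hspeed z hz.1 t ht
  · intro t ht
    rw [hmapX t ht]; exact (hDt t ht).1
  · intro t ht
    exact (hmapZ t ht).le.trans (h.plasmaMeasure_le hf ht)
  · intro t ht
    rw [← hfield t ht]; exact h.hasDeriv_η t ht
  · rw [totalEnergy_eq hf.integrable hf.nonneg, h.ξ_zero, h.η_zero]
    have e1 : ∫ z, ‖z.2‖ ^ 2 ∂μ = ∫ z, ‖V 0 z‖ ^ 2 ∂μ := by
      refine integral_congr_ae ?_
      filter_upwards [hinit'] with z hz
      rw [hz.2]
    have e2 : ∫ z, ‖z.1 - ξ₀‖⁻¹ ∂μ = ∫ z, ‖X 0 z - ξ₀‖⁻¹ ∂μ := by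
      refine integral_congr_ae ?_
      filter_upwards [hinit'] with z hz
      rw [hz.1]
    have e3 : ∫ z, ∫ z', ‖z.1 - z'.1‖⁻¹ ∂μ ∂μ = ∫ z, ∫ z', ‖X 0 z - X 0 z'‖⁻¹ ∂μ ∂μ := by
      refine integral_congr_ae ?_
      filter_upwards [hinit'] with z hz
      refine integral_congr_ae ?_
      filter_upwards [hinit'] with z' hz'
      rw [hz.1, hz'.1]
    rw [e1, e2, e3]

end IsSolution

end PlasmaCharge
end

noncomputable section

namespace PlasmaCharge

/-! ### Derivatives along curves -/

section Curves

variable {S : Set ℝ} {t : ℝ} {d w : ℝ → Space} {u a : Space}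

theorem hasDerivWithinAt_norm (hd : HasDerivWithinAt d u S t) (h0 : d t ≠ 0) :
    HasDerivWithinAt (fun s => ‖d s‖) (inner ℝ (d t) u / ‖d t‖) S t := by
  have h1 := hd.norm_sq
  have hpos : 0 < ‖d t‖ := norm_pos_iff.2 h0
  have h2 := h1.sqrt (by positivity)
  have e : (fun s => √(‖d s‖ ^ 2)) = fun s => ‖d s‖ := by
    ext s; exact Real.sqrt_sq (norm_nonneg _)
  rw [e, Real.sqrt_sq hpos.le] at h2
  convert h2 using 1
  field_simp

theorem hasDerivWithinAt_inv_norm (hd : HasDerivWithinAt d u S t) (h0 : d t ≠ 0) :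
    HasDerivWithinAt (fun s => ‖d s‖⁻¹) (-inner ℝ (coulomb (d t)) u) S t := by
  have hpos : 0 < ‖d t‖ := norm_pos_iff.2 h0
  refine HasDerivWithinAt.congr_deriv ((hasDerivWithinAt_norm hd h0).fun_inv hpos.ne') ?_
  rw [coulomb, real_inner_smul_left]
  field_simp

/-- The derivative of the component of `w` in the direction of `d`. -/
theorem hasDerivWithinAt_inner_div_norm (hd : HasDerivWithinAt d u S t)
    (hw : HasDerivWithinAt w a S t) (h0 : d t ≠ 0) :
    HasDerivWithinAt (fun s => inner ℝ (w s) (d s) / ‖d s‖)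
      ((inner ℝ a (d t) + inner ℝ (w t) u) / ‖d t‖
        - inner ℝ (w t) (d t) * inner ℝ (d t) u / ‖d t‖ ^ 3) S t := by
  have hpos : 0 < ‖d t‖ := norm_pos_iff.2 h0
  refine HasDerivWithinAt.congr_deriv
    ((hw.inner ℝ hd).fun_div (hasDerivWithinAt_norm hd h0) hpos.ne') ?_
  field_simp
  ring

/-- The smooth approximation `√(|x|² + R²)` of the norm. -/
def softNorm (R : ℝ) (x : Space) : ℝ := √(‖x‖ ^ 2 + R ^ 2)

theorem softNorm_sq (R : ℝ) (x : Space) : softNorm R x ^ 2 = ‖x‖ ^ 2 + R ^ 2 :=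
  Real.sq_sqrt (by positivity)

theorem le_softNorm {R : ℝ} (x : Space) : R ≤ softNorm R x :=
  Real.le_sqrt_of_sq_le (by nlinarith [sq_nonneg ‖x‖])

theorem norm_le_softNorm (R : ℝ) (x : Space) : ‖x‖ ≤ softNorm R x :=
  Real.le_sqrt_of_sq_le (by nlinarith [sq_nonneg R])

theorem softNorm_pos {R : ℝ} (hR : 0 < R) (x : Space) : 0 < softNorm R x :=
  hR.trans_le (le_softNorm x)

theorem continuous_softNorm (R : ℝ) : Continuous (softNorm R) := by
  unfold softNorm; fun_prop

theorem softNorm_neg (R : ℝ) (x : Space) : softNorm R (-x) = softNorm R x := by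
  simp [softNorm]

theorem hasDerivWithinAt_softNorm {R : ℝ} (hR : 0 < R) (hd : HasDerivWithinAt d u S t) :
    HasDerivWithinAt (fun s => softNorm R (d s)) (inner ℝ (d t) u / softNorm R (d t)) S t := by
  have h2 := (hd.norm_sq.add_const (R ^ 2)).sqrt (by positivity)
  refine HasDerivWithinAt.congr_deriv h2 ?_
  rw [mul_div_mul_left _ _ two_ne_zero]
  rfl

/-- The smoothed Coulomb field `x / (|x|² + R²)^{3/2}`. -/
def softCoulomb (R : ℝ) (x : Space) : Space := (softNorm R x ^ 3)⁻¹ • x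

theorem continuous_softCoulomb {R : ℝ} (hR : 0 < R) : Continuous (softCoulomb R) := by
  unfold softCoulomb
  refine Continuous.smul (Continuous.inv₀ ((continuous_softNorm R).pow 3) fun x => ?_) continuous_id
  exact (pow_pos (softNorm_pos hR x) 3).ne'

theorem softCoulomb_neg (R : ℝ) (x : Space) : softCoulomb R (-x) = -softCoulomb R x := by
  simp [softCoulomb, softNorm_neg]

theorem norm_softCoulomb_le {R : ℝ} (hR : 0 < R) (x : Space) :
    ‖softCoulomb R x‖ ≤ (R ^ 2)⁻¹ := by
  have hs := softNorm_pos hR x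
  rw [softCoulomb, norm_smul, norm_inv, norm_pow, Real.norm_of_nonneg hs.le]
  calc (softNorm R x ^ 3)⁻¹ * ‖x‖ ≤ (softNorm R x ^ 3)⁻¹ * softNorm R x := by
        gcongr; exact norm_le_softNorm R x
    _ = (softNorm R x ^ 2)⁻¹ := by field_simp
    _ ≤ (R ^ 2)⁻¹ := by gcongr; exact le_softNorm x

/-- Within distance `l` the error is at most the kernel, beyond it the expansion in `R` gives
`3R²/r⁴`. Keeping `l` and `R` independent allows `R` to be much smaller than `l`. -/
theorem norm_coulomb_sub_softCoulomb_le {R l : ℝ} (hR : 0 < R) (hl : 0 < l) (x : Space) :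
    ‖coulomb x - softCoulomb R x‖
      ≤ (Iio l).indicator (fun r => (r ^ 2)⁻¹) ‖x‖ + 3 * R ^ 2 * (l ^ 4)⁻¹ := by
  have hs := softNorm_pos hR x
  have hxs := norm_le_softNorm R x
  rcases eq_or_ne x 0 with rfl | hx
  · simp only [coulomb, softCoulomb, smul_zero, sub_zero, norm_zero]
    refine add_nonneg (indicator_nonneg (fun _ _ => by positivity) _) (by positivity)
  have hx' : 0 < ‖x‖ := norm_pos_iff.2 hx
  have hle : (softNorm R x ^ 3)⁻¹ ≤ (‖x‖ ^ 3)⁻¹ := by gcongr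
  have e : ‖coulomb x - softCoulomb R x‖ = ((‖x‖ ^ 3)⁻¹ - (softNorm R x ^ 3)⁻¹) * ‖x‖ := by
    rw [coulomb, softCoulomb, ← sub_smul, norm_smul, Real.norm_of_nonneg (by linarith)]
  rw [e]
  by_cases h : ‖x‖ < l
  · rw [indicator_of_mem (by exact h)]
    have h1 : ((‖x‖ ^ 3)⁻¹ - (softNorm R x ^ 3)⁻¹) * ‖x‖ ≤ (‖x‖ ^ 3)⁻¹ * ‖x‖ := by
      have : 0 ≤ (softNorm R x ^ 3)⁻¹ := by positivity
      gcongr; linarith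
    have h2 : (‖x‖ ^ 3)⁻¹ * ‖x‖ = (‖x‖ ^ 2)⁻¹ := by field_simp
    have h3 : 0 ≤ 3 * R ^ 2 * (l ^ 4)⁻¹ := by positivity
    linarith
  · rw [indicator_of_notMem (by exact h), zero_add]
    have h' := not_lt.1 h
    set r := ‖x‖
    set s := softNorm R x
    have hsq : s ^ 2 = r ^ 2 + R ^ 2 := softNorm_sq R x
    have key : ((r ^ 3)⁻¹ - (s ^ 3)⁻¹) * r ≤ 3 * R ^ 2 * (r ^ 4)⁻¹ := by
      have e2 : ((r ^ 3)⁻¹ - (s ^ 3)⁻¹) * r = (s ^ 3 - r ^ 3) / (r ^ 2 * s ^ 3) := by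
        field_simp
      have e3 : 3 * R ^ 2 * (r ^ 4)⁻¹ = 3 * R ^ 2 / r ^ 4 := by field_simp
      rw [e2, e3, div_le_div_iff₀ (by positivity) (by positivity)]
      have hfac : (s ^ 3 - r ^ 3) * (s + r) = R ^ 2 * (s ^ 2 + s * r + r ^ 2) := by
        have : R ^ 2 = s ^ 2 - r ^ 2 := by linarith
        rw [this]; ring
      have h4 : s ^ 3 - r ^ 3 ≤ 3 * R ^ 2 * s := by
        have : (s ^ 3 - r ^ 3) * (s + r) ≤ 3 * R ^ 2 * s * (s + r) := by
          rw [hfac]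
          have : s ^ 2 + s * r + r ^ 2 ≤ 3 * s * (s + r) := by nlinarith
          nlinarith [sq_nonneg R]
        exact le_of_mul_le_mul_right this (by positivity)
      calc (s ^ 3 - r ^ 3) * r ^ 4 ≤ 3 * R ^ 2 * s * r ^ 4 := by gcongr
        _ = 3 * R ^ 2 * (r ^ 2 * (s * r ^ 2)) := by ring
        _ ≤ 3 * R ^ 2 * (r ^ 2 * (s * s ^ 2)) := by gcongr
        _ = 3 * R ^ 2 * (r ^ 2 * s ^ 3) := by ring
    refine key.trans ?_
    gcongr

theorem hasDerivWithinAt_inv_softNorm {R : ℝ} (hR : 0 < R) (hd : HasDerivWithinAt d u S t) :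
    HasDerivWithinAt (fun s => (softNorm R (d s))⁻¹) (-inner ℝ (softCoulomb R (d t)) u) S t := by
  have hpos := softNorm_pos hR (d t)
  refine HasDerivWithinAt.congr_deriv ((hasDerivWithinAt_softNorm hR hd).fun_inv hpos.ne') ?_
  rw [softCoulomb, real_inner_smul_left]
  field_simp

theorem hasDerivWithinAt_inner_div_softNorm {R : ℝ} (hR : 0 < R) (hd : HasDerivWithinAt d u S t)
    (hw : HasDerivWithinAt w a S t) :
    HasDerivWithinAt (fun s => inner ℝ (w s) (d s) / (R + softNorm R (d s)))
      ((inner ℝ a (d t) + inner ℝ (w t) u) / (R + softNorm R (d t))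
        - inner ℝ (w t) (d t) * inner ℝ (d t) u
          / (softNorm R (d t) * (R + softNorm R (d t)) ^ 2)) S t := by
  have hpos := softNorm_pos hR (d t)
  have hpos' : 0 < R + softNorm R (d t) := by positivity
  refine HasDerivWithinAt.congr_deriv
    ((hw.inner ℝ hd).fun_div ((hasDerivWithinAt_softNorm hR hd).const_add R) hpos'.ne') ?_
  field_simp
  ring

/-- Convexity of the smoothed distance, quantitatively. -/
theorem le_softNorm_virial {R : ℝ} (hR : 0 < R) (a u d : Space) :
    ‖u‖ ^ 2 * (R / (softNorm R d * (R + softNorm R d))) - ‖a‖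
      ≤ (inner ℝ a d + inner ℝ u u) / (R + softNorm R d)
        - inner ℝ u d * inner ℝ d u / (softNorm R d * (R + softNorm R d) ^ 2) := by
  have hs := softNorm_pos hR d
  have hsq := softNorm_sq R d
  have hds := norm_le_softNorm R d
  set s := softNorm R d
  have h1 : -‖a‖ ≤ inner ℝ a d / (R + s) := by
    rw [le_div_iff₀ (by positivity)]
    have := neg_le_of_abs_le (abs_real_inner_le_norm a d)
    nlinarith [norm_nonneg a]
  have hcs : inner ℝ u d * inner ℝ d u ≤ ‖u‖ ^ 2 * (s ^ 2 - R ^ 2) := by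
    have : s ^ 2 - R ^ 2 = ‖d‖ ^ 2 := by linarith
    rw [this, real_inner_comm d u, ← mul_pow, ← sq]
    have h3 := abs_real_inner_le_norm d u
    rw [mul_comm] at h3
    exact sq_le_sq' (neg_le_of_abs_le h3) (le_of_abs_le h3)
  have h2 : inner ℝ u d * inner ℝ d u / (s * (R + s) ^ 2)
      ≤ ‖u‖ ^ 2 * (s ^ 2 - R ^ 2) / (s * (R + s) ^ 2) := by gcongr
  -- As `(s² - R²)/(s(R + s)) = (s - R)/s`, a positive remainder `R/s` survives Cauchy–Schwarz.
  -- Dividing by `R + s` instead of `s` makes it decay like `s^(-2)`, as the Coulomb force does, and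
  -- not like `s^(-3)`.
  have e : inner ℝ u u / (R + s) - ‖u‖ ^ 2 * (s ^ 2 - R ^ 2) / (s * (R + s) ^ 2)
      = ‖u‖ ^ 2 * (R / (s * (R + s))) := by
    rw [real_inner_self_eq_norm_sq]
    field_simp
    ring
  rw [add_div]
  linarith

/-- Convexity of the distance. -/
theorem norm_virial_nonneg (u d : Space) :
    0 ≤ inner ℝ u u / ‖d‖ - inner ℝ u d * inner ℝ d u / ‖d‖ ^ 3 := by
  rcases eq_or_ne d 0 with rfl | hd
  · simp
  have hpos : 0 < ‖d‖ := norm_pos_iff.2 hd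
  have e : inner ℝ u u / ‖d‖ - inner ℝ u d * inner ℝ d u / ‖d‖ ^ 3
      = ((‖u‖ * ‖d‖) ^ 2 - inner ℝ u d ^ 2) / ‖d‖ ^ 3 := by
    rw [real_inner_self_eq_norm_sq, real_inner_comm u d]
    field_simp
  rw [e]
  refine div_nonneg (sub_nonneg.2 ?_) (by positivity)
  exact sq_le_sq' (neg_le_of_abs_le (abs_real_inner_le_norm u d)) (real_inner_le_norm u d)

/-- Only the part `w` of `u` orthogonal to `d` contributes, giving `(|w|² + ⟨η, w⟩)/|d|`; completing
the square leaves `-|η|²/4` at worst. Here `u + η` is the absolute velocity, `u` the velocity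
relative to the charge. -/
theorem neg_le_norm_virial (u η d : Space) (hd : d ≠ 0) :
    -(‖η‖ ^ 2 / 4 * ‖d‖⁻¹) ≤ inner ℝ (u + η) u / ‖d‖
      - inner ℝ (u + η) d * inner ℝ d u / ‖d‖ ^ 3 := by
  have hpos : 0 < ‖d‖ := norm_pos_iff.2 hd
  set w : Space := u - (inner ℝ d u / ‖d‖ ^ 2) • d with hw
  have e : inner ℝ (u + η) u / ‖d‖ - inner ℝ (u + η) d * inner ℝ d u / ‖d‖ ^ 3
      = (‖w + (1 / 2 : ℝ) • η‖ ^ 2 - ‖η‖ ^ 2 / 4) * ‖d‖⁻¹ := by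
    have h1 : ‖w + (1 / 2 : ℝ) • η‖ ^ 2 - ‖η‖ ^ 2 / 4 = inner ℝ w w + inner ℝ η w := by
      rw [norm_add_sq_real, norm_smul, real_inner_smul_right, real_inner_comm w η,
        real_inner_self_eq_norm_sq, mul_pow]
      norm_num
      ring
    have h2 : inner ℝ w w = inner ℝ u u - inner ℝ d u ^ 2 / ‖d‖ ^ 2 := by
      rw [hw, inner_sub_left, inner_sub_right, inner_sub_right, real_inner_smul_left,
        real_inner_smul_right, real_inner_smul_left, real_inner_smul_right,
        real_inner_self_eq_norm_sq d, real_inner_comm u d]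
      field_simp
      ring
    rw [h1, h2, hw, inner_sub_right, real_inner_smul_right, inner_add_left, inner_add_left,
      real_inner_comm u d]
    field_simp
    ring
  rw [e]
  have : 0 ≤ ‖w + (1 / 2 : ℝ) • η‖ ^ 2 * ‖d‖⁻¹ := by positivity
  linarith

theorem inner_coulomb_self (d : Space) : inner ℝ (coulomb d) d / ‖d‖ = (‖d‖ ^ 2)⁻¹ := by
  rcases eq_or_ne d 0 with rfl | hd
  · simp
  have hpos : 0 < ‖d‖ := norm_pos_iff.2 hd
  rw [coulomb, real_inner_smul_left, real_inner_self_eq_norm_sq]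
  field_simp

/-- Monotonicity of the gradient `x / |x|` of the norm. -/
theorem inner_coulomb_sub_unit_nonneg (x y : Space) :
    0 ≤ inner ℝ (coulomb (x - y)) x / ‖x‖ + inner ℝ (coulomb (y - x)) y / ‖y‖ := by
  have e : inner ℝ (coulomb (x - y)) x / ‖x‖ + inner ℝ (coulomb (y - x)) y / ‖y‖
      = (‖x - y‖ ^ 3)⁻¹ * (inner ℝ (x - y) x / ‖x‖ - inner ℝ (x - y) y / ‖y‖) := by
    rw [← neg_sub x y, coulomb_neg, coulomb, inner_neg_left, real_inner_smul_left,
      real_inner_smul_left]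
    ring
  rw [e]
  refine mul_nonneg (by positivity) ?_
  rw [inner_sub_left, inner_sub_left, real_inner_self_eq_norm_sq, real_inner_self_eq_norm_sq]
  have h1 := real_inner_le_norm y x
  have h2 := real_inner_le_norm x y
  rcases eq_or_ne x 0 with rfl | hx
  · rcases eq_or_ne y 0 with rfl | hy
    · simp
    · simp only [norm_zero, inner_zero_left, inner_zero_right]
      have : 0 < ‖y‖ := norm_pos_iff.2 hy
      simp only [ne_eq, OfNat.ofNat_ne_zero, not_false_eq_true, zero_pow, sub_zero, div_zero,
        zero_sub, neg_div, neg_neg]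
      positivity
  · have hx' : 0 < ‖x‖ := norm_pos_iff.2 hx
    rcases eq_or_ne y 0 with rfl | hy
    · simp only [norm_zero, inner_zero_left, inner_zero_right]
      simp only [sub_zero, div_zero]
      positivity
    · have hy' : 0 < ‖y‖ := norm_pos_iff.2 hy
      have h3 : (‖x‖ ^ 2 - inner ℝ y x) / ‖x‖ ≥ ‖x‖ - ‖y‖ := by
        rw [ge_iff_le, le_div_iff₀ hx']; nlinarith
      have h4 : (inner ℝ x y - ‖y‖ ^ 2) / ‖y‖ ≤ ‖x‖ - ‖y‖ := by
        rw [div_le_iff₀ hy']; nlinarith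
      linarith

end Curves

end PlasmaCharge
end

noncomputable section

namespace PlasmaCharge

/-! ### Integrating along trajectories -/

/-- The fundamental theorem of calculus on each path followed by Fubini; a bounded measurable
derivative suffices and no derivative of the average is taken. -/
theorem integral_integral_eq_sub {Ω : Type*} [MeasurableSpace Ω] {P : Measure Ω}
    [IsFiniteMeasure P] {g k : ℝ → Ω → ℝ} {a b A : ℝ} (hab : a ≤ b)
    (hd : ∀ᵐ ω ∂P, ∀ t ∈ Icc a b, HasDerivWithinAt (fun t => g t ω) (k t ω) (Icc a b) t)
    (hA : ∀ᵐ ω ∂P, ∀ t ∈ Icc a b, ‖k t ω‖ ≤ A)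
    (hk : AEStronglyMeasurable (Function.uncurry k) ((volume.restrict (Ioc a b)).prod P))
    (hga : Integrable (g a) P) (hgb : Integrable (g b) P) :
    IntervalIntegrable (fun t => ∫ ω, k t ω ∂P) volume a b ∧
      ∫ t in a..b, ∫ ω, k t ω ∂P = (∫ ω, g b ω ∂P) - ∫ ω, g a ω ∂P := by
  have hintg : Integrable (Function.uncurry k) ((volume.restrict (Ioc a b)).prod P) := by
    refine Integrable.of_bound (C := A) hk ?_
    have h1 : ∀ᵐ p ∂((volume.restrict (Ioc a b)).prod P), p.1 ∈ Ioc a b :=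
      Measure.quasiMeasurePreserving_fst.ae (ae_restrict_mem measurableSet_Ioc)
    have h2 := (Measure.quasiMeasurePreserving_snd (μ := volume.restrict (Ioc a b)) (ν := P)).ae hA
    filter_upwards [h1, h2] with p hp1 hp2
    exact hp2 p.1 (Ioc_subset_Icc_self hp1)
  refine ⟨?_, ?_⟩
  · rw [intervalIntegrable_iff_integrableOn_Ioc_of_le hab]
    exact hintg.integral_prod_left
  · rw [intervalIntegral.integral_of_le hab, integral_integral_swap hintg, ← integral_sub hgb hga]
    refine integral_congr_ae ?_
    filter_upwards [hd, hA] with ω h1 h2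
    rw [← intervalIntegral.integral_of_le hab]
    exact (integral_eq_sub_of_bounded_deriv_of_le hab h1 h2).2

/-- Exchanging the two variables does not change the double integral, so twice its value is the
integral of the symmetrised function. -/
theorem integral_integral_nonneg_of_add_swap {Ω : Type*} [MeasurableSpace Ω] {P : Measure Ω}
    [IsFiniteMeasure P] {F : Ω → Ω → ℝ} (hF : Integrable (Function.uncurry F) (P.prod P))
    (h : ∀ z z', 0 ≤ F z z' + F z' z) : 0 ≤ ∫ z, ∫ z', F z z' ∂P ∂P := by
  have hF' : Integrable (fun p : Ω × Ω => F p.1 p.2) (P.prod P) := hF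
  have hswap : Integrable (fun p : Ω × Ω => F p.2 p.1) (P.prod P) := hF.swap
  have e1 : ∫ z, ∫ z', F z z' ∂P ∂P = ∫ p, F p.1 p.2 ∂(P.prod P) := (integral_prod _ hF).symm
  have e2 : ∫ z, ∫ z', F z z' ∂P ∂P = ∫ p, F p.2 p.1 ∂(P.prod P) := by
    rw [integral_prod _ hswap]
    exact integral_integral_swap hF
  have h3 : 0 ≤ ∫ p, (F p.1 p.2 + F p.2 p.1) ∂(P.prod P) := integral_nonneg fun p => h _ _
  rw [integral_add hF' hswap, ← e1, ← e2] at h3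
  linarith

/-! ### Integrability of the Lagrangian quantities and the energy balance with the charge -/

namespace IsLagrangian

variable {T δ D B M : ℝ} {μ : Measure Phase} {ξ η : ℝ → Space} {X V : ℝ → Phase → Space}

theorem measurable_X_apply (h : IsLagrangian T δ D B M μ ξ η X V) (t : ℝ) : Measurable (X t) :=
  h.measurable_X.comp measurable_prodMk_left

theorem measurable_V_apply (h : IsLagrangian T δ D B M μ ξ η X V) (t : ℝ) : Measurable (V t) :=
  h.measurable_V.comp measurable_prodMk_left

theorem map_univ_le (h : IsLagrangian T δ D B M μ ξ η X V) (t : ℝ) :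
    μ.map (X t) univ ≤ ENNReal.ofReal 1 := by
  have := h.prob
  rw [Measure.map_apply (h.measurable_X_apply t) MeasurableSet.univ]
  simp

theorem lintegral_inv_sq_le (h : IsLagrangian T δ D B M μ ξ η X V) {t : ℝ} (ht : t ∈ Icc 0 T)
    (x : Space) :
    ∫⁻ z, ENNReal.ofReal ((‖x - X t z‖ ^ 2)⁻¹) ∂μ ≤ ENNReal.ofReal (4 * Real.pi * D + 1) := by
  have := lintegral_inv_sq_le_of_le h.D_nonneg zero_le_one (h.density_le t ht) (h.map_univ_le t) x
  rwa [lintegral_map (by fun_prop) (h.measurable_X_apply t)] at this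

theorem lintegral_inv_sq_lt_le (h : IsLagrangian T δ D B M μ ξ η X V) {t : ℝ} (ht : t ∈ Icc 0 T)
    {l : ℝ} (hl : 0 ≤ l) (x : Space) :
    ∫⁻ z, ENNReal.ofReal ((Iio l).indicator (fun r => (r ^ 2)⁻¹) ‖x - X t z‖) ∂μ
      ≤ ENNReal.ofReal (D * (4 * Real.pi * l)) := by
  have := lintegral_inv_sq_lt_le_of_le h.D_nonneg (h.density_le t ht) hl x
  rwa [lintegral_map _ (h.measurable_X_apply t)] at this
  exact (Measurable.comp (Measurable.indicator (by fun_prop) measurableSet_Iio)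
    (by fun_prop)).ennreal_ofReal

theorem integrable_inv_sq (h : IsLagrangian T δ D B M μ ξ η X V) {t : ℝ} (ht : t ∈ Icc 0 T)
    (x : Space) : Integrable (fun z => (‖x - X t z‖ ^ 2)⁻¹) μ := by
  have hm := h.measurable_X_apply t
  refine ⟨Measurable.aestronglyMeasurable (by fun_prop), ?_⟩
  rw [hasFiniteIntegral_iff_ofReal (ae_of_all _ fun z => by positivity)]
  exact (h.lintegral_inv_sq_le ht x).trans_lt ENNReal.ofReal_lt_top

theorem integral_inv_sq_le (h : IsLagrangian T δ D B M μ ξ η X V) {t : ℝ} (ht : t ∈ Icc 0 T)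
    (x : Space) : ∫ z, (‖x - X t z‖ ^ 2)⁻¹ ∂μ ≤ 4 * Real.pi * D + 1 := by
  have hD := h.D_nonneg
  rw [integral_eq_lintegral_of_nonneg_ae (ae_of_all _ fun z => by positivity)
    (h.integrable_inv_sq ht x).1]
  exact ENNReal.toReal_le_of_le_ofReal (by positivity) (h.lintegral_inv_sq_le ht x)

theorem integrable_coulomb (h : IsLagrangian T δ D B M μ ξ η X V) {t : ℝ} (ht : t ∈ Icc 0 T)
    (x : Space) : Integrable (fun z => coulomb (x - X t z)) μ := by
  have hm := h.measurable_X_apply t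
  refine (h.integrable_inv_sq ht x).mono' (Measurable.aestronglyMeasurable (by fun_prop))
    (ae_of_all _ fun z => (norm_coulomb _).le)

theorem norm_plasmaField_le_integral (x : Space) (t : ℝ) :
    ‖plasmaField μ X t x‖ ≤ ∫ z, (‖x - X t z‖ ^ 2)⁻¹ ∂μ := by
  refine (norm_integral_le_integral_norm _).trans (le_of_eq ?_)
  simp_rw [norm_coulomb]

theorem norm_plasmaField_le (h : IsLagrangian T δ D B M μ ξ η X V) {t : ℝ} (ht : t ∈ Icc 0 T)
    (x : Space) : ‖plasmaField μ X t x‖ ≤ 4 * Real.pi * D + 1 :=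
  (norm_plasmaField_le_integral x t).trans (h.integral_inv_sq_le ht x)

theorem measurable_plasmaField (h : IsLagrangian T δ D B M μ ξ η X V) :
    Measurable (Function.uncurry (plasmaField μ X)) := by
  have := h.prob
  have hX := h.measurable_X
  have : StronglyMeasurable (fun p : ℝ × Space => ∫ z, coulomb (p.2 - X p.1 z) ∂μ) := by
    refine StronglyMeasurable.integral_prod_right
      (f := fun (p : ℝ × Space) (z : Phase) => coulomb (p.2 - X p.1 z)) ?_
    refine Measurable.stronglyMeasurable ?_
    have h1 : Measurable fun q : (ℝ × Space) × Phase => X q.1.1 q.2 :=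
      hX.comp (by fun_prop : Measurable fun q : (ℝ × Space) × Phase => (q.1.1, q.2))
    exact measurable_coulomb.comp (measurable_fst.snd.sub h1)
  exact this.measurable

theorem measurable_plasmaField_X (h : IsLagrangian T δ D B M μ ξ η X V) :
    Measurable (fun p : ℝ × Phase => plasmaField μ X p.1 (X p.1 p.2)) := by
  have h1 : Measurable fun p : ℝ × Phase => (p.1, X p.1 p.2) :=
    Measurable.prodMk measurable_fst h.measurable_X
  have e : (fun p : ℝ × Phase => plasmaField μ X p.1 (X p.1 p.2))
      = Function.uncurry (plasmaField μ X) ∘ fun p : ℝ × Phase => (p.1, X p.1 p.2) := by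
    ext1 p; rfl
  rw [e]
  exact h.measurable_plasmaField.comp h1

theorem continuousOn_ξ (h : IsLagrangian T δ D B M μ ξ η X V) : ContinuousOn ξ (Icc 0 T) :=
  fun t ht => (h.hasDeriv_ξ t ht).continuousWithinAt

theorem continuousOn_η (h : IsLagrangian T δ D B M μ ξ η X V) : ContinuousOn η (Icc 0 T) :=
  fun t ht => (h.hasDeriv_η t ht).continuousWithinAt

theorem exists_norm_η_le (h : IsLagrangian T δ D B M μ ξ η X V) :
    ∃ A, 0 ≤ A ∧ ∀ t ∈ Icc 0 T, ‖η t‖ ≤ A := by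
  obtain ⟨A, hA⟩ := isCompact_Icc.exists_bound_of_continuousOn h.continuousOn_η
  exact ⟨|A|, abs_nonneg _, fun t ht => (hA t ht).trans (le_abs_self A)⟩

theorem aemeasurable_fst {β : Type*} [MeasurableSpace β] {P : Measure β} [SFinite P]
    {g : ℝ → Space} (hg : ContinuousOn g (Icc 0 T)) {a b : ℝ} (ha : 0 ≤ a) (hb : b ≤ T) :
    AEMeasurable (fun p : ℝ × β => g p.1) ((volume.restrict (Ioc a b)).prod P) := by
  have hsub : Ioc a b ⊆ Icc 0 T := fun t ht => ⟨ha.trans ht.1.le, ht.2.trans hb⟩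
  have h1 : AEMeasurable g (volume.restrict (Ioc a b)) :=
    ((hg.mono hsub).aemeasurable measurableSet_Ioc)
  exact h1.comp_quasiMeasurePreserving Measure.quasiMeasurePreserving_fst

theorem integrable_inv_norm (h : IsLagrangian T δ D B M μ ξ η X V) {t : ℝ} (ht : t ∈ Icc 0 T) :
    Integrable (fun z => ‖X t z - ξ t‖⁻¹) μ := by
  have := h.prob
  have hm := h.measurable_X_apply t
  refine Integrable.of_bound (C := δ⁻¹) (Measurable.aestronglyMeasurable (by fun_prop)) ?_
  filter_upwards [h.trajectory] with z hz
  rw [Real.norm_of_nonneg (by positivity)]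
  exact inv_anti₀ h.δ_pos (hz.lower t ht)

theorem integrable_sq_norm (h : IsLagrangian T δ D B M μ ξ η X V) {t : ℝ} (ht : t ∈ Icc 0 T) :
    Integrable (fun z => ‖V t z‖ ^ 2) μ := by
  have := h.prob
  have hm := h.measurable_V_apply t
  refine Integrable.of_bound (C := B ^ 2) (Measurable.aestronglyMeasurable (by fun_prop)) ?_
  filter_upwards [h.speed] with z hz
  rw [Real.norm_of_nonneg (by positivity)]
  exact pow_le_pow_left₀ (norm_nonneg _) (hz t ht) 2

theorem B_nonneg (h : IsLagrangian T δ D B M μ ξ η X V) (hT : 0 ≤ T) : 0 ≤ B := by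
  have := h.prob
  obtain ⟨z, hz⟩ := h.speed.exists
  exact (norm_nonneg _).trans (hz 0 ⟨le_rfl, hT⟩)

theorem norm_coulomb_le {x : Space} (hδ : 0 < δ) (hx : δ ≤ ‖x‖) : ‖coulomb x‖ ≤ (δ ^ 2)⁻¹ := by
  rw [norm_coulomb]; gcongr

/-- The energy of the plasma particles and of the charge, without the interaction energy of the
plasma. -/
def outerEnergy (μ : Measure Phase) (ξ η : ℝ → Space) (X V : ℝ → Phase → Space) (t : ℝ) : ℝ :=
  (∫ z, (1 / 2 * ‖V t z‖ ^ 2 + ‖X t z - ξ t‖⁻¹) ∂μ) + 1 / 2 * ‖η t‖ ^ 2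

/-- Along a particle the work of the repulsion cancels against the change of `1/|X-ξ|` except for
the part due to the motion of the charge, and that part cancels against the kinetic energy of the
charge. Only the work of the plasma on itself is left. -/
theorem outerEnergy_sub (h : IsLagrangian T δ D B M μ ξ η X V) {t : ℝ} (ht : t ∈ Icc 0 T) :
    IntervalIntegrable (fun s => ∫ z, inner ℝ (V s z) (plasmaField μ X s (X s z)) ∂μ) volume 0 t ∧
      ∫ s in 0..t, ∫ z, inner ℝ (V s z) (plasmaField μ X s (X s z)) ∂μ
        = outerEnergy μ ξ η X V t - outerEnergy μ ξ η X V 0 := by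
  have := h.prob
  have hδ := h.δ_pos
  have hT : 0 ≤ T := ht.1.trans ht.2
  have hB0 := h.B_nonneg hT
  have h0 : (0 : ℝ) ∈ Icc 0 T := ⟨le_rfl, hT⟩
  have hsub : Icc 0 t ⊆ Icc 0 T := Icc_subset_Icc_right ht.2
  obtain ⟨A, hA0, hA⟩ := h.exists_norm_η_le
  have hD := h.D_nonneg
  set C := 4 * Real.pi * D + 1 with hC
  have hC0 : 0 ≤ C := by positivity
  have hX := h.measurable_X
  have hV := h.measurable_V
  have hEX := h.measurable_plasmaField_X
  have hgi : ∀ s ∈ Icc 0 T, Integrable (fun z => 1 / 2 * ‖V s z‖ ^ 2 + ‖X s z - ξ s‖⁻¹) μ :=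
    fun s hs => ((h.integrable_sq_norm hs).const_mul _).add (h.integrable_inv_norm hs)
  obtain ⟨hi1, he1⟩ := integral_integral_eq_sub (P := μ) (a := 0) (b := t)
    (g := fun s z => 1 / 2 * ‖V s z‖ ^ 2 + ‖X s z - ξ s‖⁻¹)
    (k := fun s z => inner ℝ (V s z) (plasmaField μ X s (X s z))
      + inner ℝ (coulomb (X s z - ξ s)) (η s)) (A := B * C + (δ ^ 2)⁻¹ * A) ht.1 (by
      filter_upwards [h.trajectory] with z hz s hs
      have hs' := hsub hs
      have hne : X s z - ξ s ≠ 0 := by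
        have := hz.lower s hs'
        exact norm_pos_iff.1 (hδ.trans_le this)
      have d1 := ((hz.hasDeriv_v s hs').mono hsub).norm_sq.const_mul (1 / 2 : ℝ)
      have d2 := hasDerivWithinAt_inv_norm
        (((hz.hasDeriv_x s hs').mono hsub).sub ((h.hasDeriv_ξ s hs').mono hsub)) hne
      refine HasDerivWithinAt.congr_deriv (d1.add d2) ?_
      simp only [inner_add_right, inner_sub_right, Pi.sub_apply]
      rw [real_inner_comm (V s z) (coulomb (X s z - ξ s))]
      ring) (by
      filter_upwards [h.trajectory, h.speed] with z hz hz' s hs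
      have hs' := hsub hs
      refine (norm_add_le _ _).trans (add_le_add ?_ ?_)
      · refine (norm_inner_le_norm _ _).trans ?_
        exact mul_le_mul (hz' s hs') (h.norm_plasmaField_le hs' _) (norm_nonneg _) hB0
      · refine (norm_inner_le_norm _ _).trans ?_
        exact mul_le_mul (norm_coulomb_le hδ (hz.lower s hs')) (hA s hs') (norm_nonneg _)
          (by positivity)) (by
      have hξ := aemeasurable_fst (P := μ) h.continuousOn_ξ le_rfl ht.2
      have hη := aemeasurable_fst (P := μ) h.continuousOn_η le_rfl ht.2
      refine AEMeasurable.aestronglyMeasurable ?_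
      refine (hV.aemeasurable.inner hEX.aemeasurable).add (AEMeasurable.inner ?_ hη)
      exact measurable_coulomb.comp_aemeasurable (hX.aemeasurable.sub hξ))
    (hgi 0 h0) (hgi t ht)
  obtain ⟨hi2, he2⟩ := integral_eq_sub_of_bounded_deriv_of_le
    (f := fun s => 1 / 2 * ‖η s‖ ^ 2) (f' := fun s => inner ℝ (η s) (plasmaField μ X s (ξ s)))
    (A := A * C) ht.1 (fun s hs => by
      have hs' := hsub hs
      refine HasDerivWithinAt.congr_deriv
        (((h.hasDeriv_η s hs').mono hsub).norm_sq.const_mul (1 / 2 : ℝ)) ?_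
      ring) (fun s hs => by
      have hs' := hsub hs
      refine (norm_inner_le_norm _ _).trans ?_
      exact mul_le_mul (hA s hs') (h.norm_plasmaField_le hs' _) (norm_nonneg _) hA0)
  -- Action and reaction: the forces exerted by the charge on the plasma sum to minus the plasma
  -- field at the charge.
  have hsum : ∀ s ∈ Icc 0 t, (∫ z, (inner ℝ (V s z) (plasmaField μ X s (X s z))
        + inner ℝ (coulomb (X s z - ξ s)) (η s)) ∂μ) + inner ℝ (η s) (plasmaField μ X s (ξ s))
      = ∫ z, inner ℝ (V s z) (plasmaField μ X s (X s z)) ∂μ := by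
    intro s hs
    have hs' := hsub hs
    have i1 : Integrable (fun z => inner ℝ (V s z) (plasmaField μ X s (X s z))) μ := by
      refine Integrable.of_bound (C := B * C) ?_ ?_
      · exact ((h.measurable_V_apply s).inner
          (hEX.comp measurable_prodMk_left)).aestronglyMeasurable
      · filter_upwards [h.speed] with z hz'
        refine (norm_inner_le_norm _ _).trans ?_
        exact mul_le_mul (hz' s hs') (h.norm_plasmaField_le hs' _) (norm_nonneg _) hB0
    have e : ∀ z, coulomb (X s z - ξ s) = -coulomb (ξ s - X s z) := by
      intro z; rw [← coulomb_neg, neg_sub]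
    have i2 : Integrable (fun z => coulomb (X s z - ξ s)) μ := by
      simp_rw [e]; exact (h.integrable_coulomb hs' (ξ s)).neg
    have i3 : ∫ z, inner ℝ (coulomb (X s z - ξ s)) (η s) ∂μ
        = - inner ℝ (η s) (plasmaField μ X s (ξ s)) := by
      simp_rw [real_inner_comm (η s)]
      rw [integral_inner i2 (η s)]
      simp_rw [e]
      rw [integral_neg, inner_neg_right]
      rfl
    rw [integral_add i1 (i2.inner_const (η s)), i3]
    ring
  have hcongr : ∀ s ∈ uIoc 0 t, (∫ z, (inner ℝ (V s z) (plasmaField μ X s (X s z))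
        + inner ℝ (coulomb (X s z - ξ s)) (η s)) ∂μ) + inner ℝ (η s) (plasmaField μ X s (ξ s))
      = ∫ z, inner ℝ (V s z) (plasmaField μ X s (X s z)) ∂μ := by
    intro s hs
    rw [uIoc_of_le ht.1] at hs
    exact hsum s (Ioc_subset_Icc_self hs)
  refine ⟨(hi1.add hi2).congr hcongr, ?_⟩
  rw [← intervalIntegral.integral_congr_ae (ae_of_all _ hcongr),
    intervalIntegral.integral_add hi1 hi2, he1, he2, outerEnergy, outerEnergy]
  ring

end IsLagrangian

end PlasmaCharge
end

noncomputable section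

namespace PlasmaCharge

namespace IsLagrangian

variable {T δ D B M : ℝ} {μ : Measure Phase} {ξ η : ℝ → Space} {X V : ℝ → Phase → Space}

/-! ### Conservation of energy -/

theorem integrable_inner_softCoulomb (h : IsLagrangian T δ D B M μ ξ η X V) {ε : ℝ} (hε : 0 < ε)
    {t : ℝ} (ht : t ∈ Icc 0 T) :
    Integrable (Function.uncurry fun z z' => inner ℝ (V t z) (softCoulomb ε (X t z - X t z')))
      (μ.prod μ) := by
  have := h.prob
  have hB0 := h.B_nonneg (ht.1.trans ht.2)
  have hX := h.measurable_X_apply t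
  have hV := h.measurable_V_apply t
  refine Integrable.of_bound (C := B * (ε ^ 2)⁻¹) ?_ ?_
  · refine Measurable.aestronglyMeasurable ?_
    exact (hV.comp measurable_fst).inner ((continuous_softCoulomb hε).measurable.comp
      ((hX.comp measurable_fst).sub (hX.comp measurable_snd)))
  · filter_upwards [(Measure.quasiMeasurePreserving_fst (μ := μ) (ν := μ)).ae h.speed] with p hp
    refine (norm_inner_le_norm _ _).trans ?_
    exact mul_le_mul (hp t ht) (norm_softCoulomb_le hε _) (norm_nonneg _) hB0

/-- The smoothed interaction energy of the plasma. -/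
def softEnergy (μ : Measure Phase) (X : ℝ → Phase → Space) (ε t : ℝ) : ℝ :=
  ∫ p : Phase × Phase, (softNorm ε (X t p.1 - X t p.2))⁻¹ ∂(μ.prod μ)

/-- The smoothed pair energy is differentiable even through collisions of plasma particles. The
factor `2` comes from the oddness of the kernel under exchange of the pair. -/
theorem softEnergy_sub (h : IsLagrangian T δ D B M μ ξ η X V) {ε : ℝ} (hε : 0 < ε)
    {t : ℝ} (ht : t ∈ Icc 0 T) :
    IntervalIntegrable
      (fun s => ∫ z, ∫ z', inner ℝ (V s z) (softCoulomb ε (X s z - X s z')) ∂μ ∂μ) volume 0 t ∧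
      2 * ∫ s in 0..t, ∫ z, ∫ z', inner ℝ (V s z) (softCoulomb ε (X s z - X s z')) ∂μ ∂μ
        = softEnergy μ X ε 0 - softEnergy μ X ε t := by
  have := h.prob
  have hT : 0 ≤ T := ht.1.trans ht.2
  have hB0 := h.B_nonneg hT
  have h0 : (0 : ℝ) ∈ Icc 0 T := ⟨le_rfl, hT⟩
  have hsub : Icc 0 t ⊆ Icc 0 T := Icc_subset_Icc_right ht.2
  have hX := h.measurable_X
  have hV := h.measurable_V
  have hX1 : Measurable fun q : ℝ × (Phase × Phase) => X q.1 q.2.1 :=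
    hX.comp (by fun_prop : Measurable fun q : ℝ × (Phase × Phase) => (q.1, q.2.1))
  have hX2 : Measurable fun q : ℝ × (Phase × Phase) => X q.1 q.2.2 :=
    hX.comp (by fun_prop : Measurable fun q : ℝ × (Phase × Phase) => (q.1, q.2.2))
  have hV1 : Measurable fun q : ℝ × (Phase × Phase) => V q.1 q.2.1 :=
    hV.comp (by fun_prop : Measurable fun q : ℝ × (Phase × Phase) => (q.1, q.2.1))
  have hV2 : Measurable fun q : ℝ × (Phase × Phase) => V q.1 q.2.2 :=
    hV.comp (by fun_prop : Measurable fun q : ℝ × (Phase × Phase) => (q.1, q.2.2))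
  have hgi : ∀ s, Integrable (fun p : Phase × Phase => (softNorm ε (X s p.1 - X s p.2))⁻¹)
      (μ.prod μ) := by
    intro s
    have hm := h.measurable_X_apply s
    refine Integrable.of_bound (C := ε⁻¹) ?_ (ae_of_all _ fun p => ?_)
    · exact ((continuous_softNorm ε).measurable.comp
        ((hm.comp measurable_fst).sub (hm.comp measurable_snd))).inv.aestronglyMeasurable
    · have := softNorm_pos hε (X s p.1 - X s p.2)
      rw [Real.norm_of_nonneg (by positivity)]
      exact inv_anti₀ hε (le_softNorm _)
  have ae1 := (Measure.quasiMeasurePreserving_fst (μ := μ) (ν := μ)).ae h.trajectory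
  have ae2 := (Measure.quasiMeasurePreserving_snd (μ := μ) (ν := μ)).ae h.trajectory
  have ae3 := (Measure.quasiMeasurePreserving_fst (μ := μ) (ν := μ)).ae h.speed
  have ae4 := (Measure.quasiMeasurePreserving_snd (μ := μ) (ν := μ)).ae h.speed
  obtain ⟨hi, he⟩ := integral_integral_eq_sub (P := μ.prod μ) (a := 0) (b := t)
    (g := fun s p => (softNorm ε (X s p.1 - X s p.2))⁻¹)
    (k := fun s p => -inner ℝ (softCoulomb ε (X s p.1 - X s p.2)) (V s p.1 - V s p.2))
    (A := (ε ^ 2)⁻¹ * (B + B)) ht.1 (by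
      filter_upwards [ae1, ae2] with p h1 h2 s hs
      have hs' := hsub hs
      exact hasDerivWithinAt_inv_softNorm hε (((h1.hasDeriv_x s hs').mono hsub).sub
        ((h2.hasDeriv_x s hs').mono hsub))) (by
      filter_upwards [ae3, ae4] with p h1 h2 s hs
      have hs' := hsub hs
      rw [norm_neg]
      refine (norm_inner_le_norm _ _).trans ?_
      exact mul_le_mul (norm_softCoulomb_le hε _) ((norm_sub_le _ _).trans
        (add_le_add (h1 s hs') (h2 s hs'))) (norm_nonneg _) (by positivity)) (by
      refine Measurable.aestronglyMeasurable ?_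
      exact (Measurable.inner ((continuous_softCoulomb hε).measurable.comp (hX1.sub hX2))
        (hV1.sub hV2)).neg) (hgi 0) (hgi t)
  have hW : ∀ s ∈ Icc 0 t,
      ∫ p : Phase × Phase, -inner ℝ (softCoulomb ε (X s p.1 - X s p.2)) (V s p.1 - V s p.2)
        ∂(μ.prod μ)
      = -(2 * ∫ z, ∫ z', inner ℝ (V s z) (softCoulomb ε (X s z - X s z')) ∂μ ∂μ) := by
    intro s hs
    have hF := h.integrable_inner_softCoulomb hε (hsub hs)
    have hF' : Integrable
        (fun p : Phase × Phase => inner ℝ (V s p.1) (softCoulomb ε (X s p.1 - X s p.2)))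
        (μ.prod μ) := hF
    have hs' : Integrable
        (fun p : Phase × Phase => inner ℝ (V s p.2) (softCoulomb ε (X s p.2 - X s p.1)))
        (μ.prod μ) := hF.swap
    have e1 := (integral_prod _ hF).symm
    have e2 : ∫ z, ∫ z', inner ℝ (V s z) (softCoulomb ε (X s z - X s z')) ∂μ ∂μ
        = ∫ p : Phase × Phase, inner ℝ (V s p.2) (softCoulomb ε (X s p.2 - X s p.1))
          ∂(μ.prod μ) := by
      rw [integral_prod _ hs']
      exact integral_integral_swap hF
    simp only [Function.uncurry] at e1
    rw [integral_neg, two_mul]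
    congr 1
    nth_rewrite 1 [e1]
    rw [e2, ← integral_add hF' hs']
    refine integral_congr_ae (ae_of_all _ fun p => ?_)
    simp only
    rw [← neg_sub (X s p.1) (X s p.2), softCoulomb_neg, inner_neg_right, inner_sub_right,
      real_inner_comm (V s p.1), real_inner_comm (V s p.2)]
    ring
  have hcongr : ∀ s ∈ uIoc 0 t,
      ∫ p : Phase × Phase, -inner ℝ (softCoulomb ε (X s p.1 - X s p.2)) (V s p.1 - V s p.2)
        ∂(μ.prod μ)
      = -(2 * ∫ z, ∫ z', inner ℝ (V s z) (softCoulomb ε (X s z - X s z')) ∂μ ∂μ) := by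
    intro s hs
    rw [uIoc_of_le ht.1] at hs
    exact hW s (Ioc_subset_Icc_self hs)
  have hi2 := hi.congr hcongr
  refine ⟨?_, ?_⟩
  · refine (hi2.const_mul (-1 / 2)).congr fun s _ => ?_
    ring
  · rw [intervalIntegral.integral_congr_ae (ae_of_all _ hcongr), intervalIntegral.integral_neg,
      intervalIntegral.integral_const_mul] at he
    rw [softEnergy, softEnergy]
    linarith

theorem power_sub_soft_le (h : IsLagrangian T δ D B M μ ξ η X V) {ε l : ℝ} (hε : 0 < ε)
    (hl : 0 < l) {t : ℝ} (ht : t ∈ Icc 0 T) :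
    ∫ z, inner ℝ (V t z) (plasmaField μ X t (X t z)) ∂μ
      ≤ (∫ z, ∫ z', inner ℝ (V t z) (softCoulomb ε (X t z - X t z')) ∂μ ∂μ)
        + B * (D * (4 * Real.pi * l) + 3 * ε ^ 2 * (l ^ 4)⁻¹) := by
  have := h.prob
  have hB0 := h.B_nonneg (ht.1.trans ht.2)
  have hD := h.D_nonneg
  have hXm := h.measurable_X_apply t
  set ω := D * (4 * Real.pi * l) + 3 * ε ^ 2 * (l ^ 4)⁻¹ with hω
  have hω0 : 0 ≤ ω := by positivity
  have hsoft : ∀ x, Integrable (fun z' => softCoulomb ε (x - X t z')) μ := by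
    intro x
    refine Integrable.of_bound (C := (ε ^ 2)⁻¹) ?_ (ae_of_all _ fun z => norm_softCoulomb_le hε _)
    exact ((continuous_softCoulomb hε).measurable.comp
      (measurable_const.sub hXm)).aestronglyMeasurable
  have hbound : ∀ x, ‖plasmaField μ X t x - ∫ z', softCoulomb ε (x - X t z') ∂μ‖ ≤ ω := by
    intro x
    rw [plasmaField, ← integral_sub (h.integrable_coulomb ht x) (hsoft x)]
    refine norm_integral_le_of_lintegral
      (k := fun z => (Iio l).indicator (fun r => (r ^ 2)⁻¹) ‖x - X t z‖ + 3 * ε ^ 2 * (l ^ 4)⁻¹)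
      (fun z => norm_coulomb_sub_softCoulomb_le hε hl _) hω0 ?_
    have hp : ∀ z, 0 ≤ (Iio l).indicator (fun r : ℝ => (r ^ 2)⁻¹) ‖x - X t z‖ :=
      fun z => indicator_nonneg (fun _ _ => by positivity) _
    simp_rw [ENNReal.ofReal_add (hp _) (show 0 ≤ 3 * ε ^ 2 * (l ^ 4)⁻¹ by positivity)]
    rw [lintegral_add_right _ measurable_const, lintegral_const, measure_univ, mul_one, hω,
      ENNReal.ofReal_add (by positivity) (by positivity)]
    gcongr
    exact h.lintegral_inv_sq_lt_le ht hl.le x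
  have hi1 : Integrable (fun z => inner ℝ (V t z) (plasmaField μ X t (X t z))) μ := by
    refine Integrable.of_bound (C := B * (4 * Real.pi * D + 1)) ?_ ?_
    · exact ((h.measurable_V_apply t).inner
        (h.measurable_plasmaField_X.comp measurable_prodMk_left)).aestronglyMeasurable
    · filter_upwards [h.speed] with z hz'
      refine (norm_inner_le_norm _ _).trans ?_
      exact mul_le_mul (hz' t ht) (h.norm_plasmaField_le ht _) (norm_nonneg _) hB0
  have hi2 := (h.integrable_inner_softCoulomb hε ht).integral_prod_left
  simp only [Function.uncurry] at hi2
  have e : ∀ z, ∫ z', inner ℝ (V t z) (softCoulomb ε (X t z - X t z')) ∂μ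
      = inner ℝ (V t z) (∫ z', softCoulomb ε (X t z - X t z') ∂μ) :=
    fun z => integral_inner (hsoft (X t z)) (V t z)
  have hc : ∫ _ : Phase, B * ω ∂μ = B * ω := by simp
  rw [← hc, ← integral_add hi2 (integrable_const _)]
  refine integral_mono_ae hi1 (hi2.add (integrable_const _)) ?_
  filter_upwards [h.speed] with z hz
  rw [e z]
  have h1 : inner ℝ (V t z) (plasmaField μ X t (X t z)
      - ∫ z', softCoulomb ε (X t z - X t z') ∂μ) ≤ B * ω :=
    (real_inner_le_norm _ _).trans
      (mul_le_mul (hz t ht) (hbound _) (norm_nonneg _) hB0)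
  rw [inner_sub_right] at h1
  linarith

theorem ae_ne (h : IsLagrangian T δ D B M μ ξ η X V) {t : ℝ} (ht : t ∈ Icc 0 T) (x : Space) :
    ∀ᵐ z ∂μ, X t z ≠ x := by
  have h1 : μ.map (X t) {x} = 0 := by
    refine le_antisymm (((h.density_le t ht) {x}).trans ?_) zero_le
    simp
  rw [Measure.map_apply (h.measurable_X_apply t) (measurableSet_singleton x)] at h1
  exact measure_eq_zero_iff_ae_notMem.1 h1

theorem inv_le_one_add_inv_sq (r : ℝ) : r⁻¹ ≤ 1 + (r ^ 2)⁻¹ := by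
  rw [← inv_pow]
  nlinarith [sq_nonneg (r⁻¹ - 1), sq_nonneg r⁻¹]

theorem softEnergy_le (h : IsLagrangian T δ D B M μ ξ η X V) {ε : ℝ} (hε : 0 < ε)
    {t : ℝ} (ht : t ∈ Icc 0 T) :
    softEnergy μ X ε t ≤ ∫ z, ∫ z', ‖X t z - X t z'‖⁻¹ ∂μ ∂μ := by
  have := h.prob
  have hD := h.D_nonneg
  have hm := h.measurable_X_apply t
  have hgi : Integrable (fun p : Phase × Phase => (softNorm ε (X t p.1 - X t p.2))⁻¹)
      (μ.prod μ) := by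
    refine Integrable.of_bound (C := ε⁻¹) ?_ (ae_of_all _ fun p => ?_)
    · exact ((continuous_softNorm ε).measurable.comp
        ((hm.comp measurable_fst).sub (hm.comp measurable_snd))).inv.aestronglyMeasurable
    · have := softNorm_pos hε (X t p.1 - X t p.2)
      rw [Real.norm_of_nonneg (by positivity)]
      exact inv_anti₀ hε (le_softNorm _)
  have hinv : ∀ x, Integrable (fun z' => ‖x - X t z'‖⁻¹) μ := by
    intro x
    refine ((integrable_const 1).add (h.integrable_inv_sq ht x)).mono'
      (Measurable.aestronglyMeasurable (by fun_prop)) (ae_of_all _ fun z => ?_)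
    rw [Real.norm_of_nonneg (by positivity)]
    exact inv_le_one_add_inv_sq _
  have hinvle : ∀ x, ∫ z', ‖x - X t z'‖⁻¹ ∂μ ≤ 1 + (4 * Real.pi * D + 1) := by
    intro x
    calc ∫ z', ‖x - X t z'‖⁻¹ ∂μ ≤ ∫ z', (1 + (‖x - X t z'‖ ^ 2)⁻¹) ∂μ :=
          integral_mono (hinv x) ((integrable_const 1).add (h.integrable_inv_sq ht x))
            fun z => inv_le_one_add_inv_sq _
      _ = 1 + ∫ z', (‖x - X t z'‖ ^ 2)⁻¹ ∂μ := by
          rw [integral_add (integrable_const 1) (h.integrable_inv_sq ht x)]; simp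
      _ ≤ _ := by gcongr; exact h.integral_inv_sq_le ht x
  have hout : Integrable (fun z => ∫ z', ‖X t z - X t z'‖⁻¹ ∂μ) μ := by
    refine Integrable.of_bound (C := 1 + (4 * Real.pi * D + 1)) ?_ (ae_of_all _ fun z => ?_)
    · refine StronglyMeasurable.aestronglyMeasurable ?_
      refine StronglyMeasurable.integral_prod_right
        (f := fun (z z' : Phase) => ‖X t z - X t z'‖⁻¹) ?_
      exact Measurable.stronglyMeasurable
        (((hm.comp measurable_fst).sub (hm.comp measurable_snd)).norm.inv)
    · rw [Real.norm_of_nonneg (integral_nonneg fun z => by positivity)]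
      exact hinvle _
  rw [softEnergy, integral_prod _ hgi]
  refine integral_mono_ae hgi.integral_prod_left hout ?_
  filter_upwards [hgi.prod_right_ae] with z hz
  refine integral_mono_ae hz (hinv _) ?_
  -- For coincident particles the inverse distance is `0` by convention and the comparison would
  -- fail; bounded density makes such pairs negligible.
  filter_upwards [h.ae_ne ht (X t z)] with z' hz'
  have : 0 < ‖X t z - X t z'‖ := norm_pos_iff.2 (sub_ne_zero.2 hz'.symm)
  exact inv_anti₀ this (norm_le_softNorm _ _)

/-- One inequality suffices: the smoothed interaction energy at the final time is nonnegative and is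
dropped, the one at time `0` lies below the true one, and the error from smoothing the field
vanishes with `l`. -/
theorem outerEnergy_le (h : IsLagrangian T δ D B M μ ξ η X V) {t : ℝ} (ht : t ∈ Icc 0 T) :
    outerEnergy μ ξ η X V t
      ≤ outerEnergy μ ξ η X V 0 + 1 / 2 * ∫ z, ∫ z', ‖X 0 z - X 0 z'‖⁻¹ ∂μ ∂μ := by
  have hT : 0 ≤ T := ht.1.trans ht.2
  have h0 : (0 : ℝ) ∈ Icc 0 T := ⟨le_rfl, hT⟩
  have hB0 := h.B_nonneg hT
  have hsub : Icc 0 t ⊆ Icc 0 T := Icc_subset_Icc_right ht.2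
  obtain ⟨hi1, he1⟩ := h.outerEnergy_sub ht
  have key : ∀ l : ℝ, 0 < l → outerEnergy μ ξ η X V t - outerEnergy μ ξ η X V 0
      ≤ 1 / 2 * (∫ z, ∫ z', ‖X 0 z - X 0 z'‖⁻¹ ∂μ ∂μ)
        + t * (B * (D * (4 * Real.pi * l) + 3 * l ^ 2)) := by
    intro l hl
    -- The smoothing length `l³` turns the far error `3ε²/l⁴` into `3l²`.
    have hε : 0 < l ^ 3 := by positivity
    obtain ⟨hi2, he2⟩ := h.softEnergy_sub hε ht
    have hle : ∫ s in 0..t, ∫ z, inner ℝ (V s z) (plasmaField μ X s (X s z)) ∂μ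
        ≤ ∫ s in 0..t, ((∫ z, ∫ z', inner ℝ (V s z) (softCoulomb (l ^ 3) (X s z - X s z')) ∂μ ∂μ)
          + B * (D * (4 * Real.pi * l) + 3 * (l ^ 3) ^ 2 * (l ^ 4)⁻¹)) :=
      intervalIntegral.integral_mono_on ht.1 hi1 (hi2.add intervalIntegrable_const)
        fun s hs => h.power_sub_soft_le hε hl (hsub hs)
    rw [intervalIntegral.integral_add hi2 intervalIntegrable_const,
      intervalIntegral.integral_const, he1, sub_zero, smul_eq_mul] at hle
    have e3 : 3 * (l ^ 3) ^ 2 * (l ^ 4)⁻¹ = 3 * l ^ 2 := by field_simp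
    rw [e3] at hle
    have h3 := h.softEnergy_le hε h0
    have h4 : 0 ≤ softEnergy μ X (l ^ 3) t :=
      integral_nonneg fun p => inv_nonneg.2 (softNorm_pos hε _).le
    linarith
  have hlim : Filter.Tendsto (fun l : ℝ => 1 / 2 * (∫ z, ∫ z', ‖X 0 z - X 0 z'‖⁻¹ ∂μ ∂μ)
        + t * (B * (D * (4 * Real.pi * l) + 3 * l ^ 2))) (nhdsWithin 0 (Ioi 0))
      (nhds (1 / 2 * (∫ z, ∫ z', ‖X 0 z - X 0 z'‖⁻¹ ∂μ ∂μ)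
        + t * (B * (D * (4 * Real.pi * 0) + 3 * 0 ^ 2)))) := by
    refine Filter.Tendsto.mono_left (Continuous.tendsto ?_ 0) nhdsWithin_le_nhds
    fun_prop
  have := ge_of_tendsto hlim (by
    filter_upwards [self_mem_nhdsWithin] with l hl
    exact key l hl)
  simp only [mul_zero, ne_eq, OfNat.ofNat_ne_zero, not_false_eq_true, zero_pow, add_zero] at this
  linarith

/-- The bounds that follow from the conservation of energy. -/
structure EnergyBound (T H : ℝ) (μ : Measure Phase) (ξ η : ℝ → Space)
    (X V : ℝ → Phase → Space) : Prop where
  nonneg : 0 ≤ H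
  kinetic : ∀ t ∈ Icc 0 T, ∫ z, ‖V t z‖ ^ 2 ∂μ ≤ 2 * H
  charge : ∀ t ∈ Icc 0 T, ‖η t‖ ^ 2 ≤ 2 * H
  potential : ∀ t ∈ Icc 0 T, ∫ z, ‖X t z - ξ t‖⁻¹ ∂μ ≤ H

theorem energyBound (h : IsLagrangian T δ D B M μ ξ η X V) (hT : 0 ≤ T) {H : ℝ}
    (hH : H = (1 / 2) * (∫ z, ‖V 0 z‖ ^ 2 ∂μ) + (1 / 2) * ‖η 0‖ ^ 2
      + (∫ z, ‖X 0 z - ξ 0‖⁻¹ ∂μ) + (1 / 2) * ∫ z, ∫ z', ‖X 0 z - X 0 z'‖⁻¹ ∂μ ∂μ) :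
    EnergyBound T H μ ξ η X V := by
  have h0 : (0 : ℝ) ∈ Icc 0 T := ⟨le_rfl, hT⟩
  have e : ∀ t ∈ Icc 0 T, outerEnergy μ ξ η X V t = (1 / 2) * (∫ z, ‖V t z‖ ^ 2 ∂μ)
      + (∫ z, ‖X t z - ξ t‖⁻¹ ∂μ) + (1 / 2) * ‖η t‖ ^ 2 := by
    intro t ht
    rw [outerEnergy, integral_add ((h.integrable_sq_norm ht).const_mul _)
      (h.integrable_inv_norm ht), integral_const_mul]
  have hle : ∀ t ∈ Icc 0 T, outerEnergy μ ξ η X V t ≤ H := by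
    intro t ht
    have := h.outerEnergy_le ht
    rw [e 0 h0] at this
    linarith
  have p1 : ∀ t, 0 ≤ ∫ z, ‖V t z‖ ^ 2 ∂μ := fun t => integral_nonneg fun z => by positivity
  have p2 : ∀ t, 0 ≤ ∫ z, ‖X t z - ξ t‖⁻¹ ∂μ := fun t => integral_nonneg fun z => by positivity
  have p3 : ∀ t, 0 ≤ ‖η t‖ ^ 2 := fun t => by positivity
  have hle' : ∀ t ∈ Icc 0 T, (1 / 2) * (∫ z, ‖V t z‖ ^ 2 ∂μ)
      + (∫ z, ‖X t z - ξ t‖⁻¹ ∂μ) + (1 / 2) * ‖η t‖ ^ 2 ≤ H := by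
    intro t ht; rw [← e t ht]; exact hle t ht
  refine ⟨?_, fun t ht => ?_, fun t ht => ?_, fun t ht => ?_⟩
  · linarith [hle' 0 h0, p1 0, p2 0, p3 0]
  all_goals linarith [hle' t ht, p1 t, p2 t, p3 t]

end IsLagrangian

end PlasmaCharge
end

noncomputable section

namespace PlasmaCharge

namespace IsLagrangian

variable {T δ D B M H : ℝ} {μ : Measure Phase} {ξ η : ℝ → Space} {X V : ℝ → Phase → Space}

/-! ### The virial identity for the charge -/

theorem abs_inner_div_norm_le (a d : Space) : |inner ℝ a d / ‖d‖| ≤ ‖a‖ := by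
  rw [abs_div, abs_norm]
  exact div_le_of_le_mul₀ (norm_nonneg _) (norm_nonneg _) (abs_real_inner_le_norm a d)

theorem integrable_inv_sq_prod (h : IsLagrangian T δ D B M μ ξ η X V) {t : ℝ} (ht : t ∈ Icc 0 T) :
    Integrable (fun p : Phase × Phase => (‖X t p.1 - X t p.2‖ ^ 2)⁻¹) (μ.prod μ) := by
  have := h.prob
  have hm := h.measurable_X_apply t
  have hmeas : Measurable fun p : Phase × Phase => (‖X t p.1 - X t p.2‖ ^ 2)⁻¹ :=
    (((hm.comp measurable_fst).sub (hm.comp measurable_snd)).norm.pow_const 2).inv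
  refine ⟨hmeas.aestronglyMeasurable, ?_⟩
  rw [hasFiniteIntegral_iff_ofReal (ae_of_all _ fun p => by positivity),
    lintegral_prod _ hmeas.ennreal_ofReal.aemeasurable]
  calc _ ≤ ∫⁻ _ : Phase, ENNReal.ofReal (4 * Real.pi * D + 1) ∂μ :=
        lintegral_mono fun z => h.lintegral_inv_sq_le ht (X t z)
    _ < ∞ := by simp

/-- The plasma field pushes the plasma away from any point. -/
theorem integral_inner_plasmaField_nonneg (h : IsLagrangian T δ D B M μ ξ η X V) {t : ℝ}
    (ht : t ∈ Icc 0 T) (y : Space) :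
    0 ≤ ∫ z, inner ℝ (plasmaField μ X t (X t z)) (X t z - y) / ‖X t z - y‖ ∂μ := by
  have := h.prob
  have hm := h.measurable_X_apply t
  have e : ∀ z, inner ℝ (plasmaField μ X t (X t z)) (X t z - y) / ‖X t z - y‖
      = ∫ z', inner ℝ (coulomb (X t z - X t z')) (X t z - y) / ‖X t z - y‖ ∂μ := by
    intro z
    rw [integral_div, plasmaField, real_inner_comm,
      ← integral_inner (h.integrable_coulomb ht (X t z))]
    simp_rw [real_inner_comm (X t z - y)]
  simp_rw [e]
  refine integral_integral_nonneg_of_add_swap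
    (F := fun z z' => inner ℝ (coulomb (X t z - X t z')) (X t z - y) / ‖X t z - y‖) ?_ ?_
  · refine (h.integrable_inv_sq_prod ht).mono' ?_ (ae_of_all _ fun p => ?_)
    · refine Measurable.aestronglyMeasurable ?_
      have h1 : Measurable fun p : Phase × Phase => X t p.1 := hm.comp measurable_fst
      have h2 : Measurable fun p : Phase × Phase => X t p.2 := hm.comp measurable_snd
      exact (Measurable.inner (measurable_coulomb.comp (h1.sub h2)) (h1.sub_const y)).div
        (h1.sub_const y).norm
    · refine (abs_inner_div_norm_le _ _).trans (norm_coulomb _).le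
  · intro z z'
    have := inner_coulomb_sub_unit_nonneg (X t z - y) (X t z' - y)
    simpa only [sub_sub_sub_cancel_right] using this

theorem measurable_plasmaField_apply (h : IsLagrangian T δ D B M μ ξ η X V) (t : ℝ) :
    Measurable fun z => plasmaField μ X t (X t z) := by
  have h1 : Measurable fun z : Phase => (t, z) := measurable_prodMk_left
  have e : (fun z => plasmaField μ X t (X t z))
      = (fun p : ℝ × Phase => plasmaField μ X p.1 (X p.1 p.2)) ∘ fun z => (t, z) := by
    ext1 z; rfl
  rw [e]
  exact h.measurable_plasmaField_X.comp h1

theorem measurable_charge_inv_sq (h : IsLagrangian T δ D B M μ ξ η X V) {a b : ℝ} (ha : 0 ≤ a)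
    (hb : b ≤ T) :
    AEStronglyMeasurable (Function.uncurry fun t z => (‖X t z - ξ t‖ ^ 2)⁻¹)
      ((volume.restrict (Ioc a b)).prod μ) := by
  have := h.prob
  have hξ := aemeasurable_fst (P := μ) h.continuousOn_ξ ha hb
  exact ((h.measurable_X.aemeasurable.sub hξ).norm.pow_const 2).inv.aestronglyMeasurable

theorem intervalIntegrable_integral_charge_inv_sq (h : IsLagrangian T δ D B M μ ξ η X V) {a b : ℝ}
    (ha : 0 ≤ a) (hab : a ≤ b) (hb : b ≤ T) :
    IntervalIntegrable (fun t => ∫ z, (‖X t z - ξ t‖ ^ 2)⁻¹ ∂μ) volume a b := by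
  have := h.prob
  have hδ := h.δ_pos
  rw [intervalIntegrable_iff_integrableOn_Ioc_of_le hab]
  refine Integrable.of_bound (C := (δ ^ 2)⁻¹)
    (h.measurable_charge_inv_sq ha hb).integral_prod_right' ?_
  refine (ae_restrict_iff' measurableSet_Ioc).2 (ae_of_all _ fun t ht => ?_)
  have ht' : t ∈ Icc 0 T := ⟨ha.trans ht.1.le, ht.2.trans hb⟩
  have := norm_integral_le_of_norm_le_const (μ := μ) (C := (δ ^ 2)⁻¹)
    (f := fun z => (‖X t z - ξ t‖ ^ 2)⁻¹) (by
      filter_upwards [h.trajectory] with z hz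
      rw [Real.norm_of_nonneg (by positivity)]
      have := hz.lower t ht'
      gcongr)
  simpa using this

/-- Differentiate the mean of the component of `V` in the direction of `X - ξ`. The repulsion
contributes exactly the integrand, the plasma field is nonnegative on average, and the kinematic
term is at least `-|η|²/(4|X-ξ|)`, with mean at least `-H²/2`. The mean itself is at most `1/2 + H`
in size. Using `V` and not `V - η` keeps the acceleration of the charge, the very quantity to be
bounded, out of the identity. -/
theorem integral_integral_charge_inv_sq_le (h : IsLagrangian T δ D B M μ ξ η X V)
    (hE : EnergyBound T H μ ξ η X V) {a b : ℝ} (ha : 0 ≤ a) (hab : a ≤ b) (hb : b ≤ T) :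
    ∫ t in a..b, ∫ z, (‖X t z - ξ t‖ ^ 2)⁻¹ ∂μ ≤ 1 + 2 * H + (b - a) * (H ^ 2 / 2) := by
  have := h.prob
  have hδ := h.δ_pos
  have hH := hE.nonneg
  have hT : 0 ≤ T := ha.trans (hab.trans hb)
  have hB0 := h.B_nonneg hT
  have hsub : Icc a b ⊆ Icc 0 T := Icc_subset_Icc ha hb
  obtain ⟨A, hA0, hA⟩ := h.exists_norm_η_le
  have hD := h.D_nonneg
  set C := 4 * Real.pi * D + 1 with hC
  have hC0 : 0 ≤ C := by positivity
  have hX := h.measurable_X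
  have hV := h.measurable_V
  have hEX := h.measurable_plasmaField_X
  have hψ : ∀ t ∈ Icc 0 T, Integrable (fun z => inner ℝ (V t z) (X t z - ξ t) / ‖X t z - ξ t‖) μ ∧
      |∫ z, inner ℝ (V t z) (X t z - ξ t) / ‖X t z - ξ t‖ ∂μ| ≤ 1 / 2 + H := by
    intro t ht
    have hm := h.measurable_X_apply t
    have hm' := h.measurable_V_apply t
    have hi : Integrable (fun z => (1 / 2 : ℝ) + 1 / 2 * ‖V t z‖ ^ 2) μ :=
      (integrable_const _).add ((h.integrable_sq_norm ht).const_mul _)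
    have hle : ∀ z, ‖inner ℝ (V t z) (X t z - ξ t) / ‖X t z - ξ t‖‖
        ≤ 1 / 2 + 1 / 2 * ‖V t z‖ ^ 2 := by
      intro z
      refine (abs_inner_div_norm_le _ _).trans ?_
      nlinarith [sq_nonneg (‖V t z‖ - 1)]
    refine ⟨hi.mono' (Measurable.aestronglyMeasurable ((hm'.inner (hm.sub_const _)).div
      (hm.sub_const _).norm)) (ae_of_all _ hle), ?_⟩
    refine (norm_integral_le_of_norm_le hi (ae_of_all _ hle)).trans ?_
    rw [integral_add (integrable_const _) ((h.integrable_sq_norm ht).const_mul _),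
      integral_const_mul]
    have := hE.kinetic t ht
    simp
    linarith
  set k : ℝ → Phase → ℝ := fun t z =>
    (inner ℝ (plasmaField μ X t (X t z) + coulomb (X t z - ξ t)) (X t z - ξ t)
      + inner ℝ (V t z) (V t z - η t)) / ‖X t z - ξ t‖
      - inner ℝ (V t z) (X t z - ξ t) * inner ℝ (X t z - ξ t) (V t z - η t) / ‖X t z - ξ t‖ ^ 3
    with hk
  have hkb : ∀ᵐ z ∂μ, ∀ t ∈ Icc a b,
      ‖k t z‖ ≤ C + (δ ^ 2)⁻¹ + B * (B + A) * δ⁻¹ + B * (B + A) * δ⁻¹ := by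
    filter_upwards [h.trajectory, h.speed] with z hz hz' t ht
    have ht' := hsub ht
    have hlow := hz.lower t ht'
    have hpos : 0 < ‖X t z - ξ t‖ := hδ.trans_le hlow
    have hu : ‖V t z - η t‖ ≤ B + A := (norm_sub_le _ _).trans (add_le_add (hz' t ht') (hA t ht'))
    have hinv : ‖X t z - ξ t‖⁻¹ ≤ δ⁻¹ := inv_anti₀ hδ hlow
    have n1 : ‖inner ℝ (plasmaField μ X t (X t z) + coulomb (X t z - ξ t)) (X t z - ξ t)
        / ‖X t z - ξ t‖‖ ≤ C + (δ ^ 2)⁻¹ :=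
      (abs_inner_div_norm_le _ _).trans ((norm_add_le _ _).trans
        (add_le_add (h.norm_plasmaField_le ht' _) (norm_coulomb_le hδ hlow)))
    have n2 : ‖inner ℝ (V t z) (V t z - η t) / ‖X t z - ξ t‖‖ ≤ B * (B + A) * δ⁻¹ := by
      rw [div_eq_mul_inv, norm_mul, norm_inv, norm_norm]
      refine mul_le_mul ((norm_inner_le_norm _ _).trans
        (mul_le_mul (hz' t ht') hu (norm_nonneg _) hB0)) hinv (by positivity) (by positivity)
    have n3 : ‖inner ℝ (V t z) (X t z - ξ t) * inner ℝ (X t z - ξ t) (V t z - η t)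
        / ‖X t z - ξ t‖ ^ 3‖ ≤ B * (B + A) * δ⁻¹ := by
      have e : inner ℝ (V t z) (X t z - ξ t) * inner ℝ (X t z - ξ t) (V t z - η t)
          / ‖X t z - ξ t‖ ^ 3 = (inner ℝ (V t z) (X t z - ξ t) / ‖X t z - ξ t‖)
          * (inner ℝ (V t z - η t) (X t z - ξ t) / ‖X t z - ξ t‖) * ‖X t z - ξ t‖⁻¹ := by
        rw [real_inner_comm (V t z - η t)]
        field_simp
      rw [e, norm_mul, norm_mul, norm_inv, norm_norm]
      refine mul_le_mul (mul_le_mul ((abs_inner_div_norm_le _ _).trans (hz' t ht'))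
        ((abs_inner_div_norm_le _ _).trans hu) (norm_nonneg _) hB0) hinv (by positivity)
        (by positivity)
    rw [hk]
    simp only [add_div]
    refine (norm_sub_le _ _).trans (add_le_add ((norm_add_le _ _).trans (add_le_add n1 n2)) n3)
  have hkm : AEMeasurable (Function.uncurry k) ((volume.restrict (Ioc a b)).prod μ) := by
    have hξ := aemeasurable_fst (P := μ) h.continuousOn_ξ ha hb
    have hη := aemeasurable_fst (P := μ) h.continuousOn_η ha hb
    have hd := hX.aemeasurable.sub hξ
    have hu := hV.aemeasurable.sub hη
    refine AEMeasurable.sub (AEMeasurable.div (AEMeasurable.add (AEMeasurable.inner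
      (hEX.aemeasurable.add (measurable_coulomb.comp_aemeasurable hd)) hd)
      (hV.aemeasurable.inner hu)) hd.norm)
      (((hV.aemeasurable.inner hd).mul (hd.inner hu)).div (hd.norm.pow_const 3))
  obtain ⟨hi, he⟩ := integral_integral_eq_sub (P := μ) (a := a) (b := b)
    (g := fun t z => inner ℝ (V t z) (X t z - ξ t) / ‖X t z - ξ t‖)
    (k := k) hab (by
      filter_upwards [h.trajectory] with z hz t ht
      have ht' := hsub ht
      have hne : X t z - ξ t ≠ 0 := norm_pos_iff.1 (hδ.trans_le (hz.lower t ht'))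
      exact hasDerivWithinAt_inner_div_norm (((hz.hasDeriv_x t ht').mono hsub).sub
        ((h.hasDeriv_ξ t ht').mono hsub)) ((hz.hasDeriv_v t ht').mono hsub) hne)
    hkb hkm.aestronglyMeasurable (hψ a (hsub ⟨le_rfl, hab⟩)).1 (hψ b (hsub ⟨hab, le_rfl⟩)).1
  have hlow : ∀ t ∈ Icc a b, ∫ z, (‖X t z - ξ t‖ ^ 2)⁻¹ ∂μ ≤ (∫ z, k t z ∂μ) + H ^ 2 / 2 := by
    intro t ht
    have ht' := hsub ht
    have hm := h.measurable_X_apply t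
    have hm' := h.measurable_V_apply t
    have hme : Measurable fun z => plasmaField μ X t (X t z) := h.measurable_plasmaField_apply t
    have hd : Measurable fun z => X t z - ξ t := hm.sub_const _
    have hu : Measurable fun z => V t z - η t := hm'.sub_const _
    have i1 : Integrable (fun z => inner ℝ (plasmaField μ X t (X t z)) (X t z - ξ t)
        / ‖X t z - ξ t‖) μ := by
      refine Integrable.of_bound (C := C) ((hme.inner hd).div hd.norm).aestronglyMeasurable
        (ae_of_all _ fun z => ?_)
      exact (abs_inner_div_norm_le _ _).trans (h.norm_plasmaField_le ht' _)
    have i2 : Integrable (fun z => (‖X t z - ξ t‖ ^ 2)⁻¹) μ := by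
      have := h.integrable_inv_sq ht' (ξ t)
      simpa only [norm_sub_rev] using this
    have i3 : Integrable (fun z => ‖η t‖ ^ 2 / 4 * ‖X t z - ξ t‖⁻¹) μ :=
      (h.integrable_inv_norm ht').const_mul _
    have i4 : Integrable (k t) μ := by
      refine Integrable.of_bound
        (C := C + (δ ^ 2)⁻¹ + B * (B + A) * δ⁻¹ + B * (B + A) * δ⁻¹) ?_ ?_
      · refine Measurable.aestronglyMeasurable ?_
        exact Measurable.sub (Measurable.div (Measurable.add (Measurable.inner
          (hme.add (measurable_coulomb.comp hd)) hd) (hm'.inner hu)) hd.norm)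
          (((hm'.inner hd).mul (hd.inner hu)).div (hd.norm.pow_const 3))
      · filter_upwards [hkb] with z hz using hz t ht
    have hpt : ∀ᵐ z ∂μ, inner ℝ (plasmaField μ X t (X t z)) (X t z - ξ t) / ‖X t z - ξ t‖
        + (‖X t z - ξ t‖ ^ 2)⁻¹ ≤ k t z + ‖η t‖ ^ 2 / 4 * ‖X t z - ξ t‖⁻¹ := by
      filter_upwards [h.trajectory] with z hz
      have hne : X t z - ξ t ≠ 0 := norm_pos_iff.1 (hδ.trans_le (hz.lower t ht'))
      have h1 := neg_le_norm_virial (V t z - η t) (η t) (X t z - ξ t) hne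
      rw [sub_add_cancel] at h1
      have h2 := inner_coulomb_self (X t z - ξ t)
      rw [hk]
      simp only [inner_add_left, add_div]
      linarith
    have h1 := integral_mono_ae (i1.add i2) (i4.add i3) hpt
    simp only [Pi.add_apply] at h1
    rw [integral_add i1 i2, integral_add i4 i3, integral_const_mul] at h1
    have h2 := h.integral_inner_plasmaField_nonneg ht' (ξ t)
    have h3 := hE.potential t ht'
    have h4 := hE.charge t ht'
    have h5 : 0 ≤ ∫ z, ‖X t z - ξ t‖⁻¹ ∂μ := integral_nonneg fun z => by positivity
    have h6 : ‖η t‖ ^ 2 / 4 * ∫ z, ‖X t z - ξ t‖⁻¹ ∂μ ≤ H / 2 * H :=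
      mul_le_mul (by linarith) h3 h5 (by positivity)
    nlinarith
  calc ∫ t in a..b, ∫ z, (‖X t z - ξ t‖ ^ 2)⁻¹ ∂μ
      ≤ ∫ t in a..b, ((∫ z, k t z ∂μ) + H ^ 2 / 2) :=
        intervalIntegral.integral_mono_on hab
          (h.intervalIntegrable_integral_charge_inv_sq ha hab hb)
          (hi.add intervalIntegrable_const) hlow
    _ = (∫ z, inner ℝ (V b z) (X b z - ξ b) / ‖X b z - ξ b‖ ∂μ)
        - (∫ z, inner ℝ (V a z) (X a z - ξ a) / ‖X a z - ξ a‖ ∂μ) + (b - a) * (H ^ 2 / 2) := by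
        rw [intervalIntegral.integral_add hi intervalIntegrable_const, he,
          intervalIntegral.integral_const, smul_eq_mul]
    _ ≤ _ := by
        have h1 := (abs_le.1 (hψ a (hsub ⟨le_rfl, hab⟩)).2).1
        have h2 := (abs_le.1 (hψ b (hsub ⟨hab, le_rfl⟩)).2).2
        linarith

theorem aestronglyMeasurable_field_comp (h : IsLagrangian T δ D B M μ ξ η X V) {x : ℝ → Space}
    (hx : ContinuousOn x (Icc 0 T)) {a b : ℝ} (ha : 0 ≤ a) (hb : b ≤ T) :
    AEMeasurable (fun t => plasmaField μ X t (x t)) (volume.restrict (Ioc a b)) := by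
  have hsub : Ioc a b ⊆ Icc 0 T := fun t ht => ⟨ha.trans ht.1.le, ht.2.trans hb⟩
  have h1 : AEMeasurable x (volume.restrict (Ioc a b)) :=
    (hx.mono hsub).aemeasurable measurableSet_Ioc
  have h2 : AEMeasurable (fun t => (t, x t)) (volume.restrict (Ioc a b)) :=
    AEMeasurable.prodMk aemeasurable_id h1
  have e : (fun t => plasmaField μ X t (x t))
      = Function.uncurry (plasmaField μ X) ∘ fun t => (t, x t) := by
    ext1 t; rfl
  rw [e]
  exact h.measurable_plasmaField.comp_aemeasurable h2

theorem intervalIntegrable_norm_field (h : IsLagrangian T δ D B M μ ξ η X V) {x : ℝ → Space}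
    (hx : ContinuousOn x (Icc 0 T)) {a b : ℝ} (ha : 0 ≤ a) (hab : a ≤ b) (hb : b ≤ T) :
    IntervalIntegrable (fun t => ‖plasmaField μ X t (x t)‖) volume a b := by
  rw [intervalIntegrable_iff_integrableOn_Ioc_of_le hab]
  refine Integrable.of_bound (C := 4 * Real.pi * D + 1)
    (h.aestronglyMeasurable_field_comp hx ha hb).norm.aestronglyMeasurable ?_
  refine (ae_restrict_iff' measurableSet_Ioc).2 (ae_of_all _ fun t ht => ?_)
  rw [norm_norm]
  exact h.norm_plasmaField_le ⟨ha.trans ht.1.le, ht.2.trans hb⟩ _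

/-- The time integral of the field at the charge. -/
theorem integral_norm_field_charge_le (h : IsLagrangian T δ D B M μ ξ η X V)
    (hE : EnergyBound T H μ ξ η X V) {a b : ℝ} (ha : 0 ≤ a) (hab : a ≤ b) (hb : b ≤ T) :
    ∫ t in a..b, ‖plasmaField μ X t (ξ t)‖ ≤ 1 + 2 * H + (b - a) * (H ^ 2 / 2) := by
  refine le_trans ?_ (h.integral_integral_charge_inv_sq_le hE ha hab hb)
  refine intervalIntegral.integral_mono_on hab (h.intervalIntegrable_norm_field h.continuousOn_ξ
    ha hab hb) (h.intervalIntegrable_integral_charge_inv_sq ha hab hb) fun t _ => ?_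
  simp_rw [norm_sub_rev (X t _) (ξ t)]
  exact norm_plasmaField_le_integral _ _

end IsLagrangian

end PlasmaCharge
end

noncomputable section

namespace PlasmaCharge

/-! ### Estimates along single trajectories -/

theorem integral_le_sub_of_deriv_ge {g g' k : ℝ → ℝ} {T a b : ℝ} (ha : 0 ≤ a) (hab : a ≤ b)
    (hb : b ≤ T) (hd : ∀ t ∈ Icc 0 T, HasDerivWithinAt g (g' t) (Icc 0 T) t)
    (hk : IntervalIntegrable k volume a b) (hle : ∀ t ∈ Icc 0 T, k t ≤ g' t) :
    ∫ t in a..b, k t ≤ g b - g a := by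
  have hsub : Icc a b ⊆ Icc 0 T := Icc_subset_Icc ha hb
  refine intervalIntegral.integral_le_sub_of_hasDeriv_right_of_le hab
    (fun t ht => ((hd t (hsub ht)).continuousWithinAt).mono hsub) (fun t ht => ?_)
    ((intervalIntegrable_iff_integrableOn_Icc_of_le hab (by simp)).1 hk)
    (fun t ht => hle t (hsub (Ioo_subset_Icc_self ht)))
  exact (((hd t (hsub (Ioo_subset_Icc_self ht))).mono hsub).hasDerivAt
    (Icc_mem_nhds ht.1 ht.2)).hasDerivWithinAt

namespace IsTrajectory

variable {T δ : ℝ} {ξ : ℝ → Space} {E : ℝ → Space → Space} {x v : ℝ → Space}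

theorem continuousOn_x (h : IsTrajectory T δ ξ E x v) : ContinuousOn x (Icc 0 T) :=
  fun t ht => (h.hasDeriv_x t ht).continuousWithinAt

theorem continuousOn_v (h : IsTrajectory T δ ξ E x v) : ContinuousOn v (Icc 0 T) :=
  fun t ht => (h.hasDeriv_v t ht).continuousWithinAt

theorem ne (h : IsTrajectory T δ ξ E x v) (hδ : 0 < δ) {t : ℝ} (ht : t ∈ Icc 0 T) :
    x t - ξ t ≠ 0 :=
  norm_pos_iff.1 (hδ.trans_le (h.lower t ht))

theorem intervalIntegrable_inv_sq (h : IsTrajectory T δ ξ E x v) (hδ : 0 < δ)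
    (hξ : ContinuousOn ξ (Icc 0 T)) {a b : ℝ} (ha : 0 ≤ a) (hab : a ≤ b) (hb : b ≤ T) :
    IntervalIntegrable (fun t => (‖x t - ξ t‖ ^ 2)⁻¹) volume a b := by
  have hsub : Icc a b ⊆ Icc 0 T := Icc_subset_Icc ha hb
  refine ContinuousOn.intervalIntegrable_of_Icc hab (ContinuousOn.inv₀ ?_ fun t ht => ?_)
  · exact (((h.continuousOn_x.mono hsub).sub (hξ.mono hsub)).norm).pow 2
  · exact (pow_pos (norm_pos_iff.2 (h.ne hδ (hsub ht))) 2).ne'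

end IsTrajectory

/-! ### Relative motion with respect to the charge and of pairs of particles -/

namespace IsLagrangian

variable {T δ D B M H : ℝ} {μ : Measure Phase} {ξ η : ℝ → Space} {X V : ℝ → Phase → Space}
  {x v y w : ℝ → Space}

theorem hasDerivWithinAt_relativeVelocity (h : IsLagrangian T δ D B M μ ξ η X V)
    (hx : IsTrajectory T δ ξ (plasmaField μ X) x v) {t : ℝ} (ht : t ∈ Icc 0 T) :
    HasDerivWithinAt (fun s => v s - η s)
      (plasmaField μ X t (x t) + coulomb (x t - ξ t) - plasmaField μ X t (ξ t)) (Icc 0 T) t :=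
  (hx.hasDeriv_v t ht).sub (h.hasDeriv_η t ht)

theorem hasDerivWithinAt_relativePosition (h : IsLagrangian T δ D B M μ ξ η X V)
    (hx : IsTrajectory T δ ξ (plasmaField μ X) x v) {t : ℝ} (ht : t ∈ Icc 0 T) :
    HasDerivWithinAt (fun s => x s - ξ s) (v t - η t) (Icc 0 T) t :=
  (hx.hasDeriv_x t ht).sub (h.hasDeriv_ξ t ht)

/-- The energy of a particle changes only through the plasma field. -/
theorem sqrt_particleEnergy_le (h : IsLagrangian T δ D B M μ ξ η X V)
    (hx : IsTrajectory T δ ξ (plasmaField μ X) x v) {K : ℝ} (hK : 0 < K) {a b : ℝ} (ha : 0 ≤ a)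
    (hab : a ≤ b) (hb : b ≤ T) :
    √(particleEnergy K (ξ b) (η b) (x b, v b)) ≤ √(particleEnergy K (ξ a) (η a) (x a, v a))
      + ((∫ t in a..b, ‖plasmaField μ X t (x t)‖) + ∫ t in a..b, ‖plasmaField μ X t (ξ t)‖) := by
  have hδ := h.δ_pos
  have hi1 := h.intervalIntegrable_norm_field hx.continuousOn_x ha hab hb
  have hi2 := h.intervalIntegrable_norm_field h.continuousOn_ξ ha hab hb
  have hpos : ∀ t, 0 < particleEnergy K (ξ t) (η t) (x t, v t) := by
    intro t
    unfold particleEnergy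
    positivity
  -- Applied to `-√h`, since the comparison bounds increments from below. The Coulomb terms cancel
  -- in `dh/dt`, and `|v-η| ≤ 2√h` removes the square root from the denominator.
  have key := integral_le_sub_of_deriv_ge (T := T)
    (g := fun t => -√(particleEnergy K (ξ t) (η t) (x t, v t)))
    (g' := fun t => -(inner ℝ (v t - η t) (plasmaField μ X t (x t) - plasmaField μ X t (ξ t))
      / (2 * √(particleEnergy K (ξ t) (η t) (x t, v t)))))
    (k := fun t => -(‖plasmaField μ X t (x t)‖ + ‖plasmaField μ X t (ξ t)‖)) ha hab hb ?_
    (hi1.add hi2).neg ?_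
  · rw [intervalIntegral.integral_neg, intervalIntegral.integral_add hi1 hi2] at key
    linarith
  · intro t ht
    have d1 := (h.hasDerivWithinAt_relativeVelocity hx ht).norm_sq.div_const 2
    have d2 := hasDerivWithinAt_inv_norm (h.hasDerivWithinAt_relativePosition hx ht) (hx.ne hδ ht)
    have d3 := ((d1.add d2).add_const K)
    have d4 : HasDerivWithinAt (fun t => particleEnergy K (ξ t) (η t) (x t, v t))
        (inner ℝ (v t - η t) (plasmaField μ X t (x t) - plasmaField μ X t (ξ t)))
        (Icc 0 T) t := by
      refine (d3.congr_deriv ?_).congr (fun s _ => ?_) ?_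
      · simp only [inner_add_right, inner_sub_right]
        rw [real_inner_comm (v t) (coulomb (x t - ξ t)),
          real_inner_comm (η t) (coulomb (x t - ξ t)), inner_sub_left, inner_sub_left,
          inner_sub_left]
        ring
      · simp [particleEnergy, one_div]
      · simp [particleEnergy, one_div]
    exact (d4.sqrt (hpos t).ne').neg
  · intro t ht
    have hs : 0 < √(particleEnergy K (ξ t) (η t) (x t, v t)) := Real.sqrt_pos.2 (hpos t)
    rw [neg_le_neg_iff, div_le_iff₀ (by positivity)]
    have hv : ‖v t - η t‖ ≤ 2 * √(particleEnergy K (ξ t) (η t) (x t, v t)) := by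
      refine (sq_le_sq₀ (norm_nonneg _) (by positivity)).1 ?_
      rw [mul_pow, Real.sq_sqrt (hpos t).le]
      unfold particleEnergy
      have : 0 ≤ 1 / ‖x t - ξ t‖ := by positivity
      simp only
      nlinarith [sq_nonneg ‖v t - η t‖]
    calc inner ℝ (v t - η t) (plasmaField μ X t (x t) - plasmaField μ X t (ξ t))
        ≤ ‖v t - η t‖ * ‖plasmaField μ X t (x t) - plasmaField μ X t (ξ t)‖ :=
          real_inner_le_norm _ _
      _ ≤ (2 * √(particleEnergy K (ξ t) (η t) (x t, v t)))
          * (‖plasmaField μ X t (x t)‖ + ‖plasmaField μ X t (ξ t)‖) := by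
          gcongr; exact norm_sub_le _ _
      _ = _ := by ring

/-- The total force exerted by the charge on a particle. -/
theorem integral_charge_force_le (h : IsLagrangian T δ D B M μ ξ η X V)
    (hx : IsTrajectory T δ ξ (plasmaField μ X) x v) {a b : ℝ} (ha : 0 ≤ a)
    (hab : a ≤ b) (hb : b ≤ T) :
    ∫ t in a..b, (‖x t - ξ t‖ ^ 2)⁻¹ ≤ ‖v a - η a‖ + ‖v b - η b‖
      + ((∫ t in a..b, ‖plasmaField μ X t (x t)‖) + ∫ t in a..b, ‖plasmaField μ X t (ξ t)‖) := by
  have hδ := h.δ_pos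
  have hi1 := h.intervalIntegrable_norm_field hx.continuousOn_x ha hab hb
  have hi2 := h.intervalIntegrable_norm_field h.continuousOn_ξ ha hab hb
  have hi3 := hx.intervalIntegrable_inv_sq hδ h.continuousOn_ξ ha hab hb
  -- The radial component of the relative velocity: repulsion and convexity of the distance both
  -- increase it, and it is bounded by the relative speed.
  have key := integral_le_sub_of_deriv_ge (T := T) ha hab hb (fun t ht =>
    hasDerivWithinAt_inner_div_norm (h.hasDerivWithinAt_relativePosition hx ht)
      (h.hasDerivWithinAt_relativeVelocity hx ht) (hx.ne hδ ht))
    (k := fun t => (‖x t - ξ t‖ ^ 2)⁻¹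
      - (‖plasmaField μ X t (x t)‖ + ‖plasmaField μ X t (ξ t)‖)) (hi3.sub (hi1.add hi2)) ?_
  · rw [intervalIntegral.integral_sub hi3 (hi1.add hi2), intervalIntegral.integral_add hi1 hi2]
      at key
    have h1 := (abs_le.1 (abs_inner_div_norm_le (v a - η a) (x a - ξ a))).1
    have h2 := (abs_le.1 (abs_inner_div_norm_le (v b - η b) (x b - ξ b))).2
    linarith
  · intro t ht
    have h1 := norm_virial_nonneg (v t - η t) (x t - ξ t)
    have h2 := inner_coulomb_self (x t - ξ t)
    have h3 := (abs_le.1 (abs_inner_div_norm_le (plasmaField μ X t (x t)) (x t - ξ t))).1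
    have h4 := (abs_le.1 (abs_inner_div_norm_le (plasmaField μ X t (ξ t)) (x t - ξ t))).2
    have e : (inner ℝ (plasmaField μ X t (x t) + coulomb (x t - ξ t) - plasmaField μ X t (ξ t))
          (x t - ξ t) + inner ℝ (v t - η t) (v t - η t)) / ‖x t - ξ t‖
        = inner ℝ (plasmaField μ X t (x t)) (x t - ξ t) / ‖x t - ξ t‖
          + inner ℝ (coulomb (x t - ξ t)) (x t - ξ t) / ‖x t - ξ t‖
          - inner ℝ (plasmaField μ X t (ξ t)) (x t - ξ t) / ‖x t - ξ t‖
          + inner ℝ (v t - η t) (v t - η t) / ‖x t - ξ t‖ := by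
      rw [inner_sub_left (plasmaField μ X t (x t) + coulomb (x t - ξ t)) _ (x t - ξ t),
        inner_add_left (plasmaField μ X t (x t)) _ (x t - ξ t)]
      ring
    rw [e]
    linarith

/-- The kernel `1 / (s (R + s))`, `s = √(|x|² + R²)`. -/
def pairKernel (R : ℝ) (x : Space) : ℝ := (softNorm R x * (R + softNorm R x))⁻¹

theorem continuous_pairKernel {R : ℝ} (hR : 0 < R) : Continuous (pairKernel R) := by
  unfold pairKernel
  have hc := continuous_softNorm R
  refine Continuous.inv₀ (hc.mul (continuous_const.add hc)) fun x => ?_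
  have := softNorm_pos hR x
  positivity

theorem pairKernel_nonneg {R : ℝ} (hR : 0 < R) (x : Space) : 0 ≤ pairKernel R x := by
  have := softNorm_pos hR x
  unfold pairKernel
  positivity

/-- Beyond the smoothing length `s ≤ (3/2)|x|`, so `s(R + s) ≤ (15/4)|x|²`. -/
theorem inv_sq_le_pairKernel {R : ℝ} (hR : 0 < R) {x : Space} (hx : R ≤ ‖x‖) :
    (‖x‖ ^ 2)⁻¹ ≤ 4 * pairKernel R x := by
  have hs := softNorm_pos hR x
  have hsq := softNorm_sq R x
  have hx0 : 0 < ‖x‖ := hR.trans_le hx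
  have h1 : softNorm R x ≤ 3 / 2 * ‖x‖ := by
    refine (sq_le_sq₀ hs.le (by positivity)).1 ?_
    rw [hsq]; nlinarith
  unfold pairKernel
  rw [← div_eq_mul_inv, le_div_iff₀ (by positivity), inv_mul_le_iff₀ (by positivity)]
  nlinarith

/-- Two particles with a large relative velocity separate quickly. -/
theorem integral_pairKernel_le (h : IsLagrangian T δ D B M μ ξ η X V)
    (hx : IsTrajectory T δ ξ (plasmaField μ X) x v)
    (hy : IsTrajectory T δ ξ (plasmaField μ X) y w) {R : ℝ} (hR : 0 < R) {a b : ℝ} (ha : 0 ≤ a)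
    (hab : a ≤ b) (hb : b ≤ T) :
    R * ∫ t in a..b, ‖v t - w t‖ ^ 2 * pairKernel R (x t - y t)
      ≤ ‖v a - w a‖ + ‖v b - w b‖
      + (((∫ t in a..b, ‖plasmaField μ X t (x t)‖) + ∫ t in a..b, (‖x t - ξ t‖ ^ 2)⁻¹)
        + ((∫ t in a..b, ‖plasmaField μ X t (y t)‖) + ∫ t in a..b, (‖y t - ξ t‖ ^ 2)⁻¹)) := by
  have hδ := h.δ_pos
  have hsub : Icc a b ⊆ Icc 0 T := Icc_subset_Icc ha hb
  have hi1 := h.intervalIntegrable_norm_field hx.continuousOn_x ha hab hb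
  have hi2 := h.intervalIntegrable_norm_field hy.continuousOn_x ha hab hb
  have hi3 := hx.intervalIntegrable_inv_sq hδ h.continuousOn_ξ ha hab hb
  have hi4 := hy.intervalIntegrable_inv_sq hδ h.continuousOn_ξ ha hab hb
  have hi5 : IntervalIntegrable (fun t => ‖v t - w t‖ ^ 2 * pairKernel R (x t - y t))
      volume a b := by
    refine ContinuousOn.intervalIntegrable_of_Icc hab (ContinuousOn.mono ?_ hsub)
    exact ((hx.continuousOn_v.sub hy.continuousOn_v).norm.pow 2).mul
      ((continuous_pairKernel hR).comp_continuousOn (hx.continuousOn_x.sub hy.continuousOn_x))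
  have hsum := (hi1.add hi3).add (hi2.add hi4)
  -- The same argument with a smoothed distance, since two plasma particles may meet. The force of
  -- the charge on each is no longer harmless, and enters through the time integral of `1/|x-ξ|²`.
  have key := integral_le_sub_of_deriv_ge (T := T) ha hab hb (fun t ht =>
    hasDerivWithinAt_inner_div_softNorm hR ((hx.hasDeriv_x t ht).sub (hy.hasDeriv_x t ht))
      ((hx.hasDeriv_v t ht).sub (hy.hasDeriv_v t ht)))
    (k := fun t => R * (‖v t - w t‖ ^ 2 * pairKernel R (x t - y t))
      - ((‖plasmaField μ X t (x t)‖ + (‖x t - ξ t‖ ^ 2)⁻¹)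
        + (‖plasmaField μ X t (y t)‖ + (‖y t - ξ t‖ ^ 2)⁻¹))) ((hi5.const_mul R).sub hsum) ?_
  · rw [intervalIntegral.integral_sub (hi5.const_mul R) hsum,
      intervalIntegral.integral_add (hi1.add hi3) (hi2.add hi4),
      intervalIntegral.integral_add hi1 hi3, intervalIntegral.integral_add hi2 hi4,
      intervalIntegral.integral_const_mul] at key
    have hbd : ∀ u d : Space, |inner ℝ u d / (R + softNorm R d)| ≤ ‖u‖ := by
      intro u d
      have hs := softNorm_pos hR d
      rw [abs_div, abs_of_pos (show 0 < R + softNorm R d by positivity), div_le_iff₀ (by positivity)]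
      refine (abs_real_inner_le_norm u d).trans ?_
      gcongr
      linarith [norm_le_softNorm R d]
    have h1 := (abs_le.1 (hbd (v a - w a) (x a - y a))).1
    have h2 := (abs_le.1 (hbd (v b - w b) (x b - y b))).2
    simp only [Pi.sub_apply] at key
    linarith
  · intro t ht
    have h1 := le_softNorm_virial hR (plasmaField μ X t (x t) + coulomb (x t - ξ t)
      - (plasmaField μ X t (y t) + coulomb (y t - ξ t))) (v t - w t) (x t - y t)
    have h2 : ‖plasmaField μ X t (x t) + coulomb (x t - ξ t)
        - (plasmaField μ X t (y t) + coulomb (y t - ξ t))‖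
        ≤ (‖plasmaField μ X t (x t)‖ + (‖x t - ξ t‖ ^ 2)⁻¹)
          + (‖plasmaField μ X t (y t)‖ + (‖y t - ξ t‖ ^ 2)⁻¹) := by
      rw [← norm_coulomb, ← norm_coulomb]
      exact (norm_sub_le _ _).trans (add_le_add (norm_add_le _ _) (norm_add_le _ _))
    have e : R * (‖v t - w t‖ ^ 2 * pairKernel R (x t - y t)) = ‖v t - w t‖ ^ 2
        * (R / (softNorm R (x t - y t) * (R + softNorm R (x t - y t)))) := by
      rw [pairKernel, div_eq_mul_inv]; ring
    rw [e]
    simp only [Pi.sub_apply]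
    linarith

end IsLagrangian

end PlasmaCharge
end

noncomputable section

namespace PlasmaCharge

/-! ### The field of slow particles -/

theorem volume_ball_space (c : Space) {r : ℝ} (hr : 0 ≤ r) :
    volume (Metric.ball c r) = ENNReal.ofReal (4 / 3 * Real.pi * r ^ 3) := by
  rw [EuclideanSpace.volume_ball_fin_three, ← ENNReal.ofReal_pow hr,
    ← ENNReal.ofReal_mul (by positivity)]
  congr 1; ring

theorem measurable_indicator_inv_pow {s : Set ℝ} (hs : MeasurableSet s) (k : ℕ) (x : Space) :
    Measurable fun y : Space => ENNReal.ofReal (s.indicator (fun r => (r ^ k)⁻¹) ‖x - y‖) :=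
  (Measurable.comp (Measurable.indicator (by fun_prop) hs) (by fun_prop)).ennreal_ofReal

theorem measurable_indicator_ball (c : Space) (P : ℝ) :
    Measurable ((Metric.ball c P).indicator (1 : Space → ℝ≥0∞)) :=
  measurable_one.indicator measurableSet_ball

theorem lintegral_phase_near_le (x c : Space) {P R : ℝ} (hP : 0 ≤ P) (hR : 0 ≤ R) :
    ∫⁻ p : Phase, ENNReal.ofReal ((Iio R).indicator (fun r => (r ^ 2)⁻¹) ‖x - p.1‖)
        * (Metric.ball c P).indicator 1 p.2
      ≤ ENNReal.ofReal (4 * Real.pi * R * (4 / 3 * Real.pi * P ^ 3)) := by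
  rw [Measure.volume_eq_prod, lintegral_prod_mul
    (measurable_indicator_inv_pow measurableSet_Iio 2 x).aemeasurable
    (measurable_indicator_ball c P).aemeasurable, lintegral_indicator_one measurableSet_ball,
    volume_ball_space c hP, ENNReal.ofReal_mul (p := 4 * Real.pi * R) (by positivity)]
  exact mul_le_mul_left (lintegral_inv_sq_lt_le hR x) _

theorem measurable_phase_far (x : Space) (κ l : ℝ) :
    Measurable fun p : Phase =>
      ENNReal.ofReal ((Ici l).indicator (fun r => (r ^ 2)⁻¹) ‖x - p.1‖)
        * {p : Phase | ‖p.2‖ < κ / ‖x - p.1‖}.indicator 1 p := by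
  refine Measurable.mul ((measurable_indicator_inv_pow measurableSet_Ici 2 x).comp measurable_fst) ?_
  exact measurable_one.indicator (measurableSet_lt (by fun_prop) (by fun_prop))

/-- At distance `r` the admissible velocities fill a ball of volume proportional to `(κ/r)³`, so the
kernel effectively decays like `r^(-5)` and is integrable at infinity. -/
theorem lintegral_phase_far_le (x : Space) {κ l : ℝ} (hκ : 0 ≤ κ) (hl : 0 < l) :
    ∫⁻ p : Phase, ENNReal.ofReal ((Ici l).indicator (fun r => (r ^ 2)⁻¹) ‖x - p.1‖)
        * {p : Phase | ‖p.2‖ < κ / ‖x - p.1‖}.indicator 1 p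
      ≤ ENNReal.ofReal (4 / 3 * Real.pi * κ ^ 3 * (2 * Real.pi * (l ^ 2)⁻¹)) := by
  rw [Measure.volume_eq_prod, lintegral_prod _ (measurable_phase_far x κ l).aemeasurable]
  have e : ∀ y : Space, ∫⁻ w : Space,
      ENNReal.ofReal ((Ici l).indicator (fun r => (r ^ 2)⁻¹) ‖x - y‖)
        * {p : Phase | ‖p.2‖ < κ / ‖x - p.1‖}.indicator 1 (y, w)
      = ENNReal.ofReal (4 / 3 * Real.pi * κ ^ 3)
        * ENNReal.ofReal ((Ici l).indicator (fun r => (r ^ 5)⁻¹) ‖x - y‖) := by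
    intro y
    have e1 : (fun w : Space => ({p : Phase | ‖p.2‖ < κ / ‖x - p.1‖}.indicator 1 (y, w) : ℝ≥0∞))
        = (Metric.ball (0 : Space) (κ / ‖x - y‖)).indicator 1 := by
      ext w
      simp [indicator]
    rw [lintegral_const_mul' _ _ ENNReal.ofReal_ne_top, e1,
      lintegral_indicator_one measurableSet_ball, volume_ball_space 0 (by positivity),
      ← ENNReal.ofReal_mul (indicator_nonneg (fun r _ => by positivity) _),
      ← ENNReal.ofReal_mul (by positivity)]
    congr 1
    by_cases hy : l ≤ ‖x - y‖
    · have : 0 < ‖x - y‖ := hl.trans_le hy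
      simp only [indicator, mem_Ici, hy, if_true]
      field_simp
    · simp [indicator, hy]
  simp_rw [e]
  rw [lintegral_const_mul' _ _ ENNReal.ofReal_ne_top,
    ENNReal.ofReal_mul (p := 4 / 3 * Real.pi * κ ^ 3) (by positivity)]
  exact mul_le_mul_right (lintegral_inv_pow_five_ge_le hl x) _

/-- Particles are slow, close, or carry much kinetic energy. -/
theorem inv_sq_mul_indicator_ball_le (x c : Space) {P κ : ℝ} (hP : 0 < P) (hκ : 0 < κ)
    (p : Phase) :
    ENNReal.ofReal ((‖x - p.1‖ ^ 2)⁻¹) * (Metric.ball c P).indicator 1 p.2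
      ≤ ENNReal.ofReal ((Iio (κ / P)).indicator (fun r => (r ^ 2)⁻¹) ‖x - p.1‖)
          * (Metric.ball c P).indicator 1 p.2
        + ENNReal.ofReal ((Ici (κ / P)).indicator (fun r => (r ^ 2)⁻¹) ‖x - p.1‖)
          * {p : Phase | ‖p.2‖ < κ / ‖x - p.1‖}.indicator 1 p
        + ENNReal.ofReal ((κ ^ 2)⁻¹ * ‖p.2‖ ^ 2) := by
  by_cases h1 : κ ≤ ‖p.2‖ * ‖x - p.1‖
  · refine le_trans ?_ le_add_self
    calc _ ≤ ENNReal.ofReal ((‖x - p.1‖ ^ 2)⁻¹) * 1 := by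
          gcongr
          exact indicator_le_self _ _ _
      _ ≤ _ := by
          rw [mul_one]
          apply ENNReal.ofReal_le_ofReal
          have hr : 0 < ‖x - p.1‖ := by
            rcases (norm_nonneg (x - p.1)).eq_or_lt with h | h
            · rw [← h, mul_zero] at h1; linarith
            · exact h
          rw [inv_mul_eq_div, le_div_iff₀ (by positivity), inv_mul_le_iff₀ (by positivity),
            ← mul_pow, mul_comm ‖x - p.1‖]
          gcongr
  · refine le_trans ?_ le_self_add
    by_cases h2 : ‖x - p.1‖ < κ / P
    · refine le_trans (le_of_eq ?_) le_self_add
      simp [indicator, h2]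
    · refine le_trans ?_ le_add_self
      have h3 : 0 < ‖x - p.1‖ := (div_pos hκ hP).trans_le (not_lt.1 h2)
      have h4 : ‖p.2‖ < κ / ‖x - p.1‖ := by rw [lt_div_iff₀ h3]; exact not_le.1 h1
      have e1 : ({p : Phase | ‖p.2‖ < κ / ‖x - p.1‖}.indicator 1 p : ℝ≥0∞) = 1 :=
        indicator_of_mem (s := {p : Phase | ‖p.2‖ < κ / ‖x - p.1‖}) h4 _
      rw [e1, indicator_of_mem (show ‖x - p.1‖ ∈ Ici (κ / P) from not_lt.1 h2)]
      gcongr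
      exact indicator_le_self _ _ _

namespace IsLagrangian

variable {T δ D B M H : ℝ} {μ : Measure Phase} {ξ η : ℝ → Space} {X V : ℝ → Phase → Space}

theorem lintegral_comp_le (h : IsLagrangian T δ D B M μ ξ η X V) {t : ℝ} (ht : t ∈ Icc 0 T)
    {g : Phase → ℝ≥0∞} (hg : Measurable g) {c : ℝ} (hc : ∫⁻ p, g p ≤ ENNReal.ofReal c) :
    ∫⁻ z, g (X t z, V t z) ∂μ ≤ ENNReal.ofReal (M * c) := by
  have hm : Measurable fun z => (X t z, V t z) :=
    (h.measurable_X_apply t).prodMk (h.measurable_V_apply t)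
  rw [← lintegral_map hg hm]
  exact lintegral_le_of_le_smul h.M_nonneg (h.phase_le t ht) hc

theorem measurable_phase_near (x c : Space) (P R : ℝ) :
    Measurable fun p : Phase =>
      ENNReal.ofReal ((Iio R).indicator (fun r => (r ^ 2)⁻¹) ‖x - p.1‖)
        * (Metric.ball c P).indicator 1 p.2 :=
  ((measurable_indicator_inv_pow measurableSet_Iio 2 x).comp measurable_fst).mul
    ((measurable_indicator_ball c P).comp measurable_snd)

theorem lintegral_near_le (h : IsLagrangian T δ D B M μ ξ η X V) {t : ℝ} (ht : t ∈ Icc 0 T)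
    (x c : Space) {P R : ℝ} (hP : 0 ≤ P) (hR : 0 ≤ R) :
    ∫⁻ z, ENNReal.ofReal ((Iio R).indicator (fun r => (r ^ 2)⁻¹) ‖x - X t z‖)
        * (Metric.ball c P).indicator 1 (V t z) ∂μ
      ≤ ENNReal.ofReal (M * (4 * Real.pi * R * (4 / 3 * Real.pi * P ^ 3))) :=
  h.lintegral_comp_le ht (measurable_phase_near x c P R) (lintegral_phase_near_le x c hP hR)

/-- Near, at distances below `κ/P`, the velocity ball gives order `κP²`; farther away the particles
with `|V| < κ/r` give the same order; the others satisfy `r^(-2) ≤ |V|²/κ²` and are paid for by the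
kinetic energy. The choice `κ = P^(-2/3)` balances the terms at `P^(4/3)`. The centre of the
velocity ball is free in order to treat slowness relative to another particle. -/
theorem lintegral_slow_le (h : IsLagrangian T δ D B M μ ξ η X V)
    (hE : EnergyBound T H μ ξ η X V) {t : ℝ} (ht : t ∈ Icc 0 T)
    (x c : Space) {P κ : ℝ} (hP : 0 < P) (hκ : 0 < κ) :
    ∫⁻ z, ENNReal.ofReal ((‖x - X t z‖ ^ 2)⁻¹) * (Metric.ball c P).indicator 1 (V t z) ∂μ
      ≤ ENNReal.ofReal (8 * Real.pi ^ 2 * M * P ^ 2 * κ + 2 * H * (κ ^ 2)⁻¹) := by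
  have hM := h.M_nonneg
  have hH := hE.nonneg
  have hm : Measurable fun z => (X t z, V t z) :=
    (h.measurable_X_apply t).prodMk (h.measurable_V_apply t)
  have hV := h.measurable_V_apply t
  have h3 : ∫⁻ z, ENNReal.ofReal ((κ ^ 2)⁻¹ * ‖V t z‖ ^ 2) ∂μ
      ≤ ENNReal.ofReal (2 * H * (κ ^ 2)⁻¹) := by
    rw [← ofReal_integral_eq_lintegral_ofReal ((h.integrable_sq_norm ht).const_mul _)
      (ae_of_all _ fun z => by positivity), integral_const_mul]
    apply ENNReal.ofReal_le_ofReal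
    rw [mul_comm]
    gcongr
    exact hE.kinetic t ht
  calc _ ≤ ∫⁻ z, (ENNReal.ofReal ((Iio (κ / P)).indicator (fun r => (r ^ 2)⁻¹) ‖x - X t z‖)
          * (Metric.ball c P).indicator 1 (V t z)
        + ENNReal.ofReal ((Ici (κ / P)).indicator (fun r => (r ^ 2)⁻¹) ‖x - X t z‖)
          * {p : Phase | ‖p.2‖ < κ / ‖x - p.1‖}.indicator 1 (X t z, V t z)
        + ENNReal.ofReal ((κ ^ 2)⁻¹ * ‖V t z‖ ^ 2)) ∂μ :=
        lintegral_mono fun z => inv_sq_mul_indicator_ball_le x c hP hκ (X t z, V t z)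
    _ ≤ ENNReal.ofReal (M * (4 * Real.pi * (κ / P) * (4 / 3 * Real.pi * P ^ 3)))
        + ENNReal.ofReal (M * (4 / 3 * Real.pi * κ ^ 3 * (2 * Real.pi * ((κ / P) ^ 2)⁻¹)))
        + ENNReal.ofReal (2 * H * (κ ^ 2)⁻¹) := by
        have hfar : Measurable fun z =>
            ENNReal.ofReal ((Ici (κ / P)).indicator (fun r => (r ^ 2)⁻¹) ‖x - X t z‖)
              * {p : Phase | ‖p.2‖ < κ / ‖x - p.1‖}.indicator 1 (X t z, V t z) := by
          have e := (measurable_phase_far x κ (κ / P)).comp hm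
          simp only [Function.comp_def] at e
          exact e
        rw [lintegral_add_right _ (by fun_prop), lintegral_add_right _ hfar]
        gcongr
        · exact h.lintegral_near_le ht x c hP.le (by positivity)
        · exact h.lintegral_comp_le ht (measurable_phase_far x κ (κ / P))
            (lintegral_phase_far_le x hκ.le (by positivity))
    _ = _ := by
        rw [← ENNReal.ofReal_add (by positivity) (by positivity),
          ← ENNReal.ofReal_add (by positivity) (by positivity)]
        congr 1
        field_simp
        ring

end IsLagrangian

end PlasmaCharge
end

noncomputable section

namespace PlasmaCharge

/-! ### The field along a trajectory -/

/-- The field is at most `fieldConst M H * q ^ 16` when the velocities are of size `q ^ 12`. -/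
def fieldConst (M H : ℝ) : ℝ := 128 * Real.pi ^ 2 * M + 2 * H

/-- Bounds the speed of the charge and, over a unit of time, the impulse that it receives. -/
def chargeConst (H : ℝ) : ℝ := 1 + 2 * H + H ^ 2 / 2

/-- The scale from which on velocities count as large. -/
def scaleThreshold (M H : ℝ) : ℝ := 10 * (fieldConst M H + chargeConst H)

theorem fieldConst_nonneg {M H : ℝ} (hM : 0 ≤ M) (hH : 0 ≤ H) : 0 ≤ fieldConst M H := by
  unfold fieldConst; positivity

theorem one_le_chargeConst {H : ℝ} (hH : 0 ≤ H) : 1 ≤ chargeConst H := by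
  unfold chargeConst; nlinarith [sq_nonneg H]

theorem ten_le_scaleThreshold {M H : ℝ} (hM : 0 ≤ M) (hH : 0 ≤ H) : 10 ≤ scaleThreshold M H := by
  unfold scaleThreshold
  linarith [fieldConst_nonneg hM hH, one_le_chargeConst hH]

namespace IsLagrangian

variable {T δ D B M H : ℝ} {μ : Measure Phase} {ξ η : ℝ → Space} {X V : ℝ → Phase → Space}
  {x v : ℝ → Space} {a b q : ℝ}

theorem norm_η_le (hE : EnergyBound T H μ ξ η X V) {t : ℝ} (ht : t ∈ Icc 0 T) :
    ‖η t‖ ≤ chargeConst H := by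
  have h1 := hE.charge t ht
  have h2 := hE.nonneg
  unfold chargeConst
  nlinarith [sq_nonneg (‖η t‖ - 1), sq_nonneg H]

theorem ae_norm_V_lt (h : IsLagrangian T δ D B M μ ξ η X V) (hE : EnergyBound T H μ ξ η X V)
    (hq : scaleThreshold M H ≤ q) (ha : 0 ≤ a) (hb : b ≤ T)
    (hc : ∀ᵐ z ∂μ, ∀ t ∈ Icc a b, ‖V t z - η t‖ ≤ 2 * q ^ 12) :
    ∀ᵐ z ∂μ, ∀ t ∈ Icc a b, ‖V t z‖ < 4 * q ^ 12 := by
  have hA := fieldConst_nonneg h.M_nonneg hE.nonneg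
  have hC := one_le_chargeConst hE.nonneg
  have h10 := ten_le_scaleThreshold h.M_nonneg hE.nonneg
  filter_upwards [hc] with z hz t ht
  have h1 := norm_η_le hE (Icc_subset_Icc ha hb ht)
  have h2 : ‖V t z‖ ≤ ‖V t z - η t‖ + ‖η t‖ := by
    simpa using norm_add_le (V t z - η t) (η t)
  have h3 : q ≤ q ^ 12 := le_self_pow₀ (by linarith) (by norm_num)
  have h4 := hz t ht
  unfold scaleThreshold at hq
  linarith

theorem norm_plasmaField_le_of_ball (h : IsLagrangian T δ D B M μ ξ η X V)
    (hE : EnergyBound T H μ ξ η X V) {t : ℝ} (ht : t ∈ Icc 0 T) {P κ : ℝ} (hP : 0 < P)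
    (hκ : 0 < κ) (hV : ∀ᵐ z ∂μ, ‖V t z‖ < P) (y : Space) :
    ‖plasmaField μ X t y‖ ≤ 8 * Real.pi ^ 2 * M * P ^ 2 * κ + 2 * H * (κ ^ 2)⁻¹ := by
  have hM := h.M_nonneg
  have hH := hE.nonneg
  refine (norm_plasmaField_le_integral y t).trans ?_
  rw [integral_eq_lintegral_of_nonneg_ae (ae_of_all _ fun z => by positivity)
    (h.integrable_inv_sq ht y).1]
  refine ENNReal.toReal_le_of_le_ofReal (by positivity) ?_
  refine le_trans (lintegral_mono_ae ?_) (h.lintegral_slow_le hE ht y 0 hP hκ)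
  filter_upwards [hV] with z hz
  rw [indicator_of_mem (show V t z ∈ Metric.ball 0 P by simpa using hz)]
  simp

/-- All speeds are of order `P = q^12`, and `κ = q^(-8)` is the balancing choice `P^(-2/3)`. -/
theorem norm_plasmaField_le_pow (h : IsLagrangian T δ D B M μ ξ η X V)
    (hE : EnergyBound T H μ ξ η X V) (hq : scaleThreshold M H ≤ q) (ha : 0 ≤ a) (hb : b ≤ T)
    (hc : ∀ᵐ z ∂μ, ∀ t ∈ Icc a b, ‖V t z - η t‖ ≤ 2 * q ^ 12) {t : ℝ} (ht : t ∈ Icc a b)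
    (y : Space) : ‖plasmaField μ X t y‖ ≤ fieldConst M H * q ^ 16 := by
  have hq0 : 0 < q := by linarith [ten_le_scaleThreshold h.M_nonneg hE.nonneg]
  have h1 : ∀ᵐ z ∂μ, ‖V t z‖ < 4 * q ^ 12 := by
    filter_upwards [h.ae_norm_V_lt hE hq ha hb hc] with z hz using hz t ht
  have h2 := h.norm_plasmaField_le_of_ball hE (Icc_subset_Icc ha hb ht)
    (show 0 < 4 * q ^ 12 by positivity) (show 0 < (q ^ 8)⁻¹ by positivity) h1 y
  refine h2.trans (le_of_eq ?_)
  unfold fieldConst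
  field_simp
  ring

/-- During a time `q^(-8)` the crude field bound gives an impulse of order `q^8`, and the charge
receives a bounded one. Above `scaleThreshold` their sum is a small fraction of `q^9`, the speed
from which particles count as fast. -/
theorem integral_field_add_le (h : IsLagrangian T δ D B M μ ξ η X V)
    (hE : EnergyBound T H μ ξ η X V) (hq : scaleThreshold M H ≤ q) (ha : 0 ≤ a)
    (hb : b ≤ T) (hba : b - a ≤ (q ^ 8)⁻¹)
    (hc : ∀ᵐ z ∂μ, ∀ t ∈ Icc a b, ‖V t z - η t‖ ≤ 2 * q ^ 12)
    {s : ℝ} (hs : s ∈ Icc a b) (y : ℝ → Space) :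
    (∫ t in a..s, ‖plasmaField μ X t (y t)‖) + ∫ t in a..s, ‖plasmaField μ X t (ξ t)‖
      ≤ q ^ 9 / 10 := by
  have h10 := ten_le_scaleThreshold h.M_nonneg hE.nonneg
  have hA := fieldConst_nonneg h.M_nonneg hE.nonneg
  have hC := one_le_chargeConst hE.nonneg
  have hq0 : 0 < q := by linarith
  have hq1 : 1 ≤ q ^ 8 := one_le_pow₀ (by linarith)
  have h1 : ∫ t in a..s, ‖plasmaField μ X t (y t)‖ ≤ fieldConst M H * q ^ 8 := by
    have := intervalIntegral.norm_integral_le_of_norm_le_const (a := a) (b := s)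
      (f := fun t => ‖plasmaField μ X t (y t)‖) (C := fieldConst M H * q ^ 16) (fun t ht => by
        rw [uIoc_of_le hs.1] at ht
        rw [norm_norm]
        exact h.norm_plasmaField_le_pow hE hq ha hb hc ⟨ht.1.le, ht.2.trans hs.2⟩ _)
    refine (le_abs_self _).trans (this.trans ?_)
    rw [abs_of_nonneg (sub_nonneg.2 hs.1)]
    calc _ ≤ fieldConst M H * q ^ 16 * (q ^ 8)⁻¹ := by gcongr; linarith [hs.2]
      _ = _ := by field_simp
  have h2 : ∫ t in a..s, ‖plasmaField μ X t (ξ t)‖ ≤ chargeConst H := by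
    refine (h.integral_norm_field_charge_le hE ha hs.1 (hs.2.trans hb)).trans ?_
    unfold chargeConst
    have : s - a ≤ 1 := by linarith [hs.2, inv_le_one_of_one_le₀ hq1]
    nlinarith [sq_nonneg H]
  unfold scaleThreshold at hq
  calc _ ≤ fieldConst M H * q ^ 8 + chargeConst H * q ^ 8 := by nlinarith
    _ = (fieldConst M H + chargeConst H) * q ^ 8 := by ring
    _ ≤ q / 10 * q ^ 8 := by gcongr; linarith
    _ = _ := by ring

/-- Few particles have a large energy. -/
theorem measure_fast_le (h : IsLagrangian T δ D B M μ ξ η X V)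
    (hE : EnergyBound T H μ ξ η X V) {t : ℝ} (ht : t ∈ Icc 0 T) {P : ℝ} (hP : 0 < P) :
    μ {z | P ^ 2 / 4 ≤ particleEnergy 1 (ξ t) (η t) (X t z, V t z)}
      ≤ ENNReal.ofReal (4 * (5 * H + 1) * (P ^ 2)⁻¹) := by
  have := h.prob
  have hH := hE.nonneg
  have hi1 := h.integrable_sq_norm ht
  have hi2 := h.integrable_inv_norm ht
  have hi3 : Integrable (fun z => ‖V t z‖ ^ 2 + ‖η t‖ ^ 2) μ := hi1.add (integrable_const _)
  have hi4 : Integrable (fun z => ‖V t z‖ ^ 2 + ‖η t‖ ^ 2 + 1) μ := hi3.add (integrable_const _)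
  have hintg : Integrable (fun z => (‖V t z‖ ^ 2 + ‖η t‖ ^ 2 + 1) + ‖X t z - ξ t‖⁻¹) μ :=
    hi4.add hi2
  -- The kinetic energy and the speed of the charge give `2H` each, the potential gives `H`, and the
  -- additive constant of the energy gives `1`.
  have hval : ∫ z, ((‖V t z‖ ^ 2 + ‖η t‖ ^ 2 + 1) + ‖X t z - ξ t‖⁻¹) ∂μ ≤ 5 * H + 1 := by
    rw [integral_add hi4 hi2, integral_add hi3 (integrable_const _),
      integral_add hi1 (integrable_const _)]
    simp only [integral_const, probReal_univ, one_smul]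
    linarith [hE.kinetic t ht, hE.charge t ht, hE.potential t ht]
  have hmarkov := mul_meas_ge_le_integral_of_nonneg (μ := μ)
    (ae_of_all _ fun z => (by positivity :
      (0 : ℝ) ≤ (‖V t z‖ ^ 2 + ‖η t‖ ^ 2 + 1) + ‖X t z - ξ t‖⁻¹)) hintg (P ^ 2 / 4)
  have hsub : {z | P ^ 2 / 4 ≤ particleEnergy 1 (ξ t) (η t) (X t z, V t z)}
      ⊆ {z | P ^ 2 / 4 ≤ (‖V t z‖ ^ 2 + ‖η t‖ ^ 2 + 1) + ‖X t z - ξ t‖⁻¹} := by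
    intro z hz
    refine le_trans (show P ^ 2 / 4 ≤ _ from hz) ?_
    unfold particleEnergy
    have h1 := norm_sub_le (V t z) (η t)
    have h2 : ‖V t z - η t‖ ^ 2 ≤ (‖V t z‖ + ‖η t‖) ^ 2 := by gcongr
    simp only [one_div]
    nlinarith [sq_nonneg (‖V t z‖ - ‖η t‖)]
  refine (measure_mono hsub).trans ?_
  rw [← ENNReal.ofReal_toReal (measure_ne_top μ _)]
  apply ENNReal.ofReal_le_ofReal
  rw [← div_eq_mul_inv, le_div_iff₀ (by positivity)]
  have h1 := hmarkov.trans hval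
  simp only [Measure.real] at h1
  linarith

/-- Being fast at any time of the interval is detected at its left endpoint, so one fixed set of
small measure contains all particles that are ever fast. The energy is taken with additive constant
`1`, to keep the measure bound independent of `K₁`. -/
theorem fast_of_le (h : IsLagrangian T δ D B M μ ξ η X V)
    (hE : EnergyBound T H μ ξ η X V) (hq : scaleThreshold M H ≤ q) (ha : 0 ≤ a)
    (hb : b ≤ T) (hba : b - a ≤ (q ^ 8)⁻¹)
    (hc : ∀ᵐ z ∂μ, ∀ t ∈ Icc a b, ‖V t z - η t‖ ≤ 2 * q ^ 12)
    (hx : IsTrajectory T δ ξ (plasmaField μ X) x v) {t : ℝ} (ht : t ∈ Icc a b)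
    (hv : q ^ 9 ≤ ‖v t‖) :
    (q ^ 9) ^ 2 / 4 ≤ particleEnergy 1 (ξ a) (η a) (x a, v a) := by
  have h10 := ten_le_scaleThreshold h.M_nonneg hE.nonneg
  have hA := fieldConst_nonneg h.M_nonneg hE.nonneg
  have hq0 : 0 < q := by linarith
  have hP : 0 < q ^ 9 := by positivity
  have h1 := h.sqrt_particleEnergy_le hx one_pos ha ht.1 (ht.2.trans hb)
  have h2 := h.integral_field_add_le hE hq ha hb hba hc ht x
  have h3 : ‖η t‖ ≤ q ^ 9 / 10 := by
    have := norm_η_le hE (Icc_subset_Icc ha hb ht)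
    have h4 : q ≤ q ^ 9 := le_self_pow₀ (by linarith) (by norm_num)
    unfold scaleThreshold at hq
    linarith
  have h4 : 9 / 10 * q ^ 9 ≤ ‖v t - η t‖ := by
    have := norm_sub_norm_le (v t) (η t)
    linarith
  have h5 : 6 / 10 * q ^ 9 ≤ √(particleEnergy 1 (ξ t) (η t) (x t, v t)) := by
    apply Real.le_sqrt_of_sq_le
    unfold particleEnergy
    have h6 : (9 / 10 * q ^ 9) ^ 2 ≤ ‖v t - η t‖ ^ 2 := by gcongr
    have h7 : 0 ≤ 1 / ‖x t - ξ t‖ := by positivity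
    simp only
    nlinarith [sq_nonneg (q ^ 9)]
  have h6 : q ^ 9 / 2 ≤ √(particleEnergy 1 (ξ a) (η a) (x a, v a)) := by linarith
  rw [Real.le_sqrt' (by positivity)] at h6
  linarith

theorem integral_inv_sq_le_of_scale (h : IsLagrangian T δ D B M μ ξ η X V)
    (hE : EnergyBound T H μ ξ η X V) (hq : scaleThreshold M H ≤ q) (ha : 0 ≤ a) (hab : a ≤ b)
    (hb : b ≤ T) (hba : b - a ≤ (q ^ 8)⁻¹)
    (hc : ∀ᵐ z ∂μ, ∀ t ∈ Icc a b, ‖V t z - η t‖ ≤ 2 * q ^ 12)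
    (hx : IsTrajectory T δ ξ (plasmaField μ X) x v)
    (hv : ∀ t ∈ Icc a b, ‖v t - η t‖ ≤ 2 * q ^ 12) :
    ∫ t in a..b, (‖x t - ξ t‖ ^ 2)⁻¹ ≤ 4 * q ^ 12 + q ^ 9 / 10 := by
  have h1 := h.integral_charge_force_le hx ha hab hb
  have h2 := h.integral_field_add_le hE hq ha hb hba hc ⟨hab, le_rfl⟩ x
  linarith [hv a ⟨le_rfl, hab⟩, hv b ⟨hab, le_rfl⟩]

/-- Where the relative speed is at least `q^9`, its square in the pair estimate can be divided out
at the price of `q^(-18)`. Boundary terms and forces amount to at most `19 q^12`, and the smoothing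
length `q^(-24)` costs `q^24`, whence `4 · 19 · q^(12+24-18)`. -/
theorem lintegral_pairKernel_le (h : IsLagrangian T δ D B M μ ξ η X V)
    (hE : EnergyBound T H μ ξ η X V) (hq : scaleThreshold M H ≤ q) (ha : 0 ≤ a) (hab : a ≤ b)
    (hb : b ≤ T) (hba : b - a ≤ (q ^ 8)⁻¹)
    (hc : ∀ᵐ z ∂μ, ∀ t ∈ Icc a b, ‖V t z - η t‖ ≤ 2 * q ^ 12)
    (hx : IsTrajectory T δ ξ (plasmaField μ X) x v)
    (hv : ∀ t ∈ Icc a b, ‖v t - η t‖ ≤ 2 * q ^ 12) {y w : ℝ → Space}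
    (hy : IsTrajectory T δ ξ (plasmaField μ X) y w)
    (hw : ∀ t ∈ Icc a b, ‖w t - η t‖ ≤ 2 * q ^ 12) :
    ∫⁻ t in Ioc a b, ENNReal.ofReal (4 * pairKernel (q ^ 24)⁻¹ (x t - y t))
        * (Ici (q ^ 9)).indicator 1 ‖v t - w t‖ ≤ ENNReal.ofReal (76 * q ^ 18) := by
  have h10 := ten_le_scaleThreshold h.M_nonneg hE.nonneg
  have hq0 : 0 < q := by linarith
  have hR : 0 < (q ^ 24)⁻¹ := by positivity
  have h9 : q ^ 9 ≤ q ^ 12 := pow_le_pow_right₀ (by linarith) (by norm_num)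
  have hsub : Icc a b ⊆ Icc 0 T := Icc_subset_Icc ha hb
  have hξ0 : 0 ≤ ∫ t in a..b, ‖plasmaField μ X t (ξ t)‖ :=
    intervalIntegral.integral_nonneg hab fun t _ => norm_nonneg _
  have hd : ∀ t ∈ Icc a b, ‖v t - w t‖ ≤ 4 * q ^ 12 := by
    intro t ht
    have := norm_sub_le (v t - η t) (w t - η t)
    rw [sub_sub_sub_cancel_right] at this
    linarith [hv t ht, hw t ht]
  have h1 := h.integral_pairKernel_le hx hy hR ha hab hb
  have h2 := h.integral_inv_sq_le_of_scale hE hq ha hab hb hba hc hx hv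
  have h3 := h.integral_inv_sq_le_of_scale hE hq ha hab hb hba hc hy hw
  have h4 := h.integral_field_add_le hE hq ha hb hba hc ⟨hab, le_rfl⟩ x
  have h5 := h.integral_field_add_le hE hq ha hb hba hc ⟨hab, le_rfl⟩ y
  have h6 : (q ^ 24)⁻¹ * ∫ t in a..b, ‖v t - w t‖ ^ 2 * pairKernel (q ^ 24)⁻¹ (x t - y t)
      ≤ 19 * q ^ 12 := by
    have : 0 ≤ q ^ 12 := by positivity
    linarith [hd a ⟨le_rfl, hab⟩, hd b ⟨hab, le_rfl⟩]
  rw [inv_mul_le_iff₀ (by positivity)] at h6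
  have hcont : ContinuousOn (fun t => 4 * ((q ^ 18)⁻¹
      * (‖v t - w t‖ ^ 2 * pairKernel (q ^ 24)⁻¹ (x t - y t)))) (Icc a b) := by
    refine ContinuousOn.mono ?_ hsub
    exact continuousOn_const.mul (continuousOn_const.mul
      (((hx.continuousOn_v.sub hy.continuousOn_v).norm.pow 2).mul
      ((continuous_pairKernel hR).comp_continuousOn (hx.continuousOn_x.sub hy.continuousOn_x))))
  have hpt : ∀ t, ENNReal.ofReal (4 * pairKernel (q ^ 24)⁻¹ (x t - y t))
        * (Ici (q ^ 9)).indicator 1 ‖v t - w t‖ ≤ ENNReal.ofReal (4 * ((q ^ 18)⁻¹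
      * (‖v t - w t‖ ^ 2 * pairKernel (q ^ 24)⁻¹ (x t - y t)))) := by
    intro t
    by_cases ht : q ^ 9 ≤ ‖v t - w t‖
    · rw [indicator_of_mem (show ‖v t - w t‖ ∈ Ici (q ^ 9) from ht), Pi.one_apply, mul_one]
      apply ENNReal.ofReal_le_ofReal
      have hk := pairKernel_nonneg hR (x t - y t)
      have h7 : 1 ≤ (q ^ 18)⁻¹ * ‖v t - w t‖ ^ 2 := by
        rw [le_inv_mul_iff₀ (by positivity), mul_one]
        calc q ^ 18 = (q ^ 9) ^ 2 := by ring
          _ ≤ _ := by gcongr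
      nlinarith
    · rw [indicator_of_notMem (show ‖v t - w t‖ ∉ Ici (q ^ 9) from ht), mul_zero]
      exact zero_le
  refine (lintegral_mono hpt).trans ?_
  rw [← ofReal_integral_eq_lintegral_ofReal
    ((hcont.integrableOn_Icc).mono_set Ioc_subset_Icc_self)
    (ae_of_all _ fun t => by have := pairKernel_nonneg hR (x t - y t); positivity),
    ← intervalIntegral.integral_of_le hab, intervalIntegral.integral_const_mul,
    intervalIntegral.integral_const_mul]
  apply ENNReal.ofReal_le_ofReal
  calc _ ≤ 4 * ((q ^ 18)⁻¹ * (q ^ 24 * (19 * q ^ 12))) := by gcongr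
    _ = _ := by field_simp; ring

end IsLagrangian

end PlasmaCharge
end

/-! ### The field of slow, close and fast particles together -/

noncomputable section

namespace PlasmaCharge

/-- The constant in the bound on the field along a trajectory. -/
def growthConst (M H : ℝ) : ℝ := 400 * Real.pi ^ 2 * M + 2000 * H + 400

theorem growthConst_pos {M H : ℝ} (hM : 0 ≤ M) (hH : 0 ≤ H) : 0 < growthConst M H := by
  unfold growthConst; positivity

namespace IsLagrangian

variable {T δ D B M H : ℝ} {μ : Measure Phase} {ξ η : ℝ → Space} {X V : ℝ → Phase → Space}
  {x v : ℝ → Space} {a b q : ℝ}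

theorem lintegral_add_add_add {f g k l : Phase → ℝ≥0∞} (hf : Measurable f) (hg : Measurable g)
    (hk : Measurable k) : ∫⁻ z, (f z + g z + k z + l z) ∂μ
      = (∫⁻ z, f z ∂μ) + (∫⁻ z, g z ∂μ) + (∫⁻ z, k z ∂μ) + ∫⁻ z, l z ∂μ := by
  rw [lintegral_add_left (by fun_prop), lintegral_add_left (by fun_prop), lintegral_add_left hf]

/-- A pair of particles is slow relative to the origin or to each other, or close, or fast. -/
theorem ofReal_inv_sq_le {y x' w v' : Space} {P Q R : ℝ} (hR : 0 < R) (hw : ‖w‖ < Q) {S : ℝ≥0∞}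
    (hS : P ≤ ‖w‖ → S = 1) :
    ENNReal.ofReal ((‖x' - y‖ ^ 2)⁻¹)
      ≤ ENNReal.ofReal ((‖x' - y‖ ^ 2)⁻¹) * (Metric.ball 0 P).indicator 1 w
        + ENNReal.ofReal ((‖x' - y‖ ^ 2)⁻¹) * (Metric.ball v' P).indicator 1 w
        + ENNReal.ofReal ((Iio R).indicator (fun r => (r ^ 2)⁻¹) ‖x' - y‖)
          * (Metric.ball 0 Q).indicator 1 w
        + S * (ENNReal.ofReal (4 * pairKernel R (x' - y))
          * (Ici P).indicator 1 ‖v' - w‖) := by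
  by_cases h1 : ‖w‖ < P
  · rw [indicator_of_mem (show w ∈ Metric.ball 0 P by simpa using h1), Pi.one_apply, mul_one,
      add_assoc, add_assoc]
    exact le_self_add
  by_cases h2 : ‖v' - w‖ < P
  · rw [indicator_of_mem (show w ∈ Metric.ball v' P by
      rwa [Metric.mem_ball, dist_comm, dist_eq_norm]), Pi.one_apply, mul_one]
    exact le_add_self.trans (le_self_add.trans le_self_add)
  by_cases h3 : ‖x' - y‖ < R
  · rw [indicator_of_mem (show w ∈ Metric.ball 0 Q by simpa using hw),
      indicator_of_mem (show ‖x' - y‖ ∈ Iio R from h3)]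
    simp only [Pi.one_apply, mul_one]
    exact le_add_self.trans le_self_add
  · rw [hS (not_lt.1 h1), indicator_of_mem (show ‖v' - w‖ ∈ Ici P from not_lt.1 h2)]
    simp only [Pi.one_apply, mul_one, one_mul]
    exact (ENNReal.ofReal_le_ofReal (inv_sq_le_pairKernel hR (not_lt.1 h3))).trans le_add_self

theorem aemeasurable_pairKernel (h : IsLagrangian T δ D B M μ ξ η X V)
    (hx : IsTrajectory T δ ξ (plasmaField μ X) x v) {R P : ℝ} (hR : 0 < R) {F : Set Phase}
    (hF : MeasurableSet F) (ha : 0 ≤ a) (hb : b ≤ T) :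
    AEMeasurable (Function.uncurry fun t z => F.indicator (1 : Phase → ℝ≥0∞) z
      * (ENNReal.ofReal (4 * pairKernel R (x t - X t z)) * (Ici P).indicator 1 ‖v t - V t z‖))
      ((volume.restrict (Ioc a b)).prod μ) := by
  have := h.prob
  have h1 := aemeasurable_fst (P := μ) hx.continuousOn_x ha hb
  have h2 := aemeasurable_fst (P := μ) hx.continuousOn_v ha hb
  have hX : Measurable fun p : ℝ × Phase => X p.1 p.2 := h.measurable_X
  have hV : Measurable fun p : ℝ × Phase => V p.1 p.2 := h.measurable_V
  have h3 : AEMeasurable (fun p : ℝ × Phase => F.indicator (1 : Phase → ℝ≥0∞) p.2)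
      ((volume.restrict (Ioc a b)).prod μ) :=
    ((measurable_one.indicator hF).comp measurable_snd).aemeasurable
  have h4 : AEMeasurable (fun p : ℝ × Phase =>
      ENNReal.ofReal (4 * pairKernel R (x p.1 - X p.1 p.2)))
      ((volume.restrict (Ioc a b)).prod μ) :=
    (((continuous_pairKernel hR).measurable.comp_aemeasurable
      (h1.sub hX.aemeasurable)).const_mul 4).ennreal_ofReal
  have h5 : AEMeasurable (fun p : ℝ × Phase =>
      (Ici P).indicator (1 : ℝ → ℝ≥0∞) ‖v p.1 - V p.1 p.2‖)
      ((volume.restrict (Ioc a b)).prod μ) :=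
    (measurable_one.indicator measurableSet_Ici).comp_aemeasurable (h2.sub hV.aemeasurable).norm
  exact h3.mul (h4.mul h5)

/-- The bound on the field along a trajectory during a short interval of time. -/
theorem integral_field_le_of_short (h : IsLagrangian T δ D B M μ ξ η X V)
    (hE : EnergyBound T H μ ξ η X V) (hq : scaleThreshold M H ≤ q) (ha : 0 ≤ a) (hab : a ≤ b)
    (hb : b ≤ T) (hba : b - a ≤ (q ^ 8)⁻¹)
    (hc : ∀ᵐ z ∂μ, ∀ t ∈ Icc a b, ‖V t z - η t‖ ≤ 2 * q ^ 12)
    (hx : IsTrajectory T δ ξ (plasmaField μ X) x v)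
    (hv : ∀ t ∈ Icc a b, ‖v t - η t‖ ≤ 2 * q ^ 12) :
    ∫ t in a..b, ‖plasmaField μ X t (x t)‖
      ≤ (400 * Real.pi ^ 2 * M + 4 * H) * q ^ 12 * (b - a) + 304 * (5 * H + 1) := by
  have := h.prob
  have hM := h.M_nonneg
  have hH := hE.nonneg
  have h10 := ten_le_scaleThreshold hM hH
  have hq0 : 0 < q := by linarith
  have hR : 0 < (q ^ 24)⁻¹ := by positivity
  have hsub : Icc a b ⊆ Icc 0 T := Icc_subset_Icc ha hb
  have hP : 0 < q ^ 9 := by positivity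
  -- The balancing choice `P^(-2/3)` for `P = q^9`; it makes the field of the slow particles of
  -- order `q^12`.
  have hκ : 0 < (q ^ 6)⁻¹ := by positivity
  set F : Set Phase := {z | (q ^ 9) ^ 2 / 4 ≤ particleEnergy 1 (ξ a) (η a) (X a z, V a z)} with hF
  have hXa := h.measurable_X_apply a
  have hVa := h.measurable_V_apply a
  have hFm : MeasurableSet F := by
    refine measurableSet_le measurable_const ?_
    unfold particleEnergy
    fun_prop
  have hFμ : μ F ≤ ENNReal.ofReal (4 * (5 * H + 1) * ((q ^ 9) ^ 2)⁻¹) :=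
    h.measure_fast_le hE (hsub ⟨le_rfl, hab⟩) hP
  have hc' := h.ae_norm_V_lt hE hq ha hb hc
  set G : ℝ → Phase → ℝ≥0∞ := fun t z => F.indicator (1 : Phase → ℝ≥0∞) z
      * (ENNReal.ofReal (4 * pairKernel (q ^ 24)⁻¹ (x t - X t z))
        * (Ici (q ^ 9)).indicator 1 ‖v t - V t z‖) with hG
  have hGm : AEMeasurable (Function.uncurry G) ((volume.restrict (Ioc a b)).prod μ) :=
    h.aemeasurable_pairKernel hx hR hFm ha hb
  -- Integrating first in time, each particle of `F` contributes at most `76 q^18`, and `F` has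
  -- measure at most `4(5H + 1) q^(-18)`: the powers of `q` cancel.
  have hfast : ∫⁻ t in Ioc a b, ∫⁻ z, G t z ∂μ ≤ ENNReal.ofReal (304 * (5 * H + 1)) := by
    rw [lintegral_lintegral_swap hGm]
    calc ∫⁻ z, (∫⁻ t in Ioc a b, G t z) ∂μ
        ≤ ∫⁻ z, F.indicator (fun _ => ENNReal.ofReal (76 * q ^ 18)) z ∂μ := by
          refine lintegral_mono_ae ?_
          filter_upwards [hc, h.trajectory] with z hz hzt
          by_cases hzF : z ∈ F
          · simp only [hG, indicator_of_mem hzF, Pi.one_apply, one_mul]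
            exact h.lintegral_pairKernel_le hE hq ha hab hb hba hc hx hv hzt hz
          · simp [hG, indicator_of_notMem hzF]
      _ = ENNReal.ofReal (76 * q ^ 18) * μ F := lintegral_indicator_const hFm _
      _ ≤ ENNReal.ofReal (76 * q ^ 18)
          * ENNReal.ofReal (4 * (5 * H + 1) * ((q ^ 9) ^ 2)⁻¹) := by gcongr
      _ = _ := by
          rw [← ENNReal.ofReal_mul (by positivity)]
          congr 1
          field_simp
          norm_num
  -- At each time the two slow groups and the close one are bounded pointwise by order `q^12`; only
  -- the fast group is left for the time integral.
  have hpt : ∀ t ∈ Ioc a b, ENNReal.ofReal ‖plasmaField μ X t (x t)‖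
      ≤ ENNReal.ofReal ((400 * Real.pi ^ 2 * M + 4 * H) * q ^ 12) + ∫⁻ z, G t z ∂μ := by
    intro t ht'
    have ht : t ∈ Icc a b := Ioc_subset_Icc_self ht'
    have htT := hsub ht
    have hXt := h.measurable_X_apply t
    have hVt := h.measurable_V_apply t
    have hm : Measurable fun z => (X t z, V t z) := hXt.prodMk hVt
    have hball : ∀ (c : Space) (P : ℝ), Measurable fun z =>
        (Metric.ball c P).indicator (1 : Space → ℝ≥0∞) (V t z) := fun c P =>
      (measurable_indicator_ball c P).comp hVt
    have hinv : Measurable fun z => ENNReal.ofReal ((‖x t - X t z‖ ^ 2)⁻¹) := by fun_prop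
    have hnear : Measurable fun z => ENNReal.ofReal
        ((Iio (q ^ 24)⁻¹).indicator (fun r => (r ^ 2)⁻¹) ‖x t - X t z‖) :=
      (measurable_indicator_inv_pow measurableSet_Iio 2 (x t)).comp hXt
    calc ENNReal.ofReal ‖plasmaField μ X t (x t)‖
        ≤ ENNReal.ofReal (∫ z, (‖x t - X t z‖ ^ 2)⁻¹ ∂μ) :=
          ENNReal.ofReal_le_ofReal (norm_plasmaField_le_integral _ _)
      _ = ∫⁻ z, ENNReal.ofReal ((‖x t - X t z‖ ^ 2)⁻¹) ∂μ :=
          ofReal_integral_eq_lintegral_ofReal (h.integrable_inv_sq htT _)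
            (ae_of_all _ fun z => by positivity)
      _ ≤ ∫⁻ z, (ENNReal.ofReal ((‖x t - X t z‖ ^ 2)⁻¹)
              * (Metric.ball 0 (q ^ 9)).indicator 1 (V t z)
            + ENNReal.ofReal ((‖x t - X t z‖ ^ 2)⁻¹)
              * (Metric.ball (v t) (q ^ 9)).indicator 1 (V t z)
            + ENNReal.ofReal ((Iio (q ^ 24)⁻¹).indicator (fun r => (r ^ 2)⁻¹) ‖x t - X t z‖)
              * (Metric.ball 0 (4 * q ^ 12)).indicator 1 (V t z) + G t z) ∂μ := by
          refine lintegral_mono_ae ?_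
          filter_upwards [hc', h.trajectory] with z hz hzt
          have hS : q ^ 9 ≤ ‖V t z‖ → F.indicator (1 : Phase → ℝ≥0∞) z = 1 := fun hfast => by
            have hzF : z ∈ F := by
              have := h.fast_of_le hE hq ha hb hba hc (x := fun t => X t z)
                (v := fun t => V t z) hzt ht hfast
              simpa only [hF, mem_ofPred_eq] using this
            rw [indicator_of_mem hzF, Pi.one_apply]
          simp only [hG]
          exact ofReal_inv_sq_le hR (hz t ht) hS
      _ ≤ ENNReal.ofReal (8 * Real.pi ^ 2 * M * (q ^ 9) ^ 2 * (q ^ 6)⁻¹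
              + 2 * H * (((q ^ 6)⁻¹) ^ 2)⁻¹)
          + ENNReal.ofReal (8 * Real.pi ^ 2 * M * (q ^ 9) ^ 2 * (q ^ 6)⁻¹
              + 2 * H * (((q ^ 6)⁻¹) ^ 2)⁻¹)
          + ENNReal.ofReal
            (M * (4 * Real.pi * (q ^ 24)⁻¹ * (4 / 3 * Real.pi * (4 * q ^ 12) ^ 3)))
          + ∫⁻ z, G t z ∂μ := by
          have m1 : ∀ c, Measurable fun z => ENNReal.ofReal ((‖x t - X t z‖ ^ 2)⁻¹)
              * (Metric.ball c (q ^ 9)).indicator 1 (V t z) := fun c =>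
            hinv.mul (hball c (q ^ 9))
          have m2 : Measurable fun z => ENNReal.ofReal
              ((Iio (q ^ 24)⁻¹).indicator (fun r => (r ^ 2)⁻¹) ‖x t - X t z‖)
              * (Metric.ball 0 (4 * q ^ 12)).indicator 1 (V t z) :=
            hnear.mul (hball 0 (4 * q ^ 12))
          rw [lintegral_add_add_add (m1 0) (m1 (v t)) m2]
          gcongr
          · exact h.lintegral_slow_le hE htT (x t) 0 hP hκ
          · exact h.lintegral_slow_le hE htT (x t) (v t) hP hκ
          · exact h.lintegral_near_le htT (x t) 0 (by positivity) hR.le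
      _ ≤ _ := by
          gcongr
          rw [← ENNReal.ofReal_add (by positivity) (by positivity),
            ← ENNReal.ofReal_add (by positivity) (by positivity)]
          apply ENNReal.ofReal_le_ofReal
          have e1 : 8 * Real.pi ^ 2 * M * (q ^ 9) ^ 2 * (q ^ 6)⁻¹ + 2 * H * (((q ^ 6)⁻¹) ^ 2)⁻¹
              = (8 * (Real.pi ^ 2 * M) + 2 * H) * q ^ 12 := by
            field_simp
          -- The closeness radius `q^(-24)` compensates the volume of order `(q^12)³` of all
          -- velocities, leaving `q^12`.
          have e2 : M * (4 * Real.pi * (q ^ 24)⁻¹ * (4 / 3 * Real.pi * (4 * q ^ 12) ^ 3))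
              = 1024 / 3 * (Real.pi ^ 2 * M) * q ^ 12 := by
            field_simp
            ring
          rw [e1, e2]
          have : 0 ≤ Real.pi ^ 2 * M * q ^ 12 := by positivity
          nlinarith
  rw [intervalIntegral.integral_of_le hab, integral_eq_lintegral_of_nonneg_ae
    (ae_of_all _ fun t => norm_nonneg _)
    (h.intervalIntegrable_norm_field hx.continuousOn_x ha hab hb).1.aestronglyMeasurable]
  have hba0 : 0 ≤ b - a := sub_nonneg.2 hab
  refine ENNReal.toReal_le_of_le_ofReal (by positivity) ?_
  calc ∫⁻ t in Ioc a b, ENNReal.ofReal ‖plasmaField μ X t (x t)‖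
      ≤ ∫⁻ t in Ioc a b, (ENNReal.ofReal ((400 * Real.pi ^ 2 * M + 4 * H) * q ^ 12)
          + ∫⁻ z, G t z ∂μ) := setLIntegral_mono' measurableSet_Ioc hpt
    _ ≤ ENNReal.ofReal ((400 * Real.pi ^ 2 * M + 4 * H) * q ^ 12) * ENNReal.ofReal (b - a)
          + ENNReal.ofReal (304 * (5 * H + 1)) := by
        rw [lintegral_add_left measurable_const, lintegral_const, Measure.restrict_apply_univ,
          Real.volume_Ioc]
        gcongr
    _ = _ := by
        rw [← ENNReal.ofReal_mul (by positivity), ← ENNReal.ofReal_add (by positivity)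
          (by positivity)]

end IsLagrangian

end PlasmaCharge
end

noncomputable section

namespace PlasmaCharge

/-! ### Growth of the particle energies -/

namespace IsLagrangian

variable {T δ D B M H : ℝ} {μ : Measure Phase} {ξ η : ℝ → Space} {X V : ℝ → Phase → Space}
  {x v : ℝ → Space} {a b q : ℝ}

/-- The last piece of length at most `q^(-8)` is split off each time. Each piece starts its own
count of fast particles and so adds its own constant. -/
theorem integral_field_le_of_subintervals (h : IsLagrangian T δ D B M μ ξ η X V)
    (hE : EnergyBound T H μ ξ η X V) (hq : scaleThreshold M H ≤ q) (ha : 0 ≤ a) (hab : a ≤ b)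
    (hb : b ≤ T) (n : ℕ) (hba : b - a ≤ n * (q ^ 8)⁻¹)
    (hc : ∀ᵐ z ∂μ, ∀ t ∈ Icc a b, ‖V t z - η t‖ ≤ 2 * q ^ 12)
    (hx : IsTrajectory T δ ξ (plasmaField μ X) x v)
    (hv : ∀ t ∈ Icc a b, ‖v t - η t‖ ≤ 2 * q ^ 12) :
    ∫ t in a..b, ‖plasmaField μ X t (x t)‖
      ≤ (400 * Real.pi ^ 2 * M + 4 * H) * q ^ 12 * (b - a) + n * (304 * (5 * H + 1)) := by
  have hM := h.M_nonneg
  have hH := hE.nonneg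
  have hq0 : 0 < q := by linarith [ten_le_scaleThreshold hM hH]
  induction n generalizing b with
  | zero =>
    have : b = a := by
      rw [Nat.cast_zero, zero_mul] at hba
      linarith
    simp [this]
  | succ n ih =>
    set m := max a (b - (q ^ 8)⁻¹) with hm
    have hqi : 0 < (q ^ 8)⁻¹ := by positivity
    have ham : a ≤ m := le_max_left _ _
    have hmb : m ≤ b := max_le hab (by linarith)
    have hma : m - a ≤ n * (q ^ 8)⁻¹ := by
      rw [sub_le_iff_le_add]
      refine max_le (by have : 0 ≤ n * (q ^ 8)⁻¹ := by positivity
                        linarith) ?_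
      push_cast at hba
      linarith
    have hbm : b - m ≤ (q ^ 8)⁻¹ := by linarith [le_max_right a (b - (q ^ 8)⁻¹)]
    have s1 : Icc a m ⊆ Icc a b := Icc_subset_Icc_right hmb
    have s2 : Icc m b ⊆ Icc a b := Icc_subset_Icc_left ham
    have h1 := ih ham (hmb.trans hb) hma (hc.mono fun z hz t ht => hz t (s1 ht))
      fun t ht => hv t (s1 ht)
    have h2 := h.integral_field_le_of_short hE hq (ha.trans ham) hmb hb hbm
      (hc.mono fun z hz t ht => hz t (s2 ht)) hx fun t ht => hv t (s2 ht)
    rw [← intervalIntegral.integral_add_adjacent_intervals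
      (h.intervalIntegrable_norm_field hx.continuousOn_x ha ham (hmb.trans hb))
      (h.intervalIntegrable_norm_field hx.continuousOn_x (ha.trans ham) hmb hb)]
    push_cast
    linarith

/-- The bound on the field along a trajectory. -/
theorem integral_field_le (h : IsLagrangian T δ D B M μ ξ η X V)
    (hE : EnergyBound T H μ ξ η X V) (hq : scaleThreshold M H ≤ q) (ha : 0 ≤ a) (hab : a ≤ b)
    (hb : b ≤ T) (hc : ∀ᵐ z ∂μ, ∀ t ∈ Icc a b, ‖V t z - η t‖ ≤ 2 * q ^ 12)
    (hx : IsTrajectory T δ ξ (plasmaField μ X) x v)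
    (hv : ∀ t ∈ Icc a b, ‖v t - η t‖ ≤ 2 * q ^ 12) :
    ∫ t in a..b, ‖plasmaField μ X t (x t)‖ ≤ growthConst M H * (q ^ 12 * (b - a) + 1) := by
  have hM := h.M_nonneg
  have hH := hE.nonneg
  have h10 := ten_le_scaleThreshold hM hH
  have hq0 : 0 < q := by linarith
  have hba : 0 ≤ b - a := sub_nonneg.2 hab
  have h1 := h.integral_field_le_of_subintervals hE hq ha hab hb ⌈(b - a) * q ^ 8⌉₊ (by
    rw [← div_eq_mul_inv, le_div_iff₀ (by positivity)]
    exact Nat.le_ceil _) hc hx hv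
  -- The number of pieces is of order `q^8`, below the admissible `q^12`, so the constants of the
  -- pieces are affordable.
  have h2 : (⌈(b - a) * q ^ 8⌉₊ : ℝ) ≤ q ^ 12 * (b - a) + 1 := by
    refine (Nat.ceil_lt_add_one (by positivity)).le.trans ?_
    have : q ^ 8 ≤ q ^ 12 := pow_le_pow_right₀ (by linarith) (by norm_num)
    nlinarith
  refine h1.trans ?_
  have h3 : 0 ≤ q ^ 12 * (b - a) := by positivity
  have h4 : (⌈(b - a) * q ^ 8⌉₊ : ℝ) * (304 * (5 * H + 1))
      ≤ (q ^ 12 * (b - a) + 1) * (304 * (5 * H + 1)) := by gcongr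
  have h5 : 0 ≤ Real.pi ^ 2 * M := by positivity
  unfold growthConst
  nlinarith [mul_nonneg hH h3]

end IsLagrangian

/-- The additive constant in the growth of the energies during the time `1 / (2 growthConst)`. -/
def stepConst (M H : ℝ) : ℝ :=
  2 * (growthConst M H + chargeConst H) + scaleThreshold M H ^ 12

theorem stepConst_pos {M H : ℝ} (hM : 0 ≤ M) (hH : 0 ≤ H) : 0 < stepConst M H := by
  have h1 := growthConst_pos hM hH
  have h2 := one_le_chargeConst hH
  have h3 := ten_le_scaleThreshold hM hH
  unfold stepConst
  positivity

theorem norm_sub_le_of_sqrt_particleEnergy_le {K Q : ℝ} (hK : 0 ≤ K) {ξ η : Space} {z : Phase}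
    (hz : √(particleEnergy K ξ η z) ≤ Q) : ‖z.2 - η‖ ≤ 2 * Q := by
  have hQ : 0 ≤ Q := (Real.sqrt_nonneg _).trans hz
  have h1 := (Real.sqrt_le_left hQ).1 hz
  refine (sq_le_sq₀ (norm_nonneg _) (by positivity)).1 ?_
  unfold particleEnergy at h1
  have h2 : 0 ≤ 1 / ‖z.1 - ξ‖ := by positivity
  nlinarith [sq_nonneg ‖z.2 - η‖]

/-! ### Doubling in a fixed time and iteration -/

namespace IsLagrangian

variable {T δ D B M H : ℝ} {μ : Measure Phase} {ξ η : ℝ → Space} {X V : ℝ → Phase → Space}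
  {S : Set Phase} {ψ : ℝ → Phase → Phase} {K L Y a b : ℝ}

/-- During a time `1 / (2 growthConst)` the energies at most double, up to a constant. -/
theorem sqrt_particleEnergy_le_two_mul_add (h : IsLagrangian T δ D B M μ ξ η X V)
    (hE : EnergyBound T H μ ξ η X V) (hK : 0 < K)
    (hS : ∀ z ∈ S, IsTrajectory T δ ξ (plasmaField μ X) (fun t => (ψ t z).1) fun t => (ψ t z).2)
    (hae : ∀ᵐ z ∂μ, z ∈ S ∧ ∀ t ∈ Icc 0 T, X t z = (ψ t z).1 ∧ V t z = (ψ t z).2)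
    (hL : ∀ z ∈ S, ∀ t ∈ Icc 0 T, √(particleEnergy K (ξ t) (η t) (ψ t z)) ≤ L)
    (ha : 0 ≤ a) (hb : b ≤ T) (hba : b - a ≤ (2 * growthConst M H)⁻¹)
    (hY : ∀ z ∈ S, ∀ t ∈ Icc 0 a, √(particleEnergy K (ξ t) (η t) (ψ t z)) ≤ Y) :
    ∀ z ∈ S, ∀ t ∈ Icc 0 b,
      √(particleEnergy K (ξ t) (η t) (ψ t z)) ≤ 2 * Y + stepConst M H := by
  intro z₀ hz₀ t₀ ht₀
  have hM := h.M_nonneg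
  have hH := hE.nonneg
  have hG := growthConst_pos hM hH
  have hC := one_le_chargeConst hH
  have h10 := ten_le_scaleThreshold hM hH
  have hY0 : 0 ≤ Y := (Real.sqrt_nonneg _).trans (hY z₀ hz₀ 0 ⟨le_rfl, ha⟩)
  -- The bound is run on the supremum over all particles and times up to `b`, since the field
  -- depends on all of them. It is finite by the qualitative bound `L`, which does not enter the
  -- result.
  set A := sSup {r | ∃ t ∈ Icc 0 b, ∃ z ∈ S, r = √(particleEnergy K (ξ t) (η t) (ψ t z))}
  have hbdd : BddAbove {r | ∃ t ∈ Icc 0 b, ∃ z ∈ S,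
      r = √(particleEnergy K (ξ t) (η t) (ψ t z))} := by
    refine ⟨L, ?_⟩
    rintro r ⟨t, ht, z, hz, rfl⟩
    exact hL z hz t ⟨ht.1, ht.2.trans hb⟩
  have hA : ∀ z ∈ S, ∀ t ∈ Icc 0 b, √(particleEnergy K (ξ t) (η t) (ψ t z)) ≤ A :=
    fun z hz t ht => le_csSup hbdd ⟨t, ht, z, hz, rfl⟩
  set Q := max A (scaleThreshold M H ^ 12)
  have hQ0 : 0 < Q := lt_max_of_lt_right (by positivity)
  -- The twelfth root turns all scales (`Q^(3/4)`, `Q^(2/3)`, `Q²`) into integral powers. The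
  -- maximum with the threshold ensures that `q` is large enough.
  set q := Q ^ (1 / 12 : ℝ)
  have hqQ : q ^ 12 = Q := by
    rw [← Real.rpow_natCast, ← Real.rpow_mul hQ0.le]
    norm_num
  have hq : scaleThreshold M H ≤ q := by
    refine (pow_le_pow_iff_left₀ (by linarith) (by positivity) (n := 12) (by norm_num)).1 ?_
    rw [hqQ]
    exact le_max_right _ _
  have hspeed : ∀ z ∈ S, ∀ t ∈ Icc a b, ‖(ψ t z).2 - η t‖ ≤ 2 * q ^ 12 := by
    intro z hz t ht
    rw [hqQ]
    exact norm_sub_le_of_sqrt_particleEnergy_le hK.le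
      ((hA z hz t ⟨ha.trans ht.1, ht.2⟩).trans (le_max_left _ _))
  have hc : ∀ᵐ z ∂μ, ∀ t ∈ Icc a b, ‖V t z - η t‖ ≤ 2 * q ^ 12 := by
    filter_upwards [hae] with z hz t ht
    rw [(hz.2 t ⟨ha.trans ht.1, ht.2.trans hb⟩).2]
    exact hspeed z hz.1 t ht
  have hone : (2 * growthConst M H)⁻¹ ≤ 1 := by
    refine inv_le_one_of_one_le₀ ?_
    unfold growthConst
    have : 0 ≤ Real.pi ^ 2 * M := by positivity
    nlinarith
  have key : ∀ z ∈ S, ∀ t ∈ Icc 0 b, √(particleEnergy K (ξ t) (η t) (ψ t z))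
      ≤ Y + (Q / 2 + growthConst M H + chargeConst H) := by
    intro z hz t ht
    rcases le_total t a with hta | hat
    · refine (hY z hz t ⟨ht.1, hta⟩).trans ?_
      have : 0 ≤ Q / 2 + growthConst M H + chargeConst H := by positivity
      linarith
    · have hsub : Icc a t ⊆ Icc a b := Icc_subset_Icc_right ht.2
      have h1 := h.sqrt_particleEnergy_le (hS z hz) hK ha hat (ht.2.trans hb)
      have h2 := h.integral_field_le hE hq ha hat (ht.2.trans hb)
        (hc.mono fun z hz t ht => hz t (hsub ht)) (hS z hz)
        fun t ht => hspeed z hz t (hsub ht)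
      have h3 := h.integral_norm_field_charge_le hE ha hat (ht.2.trans hb)
      have h4 := hY z hz a ⟨ha, le_rfl⟩
      have h5 : (t - a) * (H ^ 2 / 2) ≤ 1 * (H ^ 2 / 2) := by
        gcongr
        linarith [ht.2]
      have h6 : growthConst M H * (q ^ 12 * (t - a) + 1) ≤ Q / 2 + growthConst M H := by
        rw [hqQ]
        have : growthConst M H * (t - a) ≤ 1 / 2 := by
          calc _ ≤ growthConst M H * (2 * growthConst M H)⁻¹ := by
                gcongr
                linarith [ht.2]
            _ = _ := by field_simp
        nlinarith
      unfold chargeConst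
      linarith
  -- The time step was chosen so that the field costs only `Q/2`. If `Q = A` this half is absorbed
  -- on the left, which doubles `Y`; otherwise `A` is below the threshold.
  have hAle : A ≤ Y + (Q / 2 + growthConst M H + chargeConst H) := by
    refine csSup_le ⟨_, t₀, ht₀, z₀, hz₀, rfl⟩ ?_
    rintro r ⟨t, ht, z, hz, rfl⟩
    exact key z hz t ht
  refine (hA z₀ hz₀ t₀ ht₀).trans ?_
  have h12 : 0 ≤ scaleThreshold M H ^ 12 := by positivity
  unfold stepConst
  rcases le_total A (scaleThreshold M H ^ 12) with hAQ | hAQ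
  · linarith
  · have : Q = A := max_eq_left hAQ
    rw [this] at hAle
    linarith

/-- Iterating `Y ↦ 2Y + c` doubles `Y + c` at every step. The minimum with `T` lets the last step be
incomplete. -/
theorem sqrt_particleEnergy_le_pow (h : IsLagrangian T δ D B M μ ξ η X V)
    (hE : EnergyBound T H μ ξ η X V) (hK : 0 < K) (hT : 0 ≤ T)
    (hS : ∀ z ∈ S, IsTrajectory T δ ξ (plasmaField μ X) (fun t => (ψ t z).1) fun t => (ψ t z).2)
    (hae : ∀ᵐ z ∂μ, z ∈ S ∧ ∀ t ∈ Icc 0 T, X t z = (ψ t z).1 ∧ V t z = (ψ t z).2)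
    (hL : ∀ z ∈ S, ∀ t ∈ Icc 0 T, √(particleEnergy K (ξ t) (η t) (ψ t z)) ≤ L)
    (hY : ∀ z ∈ S, √(particleEnergy K (ξ 0) (η 0) (ψ 0 z)) ≤ Y) (n : ℕ) :
    ∀ z ∈ S, ∀ t ∈ Icc 0 (min T (n * (2 * growthConst M H)⁻¹)),
      √(particleEnergy K (ξ t) (η t) (ψ t z)) ≤ 2 ^ n * (Y + stepConst M H) - stepConst M H := by
  have hG := growthConst_pos h.M_nonneg hE.nonneg
  have hl : 0 < (2 * growthConst M H)⁻¹ := by positivity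
  induction n with
  | zero =>
    intro z hz t ht
    rw [Nat.cast_zero, zero_mul, min_eq_right hT] at ht
    have : t = 0 := le_antisymm ht.2 ht.1
    simpa [this] using hY z hz
  | succ n ih =>
    intro z hz t ht
    have h0 : 0 ≤ min T (n * (2 * growthConst M H)⁻¹) := le_min hT (by positivity)
    have := h.sqrt_particleEnergy_le_two_mul_add hE hK hS hae hL h0 (min_le_left T _) (by
        rw [sub_le_iff_le_add, ← min_add_add_left]
        refine min_le_min (by linarith) ?_
        push_cast; linarith) ih z hz t ht
    rw [pow_succ]
    linarith

end IsLagrangian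

/-- The constant in the growth of the support. -/
def supportConst (M H : ℝ) : ℝ := stepConst |M| |H| + 2 * growthConst |M| |H|

theorem supportConst_pos (M H : ℝ) : 0 < supportConst M H := by
  have h1 := stepConst_pos (abs_nonneg M) (abs_nonneg H)
  have h2 := growthConst_pos (abs_nonneg M) (abs_nonneg H)
  unfold supportConst
  positivity

theorem IsLagrangian.sqrt_particleEnergy_le_exp {T δ D B M H : ℝ} {μ : Measure Phase}
    {ξ η : ℝ → Space} {X V : ℝ → Phase → Space} {S : Set Phase} {ψ : ℝ → Phase → Phase}
    {K L Y : ℝ} (h : IsLagrangian T δ D B M μ ξ η X V)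
    (hE : EnergyBound T H μ ξ η X V) (hK : 0 < K) (hT : 0 ≤ T)
    (hS : ∀ z ∈ S, IsTrajectory T δ ξ (plasmaField μ X) (fun t => (ψ t z).1) fun t => (ψ t z).2)
    (hae : ∀ᵐ z ∂μ, z ∈ S ∧ ∀ t ∈ Icc 0 T, X t z = (ψ t z).1 ∧ V t z = (ψ t z).2)
    (hL : ∀ z ∈ S, ∀ t ∈ Icc 0 T, √(particleEnergy K (ξ t) (η t) (ψ t z)) ≤ L)
    (hY : ∀ z ∈ S, √(particleEnergy K (ξ 0) (η 0) (ψ 0 z)) ≤ Y) :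
    ∀ z ∈ S, ∀ t ∈ Icc 0 T, √(particleEnergy K (ξ t) (η t) (ψ t z))
      ≤ (Y + supportConst M H) * Real.exp (supportConst M H * (1 + T)) := by
  intro z hz t ht
  have hM := h.M_nonneg
  have hH := hE.nonneg
  have hG := growthConst_pos hM hH
  have hW := stepConst_pos hM hH
  have hG1 : 1 ≤ growthConst M H := by
    unfold growthConst
    have : 0 ≤ Real.pi ^ 2 * M := by positivity
    nlinarith
  have hY0 : 0 ≤ Y := (Real.sqrt_nonneg _).trans (hY z hz)
  -- The absolute values in `supportConst` make it positive for all real arguments; here both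
  -- arguments are nonnegative.
  have hC : supportConst M H = stepConst M H + 2 * growthConst M H := by
    rw [supportConst, abs_of_nonneg hM, abs_of_nonneg hH]
  set n := ⌈T * (2 * growthConst M H)⌉₊
  have hn : T ≤ n * (2 * growthConst M H)⁻¹ := by
    rw [← div_eq_mul_inv, le_div_iff₀ (by positivity)]
    exact Nat.le_ceil _
  have hn1 : (n : ℝ) ≤ T * (2 * growthConst M H) + 1 :=
    (Nat.ceil_lt_add_one (by positivity)).le
  have h1 := h.sqrt_particleEnergy_le_pow hE hK hT hS hae hL hY n z hz t (by rwa [min_eq_left hn])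
  -- `2 ≤ e`, and the number of doublings is at most `1 + 2 growthConst · T`, which `supportConst ·
  -- (1 + T)` dominates.
  have h2 : (2 : ℝ) ^ n ≤ Real.exp (supportConst M H * (1 + T)) := by
    calc (2 : ℝ) ^ n ≤ Real.exp 1 ^ n := by
          gcongr
          linarith [Real.add_one_le_exp 1]
      _ = Real.exp n := by rw [← Real.exp_nat_mul, mul_one]
      _ ≤ _ := by
          apply Real.exp_le_exp.2
          rw [hC]
          nlinarith [mul_nonneg hW.le hT]
  calc _ ≤ 2 ^ n * (Y + stepConst M H) := by linarith
    _ ≤ Real.exp (supportConst M H * (1 + T)) * (Y + supportConst M H) := by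
        gcongr
        rw [hC]; linarith
    _ = _ := mul_comm _ _

namespace IsSolution

variable {T : ℝ} {f₀ : Phase → ℝ} {ξ₀ η₀ : Space} {ξ η : ℝ → Space} {f : ℝ → Phase → ℝ}
  {φ : ℝ → ℝ → Phase → Phase}

/-- The energies of the plasma particles grow at most exponentially. -/
theorem exists_isLUB (h : IsSolution T f₀ ξ₀ η₀ ξ η f φ) (hf : IsInitialDatum f₀ ξ₀)
    (hT : 0 ≤ T) {K : ℝ} (hK : 0 < K) :
    ∃ Q₀ Q_T : ℝ, IsLUB (initialValues K f₀ ξ₀ η₀) Q₀ ∧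
      IsLUB (trajectoryValues K T f₀ ξ η φ) Q_T ∧
      Q_T ≤ (Q₀ + supportConst (eLpNorm f₀ ∞ volume).toReal (totalEnergy f₀ ξ₀ η₀))
        * Real.exp (supportConst (eLpNorm f₀ ∞ volume).toReal (totalEnergy f₀ ξ₀ η₀)
          * (1 + T)) := by
  obtain ⟨δ, D, B, X, V, hL, htraj, hspeed, hae, hH⟩ := h.exists_isLagrangian hf hT
  have hE := hL.energyBound hT hH
  have h0 : (0 : ℝ) ∈ Icc 0 T := ⟨le_rfl, hT⟩
  obtain ⟨A, hA0, hA⟩ := hL.exists_norm_η_le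
  have hδ := hL.δ_pos
  have hinit : ∀ z ∈ tsupport f₀, φ 0 0 z = z := fun z hz =>
    h.flow_init 0 h0 z (by rwa [h.apply_zero hf hT])
  have hbd : ∀ z ∈ tsupport f₀, ∀ t ∈ Icc 0 T, √(particleEnergy K (ξ t) (η t) (φ 0 t z))
      ≤ √((B + A) ^ 2 / 2 + 1 / δ + K) := by
    intro z hz t ht
    apply Real.sqrt_le_sqrt
    unfold particleEnergy
    have h1 : ‖(φ 0 t z).2 - η t‖ ≤ B + A :=
      (norm_sub_le _ _).trans (add_le_add (hspeed z hz t ht) (hA t ht))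
    have h2 : δ ≤ ‖(φ 0 t z).1 - ξ t‖ := (htraj z hz).lower t ht
    gcongr
  -- Mass one excludes an empty support, for which the set of values would have no least upper
  -- bound.
  have hne : (tsupport f₀).Nonempty := by
    by_contra hemp
    have h1 : f₀ = 0 := by
      rw [← tsupport_eq_empty_iff, ← not_nonempty_iff_eq_empty]; exact hemp
    have := hf.integral_eq_one
    simp [h1] at this
  obtain ⟨z₀, hz₀⟩ := hne
  have hsub : initialValues K f₀ ξ₀ η₀ ⊆ trajectoryValues K T f₀ ξ η φ := by
    rintro r ⟨z, hz, rfl⟩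
    exact ⟨0, h0, z, hz, by rw [hinit z hz, h.ξ_zero, h.η_zero]⟩
  have hbdd : BddAbove (trajectoryValues K T f₀ ξ η φ) := by
    refine ⟨√((B + A) ^ 2 / 2 + 1 / δ + K), ?_⟩
    rintro r ⟨t, ht, z, hz, rfl⟩
    exact hbd z hz t ht
  have hne0 : (initialValues K f₀ ξ₀ η₀).Nonempty := ⟨_, z₀, hz₀, rfl⟩
  refine ⟨_, _, isLUB_csSup hne0 (hbdd.mono hsub), isLUB_csSup (hne0.mono hsub) hbdd, ?_⟩
  refine csSup_le (hne0.mono hsub) ?_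
  rintro r ⟨t, ht, z, hz, rfl⟩
  refine hL.sqrt_particleEnergy_le_exp hE hK hT htraj hae hbd (fun z hz => ?_) z hz t ht
  rw [hinit z hz, h.ξ_zero, h.η_zero]
  exact le_csSup (hbdd.mono hsub) ⟨z, hz, rfl⟩

end IsSolution

end PlasmaCharge
end

open PlasmaCharge in
theorem mainTheorem3 :
    ∃ C₁ : ℝ → ℝ → ℝ, (∀ M H : ℝ, 0 < C₁ M H) ∧
      ∀ (f₀ : Phase → ℝ) (ξ₀ η₀ : Space), IsInitialDatum f₀ ξ₀ →
      ∀ (M H K₁ : ℝ), M = (eLpNorm f₀ ∞ volume).toReal → H = totalEnergy f₀ ξ₀ η₀ →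
        max (8 * H) 1 ≤ K₁ →
      ∀ (T : ℝ), 0 < T →
      ∀ (ξ η : ℝ → Space) (f : ℝ → Phase → ℝ) (φ : ℝ → ℝ → Phase → Phase),
        IsSolution T f₀ ξ₀ η₀ ξ η f φ →
        ∃ Q₀ Q_T : ℝ, IsLUB (initialValues K₁ f₀ ξ₀ η₀) Q₀ ∧
          IsLUB (trajectoryValues K₁ T f₀ ξ η φ) Q_T ∧
          Q_T ≤ (Q₀ + C₁ M H) * Real.exp (C₁ M H * (1 + T)) := by
  refine ⟨supportConst, supportConst_pos, ?_⟩
  rintro f₀ ξ₀ η₀ hf M H K₁ rfl rfl hK T hT ξ η f φ h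
  exact h.exists_isLUB hf hT.le (one_pos.trans_le ((le_max_right _ _).trans hK))
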